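/- \textbf{Theorem.} The search problem \textsc{Index} is PPP-complete; that is, \textsc{Index} $\in$ PPP, and every problem in PPP is reducible to \textsc{Index}. \textbf{Search problems.} A \emph{total NP search problem} is a relation $S\subseteq\{0,1\}^*\times\{0,1\}^*$ such that $(x,y)\in S$ is decidable in time polynomial in $|x|+|y|$, and for some polynomial $q$ every $x\in\{0,1\}^*$ has some $y$ with $(x,y)\in S$ and $|y|\le q(|x|)$. Problems are given by their instances (encoded as strings) and the solutions of each instance; for a string that encodes no instance, every string is a solution. A \emph{reduction} from $S$ to $T$ is a pair of polynomial-time computable functions $f,g:\{0,1\}^*\to\{0,1\}^*$ such that, for all $x,y$, $(f(x),y)\in T$ implies $(x,g(y))\in S$. \textbf{Pigeon and PPP.} An instance of \textsc{Pigeon} is a Boolean circuit $C$ with $n$ inputs and $n$ outputs; a solution is either $u\in\{0,1\}^n$ with $C(u)=0^n$, or a pair of distinct $u,v\in\{0,1\}^n$ with $C(u)=C(v)$. PPP is the class of all total NP search problems that are reducible to \textsc{Pigeon}. \textbf{Index.} Write $[s]=\{0,\dots,s-1\}$. An instance of \textsc{Index} is a tuple $(s,f,id,g,t)$, where $s\ge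 2$ is an integer (given in binary), $f$ is a Boolean circuit with $2l$ inputs and $l$ outputs, $l=\lceil\log_2 s\rceil$, and $id,g,t\in[s]$. Let $\mathrm{bd}(a)\in\{0,1\}^l$ be the $l$-bit binary representation of $a$ (most significant bit first) and $\mathrm{bc}$ its inverse, and put $f_{\mathbb G}(x,y)=\mathrm{bc}(f(\mathrm{bd}(x),\mathrm{bd}(y)))$. The indexing function $\mathcal I_{\mathbb G}:[s]\to[2^l]$ is computed on input $x$ as follows: let $x_m\dots x_1$ be the binary representation of $x$ without leading zeroes (the string $0$ if $x=0$); start with $r=\mathrm{bd}(id)$; for $i=m,\dots,1$ replace $r$ by $f(r,r)$ and then, if $x_i=1$, replace $r$ by $f(\mathrm{bd}(g),r)$; return $\mathrm{bc}(r)$. A solution of the instance is one of the following: \begin{enumerate} \item $x\in[s]$ with $\mathcal I_{\mathbb G}(x)=t$; \item $x,y\in[s]$ (not necessarily distinct) with $f_{\mathbb G}(x,y)\ge s$; \item distinct $x,y\in[s]$ with $\mathcal I_{\mathbb G}(x)=\mathcal I_{\mathbb G}(y)$. \end{enumerate} -/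

import Mathlib

namespace PPPIndex

/-! ### Bit composition and decomposition, most significant bit first -/

/-- `bc (x₁ x₂ … x_k) = ∑ x_{k-i} 2^i`. -/
def bc : List Bool → ℕ
  | [] => 0
  | b :: u => b.toNat * 2 ^ u.length + bc u

/-- `bd k a` is the binary representation of `a` of length `k`, with leading zeroes
(for `a < 2 ^ k`; only such `a` are ever used). -/
def bd : ℕ → ℕ → List Bool
  | 0, _ => []
  | k + 1, a => a.testBit k :: bd k a

/-- The standard binary representation without leading zeroes; zero is represented by `0`. -/
def bd0 (a : ℕ) : List Bool := bd (max 1 a.size) a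

theorem length_bd (k a : ℕ) : (bd k a).length = k := by
  induction k with
  | zero => rfl
  | succ k ih => simp [bd, ih]

theorem bc_bd_mod (k a : ℕ) : bc (bd k a) = a % 2 ^ k := by
  induction k with
  | zero => simp [bd, bc, Nat.mod_one]
  | succ k ih =>
    rw [bd, bc, ih, length_bd, Nat.mod_pow_succ, Nat.toNat_testBit]
    ring

theorem bc_bd {k a : ℕ} (h : a < 2 ^ k) : bc (bd k a) = a := by
  rw [bc_bd_mod, Nat.mod_eq_of_lt h]

theorem bc_lt (u : List Bool) : bc u < 2 ^ u.length := by
  induction u with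
  | nil => simp [bc]
  | cons b u ih =>
    rw [bc, List.length_cons, pow_succ]
    cases b <;> simp <;> omega

theorem bd_bc (u : List Bool) : bd u.length (bc u) = u := by
  have key : ∀ (k a c : ℕ), a % 2 ^ k = c % 2 ^ k → bd k a = bd k c := by
    intro k
    induction k with
    | zero => intros; rfl
    | succ k ih =>
      intro a c h
      have h1 : a.testBit k = c.testBit k := by
        have := congrArg (fun z => z.testBit k) h
        simpa [Nat.testBit_mod_two_pow] using this
      have h2 : a % 2 ^ k = c % 2 ^ k := by
        have := congrArg (fun z => z % 2 ^ k) h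
        simpa [Nat.mod_mod_of_dvd _ (pow_dvd_pow 2 (Nat.le_succ k))] using this
      rw [bd, bd, h1, ih a c h2]
  induction u with
  | nil => rfl
  | cons b u ih =>
    rw [List.length_cons, bd, bc]
    congr 1
    · have := bc_lt u
      cases b
      · simp [Nat.testBit_lt_two_pow this]
      · simp [Nat.testBit_two_pow_add_eq, Nat.testBit_lt_two_pow this]
    · refine (key _ _ _ ?_).trans ih
      simp

theorem bc_bd0 (a : ℕ) : bc (bd0 a) = a :=
  bc_bd (lt_of_lt_of_le a.lt_size_self (Nat.pow_le_pow_right (by norm_num) (le_max_right _ _)))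

/-! ### Polynomial time, total search problems, reductions -/

/-- Computable in polynomial time by a (multi-stack) Turing machine, for given encodings of
arguments and values as bit strings. -/
def PolyTime {α β : Type} (ea : α → List Bool) (eb : β → List Bool) (f : α → β) : Prop :=
  Nonempty (Turing.TM2ComputableInPolyTime ea eb f)

/-- A search problem: `S x y` says that the string `y` is a solution for the string `x`. -/
abbrev SearchProblem := List Bool → List Bool → Prop

/-- Encoding of a list, given the encoding of its entries: `1` before each entry, and a final `0`. -/
def encList {α : Type} (e : α → List Bool) : List α → List Bool
  | [] => [false]
  | a :: l => true :: (e a ++ encList e l)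

/-- Self-delimiting encoding of a bit string. -/
def encStr : List Bool → List Bool := encList fun b => [b]

/-- Encoding of a pair of bit strings, of length `2|x| + 1 + |y|`. -/
def encPair (p : List Bool × List Bool) : List Bool := encStr p.1 ++ p.2

/-- Total NP search problems. -/
def IsTFNP (S : SearchProblem) : Prop :=
  (∃ d : List Bool × List Bool → Bool,
    PolyTime encPair (fun b => [b]) d ∧ ∀ x y, d (x, y) = true ↔ S x y) ∧
  ∃ q : Polynomial ℕ, ∀ x, ∃ y, S x y ∧ y.length ≤ q.eval x.length

/-- `S` is reducible to `T`. The function `g` that translates solutions back sees only the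
solution. -/
def Reducible (S T : SearchProblem) : Prop :=
  ∃ f g : List Bool → List Bool, PolyTime id id f ∧ PolyTime id id g ∧
    ∀ x y, T (f x) y → S x (g y)

/-- The search problem given by a type `I` of instances, an injective encoding of instances by
strings, and the solutions of each instance. For a string that encodes no instance, every string is
a solution. -/
def searchProblem {I : Type} (enc : I → List Bool) (Sol : I → List Bool → Prop) : SearchProblem :=
  fun x y => ∀ i, enc i = x → Sol i y

/-! ### Boolean circuits -/

/-- A gate refers to earlier wires by their numbers. -/
inductive Gate where
  | const (b : Bool)
  | not (i : ℕ)
  | and (i j : ℕ)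
  | or (i j : ℕ)

/-- All wires that the gate refers to have numbers below `w`. -/
def Gate.Below (w : ℕ) : Gate → Prop
  | .const _ => True
  | .not i => i < w
  | .and i j => i < w ∧ j < w
  | .or i j => i < w ∧ j < w

/-- Value of a gate, given the values of the earlier wires. -/
def Gate.eval (w : List Bool) : Gate → Bool
  | .const b => b
  | .not i => !(w.getD i false)
  | .and i j => w.getD i false && w.getD j false
  | .or i j => w.getD i false || w.getD j false

/-- Each gate of the list refers only to the first `w` wires and to earlier gates of the list. -/
def GatesBelow : ℕ → List Gate → Prop
  | _, [] => True
  | w, a :: l => a.Below w ∧ GatesBelow (w + 1) l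

/-- A Boolean circuit with `n` inputs and `m` outputs, as a list of gates in topological order.
Wires `0, …, n - 1` are the inputs, and wire `n + k` is the value of gate number `k`. -/
@[ext]
structure Circuit (n m : ℕ) where
  gates : List Gate
  outputs : List ℕ
  gates_below : GatesBelow n gates
  outputs_below : ∀ o ∈ outputs, o < n + gates.length
  length_outputs : outputs.length = m

/-- The value of the circuit on an input string (of length `n`). -/
def Circuit.eval {n m : ℕ} (C : Circuit n m) (u : List Bool) : List Bool :=
  let w := C.gates.foldl (fun w a => w ++ [a.eval w]) u
  C.outputs.map fun o => w.getD o false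

theorem Circuit.length_eval {n m : ℕ} (C : Circuit n m) (u : List Bool) :
    (C.eval u).length = m := by
  simp [Circuit.eval, C.length_outputs]

/-- Wire numbers are encoded in unary. They are bounded by the number of wires, so the length of
the encoding of a circuit is polynomial in its size. -/
def encUnary (k : ℕ) : List Bool := List.replicate k true ++ [false]

def encGate : Gate → List Bool
  | .const b => [false, false, b]
  | .not i => [false, true] ++ encUnary i
  | .and i j => [true, false] ++ encUnary i ++ encUnary j
  | .or i j => [true, true] ++ encUnary i ++ encUnary j

def encCircuit {n m : ℕ} (C : Circuit n m) : List Bool :=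
  encUnary n ++ encList encGate C.gates ++ encList encUnary C.outputs

/-! ### Pigeon and PPP -/

/-- An instance of Pigeon: a circuit with `n` inputs and `n` outputs. -/
structure PigeonInput where
  n : ℕ
  C : Circuit n n

def PigeonInput.enc (i : PigeonInput) : List Bool := encCircuit i.C

/-- Solutions of Pigeon; a solution is written as the list of its one or two strings. -/
def PigeonInput.Sol (i : PigeonInput) (y : List Bool) : Prop :=
  (∃ u : List Bool, u.length = i.n ∧ y = encList encStr [u] ∧
    i.C.eval u = List.replicate i.n false) ∨
  (∃ u v : List Bool, u.length = i.n ∧ v.length = i.n ∧ y = encList encStr [u, v] ∧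
    u ≠ v ∧ i.C.eval u = i.C.eval v)

def Pigeon : SearchProblem := searchProblem PigeonInput.enc PigeonInput.Sol

/-- The class of all total NP search problems that are reducible to Pigeon. -/
def PPP : Set SearchProblem := {S | IsTFNP S ∧ Reducible S Pigeon}

def IsPPPComplete (S : SearchProblem) : Prop :=
  S ∈ PPP ∧ ∀ T ∈ PPP, Reducible T S

/-! ### Index -/

/-- An instance `(s, f, id, g, t)` of Index. -/
structure IndexInput where
  s : ℕ
  two_le : 2 ≤ s
  f : Circuit (2 * Nat.clog 2 s) (Nat.clog 2 s)
  ident : Fin s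
  gen : Fin s
  target : Fin s

namespace IndexInput

variable (i : IndexInput)

/-- The length `⌈log₂ s⌉` of the strings that represent elements of `[s]`. -/
def l : ℕ := Nat.clog 2 i.s

/-- The circuit `f` as a binary operation on strings of length `l`. -/
def op (u v : List Bool) : List Bool := i.f.eval (u ++ v)

/-- The operation `f_𝔾 (x, y) = bc (f (bd x, bd y))`. -/
def fG (x y : ℕ) : ℕ := bc (i.op (bd i.l x) (bd i.l y))

/-- The indexing function: square-and-multiply along the binary representation of `x`. -/
def indexFun (x : ℕ) : ℕ :=
  bc ((bd0 x).foldl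
    (fun r b =>
      let r' := i.op r r
      if b then i.op (bd i.l i.gen) r' else r')
    (bd i.l i.ident))

def enc : List Bool :=
  encStr (bd0 i.s) ++ (encCircuit i.f ++
    (encStr (bd i.l i.ident) ++ (encStr (bd i.l i.gen) ++ encStr (bd i.l i.target))))

/-- Solutions of Index; a solution is written as the list of its one or two elements of `[s]`, each
represented by `l` bits. -/
def Sol (y : List Bool) : Prop :=
  (∃ x < i.s, y = encList encStr [bd i.l x] ∧ i.indexFun x = i.target) ∨
  (∃ x < i.s, ∃ z < i.s, y = encList encStr [bd i.l x, bd i.l z] ∧ i.s ≤ i.fG x z) ∨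
  (∃ x < i.s, ∃ z < i.s, y = encList encStr [bd i.l x, bd i.l z] ∧
    x ≠ z ∧ i.indexFun x = i.indexFun z)

end IndexInput

def Index : SearchProblem := searchProblem IndexInput.enc IndexInput.Sol

/-! ### The encodings are injective -/

/-- Encoded objects can be read off the front of a string unambiguously. -/
def PrefixInj {α : Type} (e : α → List Bool) : Prop :=
  ∀ a b u v, e a ++ u = e b ++ v → a = b ∧ u = v

theorem prefixInj_encList {α : Type} {e : α → List Bool} (he : PrefixInj e) :
    PrefixInj (encList e) := by
  intro a
  induction a with
  | nil =>
    intro b u v h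
    cases b with
    | nil => simpa [encList] using h
    | cons => simp [encList] at h
  | cons a l ih =>
    intro b u v h
    cases b with
    | nil => simp [encList] at h
    | cons b l' =>
      simp only [encList, List.cons_append, List.append_assoc, List.cons.injEq, true_and] at h
      obtain ⟨h1, h2⟩ := he _ _ _ _ h
      obtain ⟨h3, h4⟩ := ih _ _ _ h2
      exact ⟨by rw [h1, h3], h4⟩

theorem prefixInj_encStr : PrefixInj encStr :=
  prefixInj_encList fun a b u v h => by simpa using h

theorem prefixInj_encUnary : PrefixInj encUnary := by
  intro a
  induction a with
  | zero =>
    intro b u v h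
    cases b with
    | zero => simpa [encUnary] using h
    | succ => simp [encUnary, List.replicate_succ] at h
  | succ a ih =>
    intro b u v h
    cases b with
    | zero => simp [encUnary, List.replicate_succ] at h
    | succ b =>
      obtain ⟨h1, h2⟩ := ih b u v (by simpa [encUnary, List.replicate_succ] using h)
      exact ⟨by rw [h1], h2⟩

theorem prefixInj_encGate : PrefixInj encGate := by
  intro a b u v h
  cases a <;> cases b <;> simp [encGate] at h
  · exact ⟨by rw [h.1], h.2⟩
  · obtain ⟨h1, h2⟩ := prefixInj_encUnary _ _ _ _ h
    exact ⟨by rw [h1], h2⟩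
  · obtain ⟨h1, h2⟩ := prefixInj_encUnary _ _ _ _ h
    obtain ⟨h3, h4⟩ := prefixInj_encUnary _ _ _ _ h2
    exact ⟨by rw [h1, h3], h4⟩
  · obtain ⟨h1, h2⟩ := prefixInj_encUnary _ _ _ _ h
    obtain ⟨h3, h4⟩ := prefixInj_encUnary _ _ _ _ h2
    exact ⟨by rw [h1, h3], h4⟩

theorem encCircuit_append_inj {n m n' m' : ℕ} {C : Circuit n m} {C' : Circuit n' m'}
    {u v : List Bool} (h : encCircuit C ++ u = encCircuit C' ++ v) :
    n = n' ∧ m = m' ∧ HEq C C' ∧ u = v := by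
  simp only [encCircuit, List.append_assoc] at h
  obtain ⟨hn, h0⟩ := prefixInj_encUnary _ _ _ _ h
  subst hn
  obtain ⟨h1, h3⟩ := prefixInj_encList prefixInj_encGate _ _ _ _ h0
  obtain ⟨h2, h4⟩ := prefixInj_encList prefixInj_encUnary _ _ _ _ h3
  have hm : m = m' := by rw [← C.length_outputs, ← C'.length_outputs, h2]
  subst hm
  exact ⟨rfl, rfl, heq_of_eq (Circuit.ext h1 h2), h4⟩

theorem PigeonInput.enc_injective : Function.Injective PigeonInput.enc := by
  rintro ⟨n, C⟩ ⟨n', C'⟩ h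
  obtain ⟨rfl, -, h, -⟩ := encCircuit_append_inj (u := []) (v := []) (by simpa [enc] using h)
  rw [eq_of_heq h]

theorem IndexInput.bd_fin_injective {s : ℕ} {a b : Fin s}
    (h : bd (Nat.clog 2 s) a = bd (Nat.clog 2 s) b) : a = b := by
  have key : ∀ c : Fin s, (c : ℕ) < 2 ^ Nat.clog 2 s := fun c =>
    lt_of_lt_of_le c.2 (Nat.le_pow_clog (by norm_num) s)
  have := congrArg bc h
  rw [bc_bd (key a), bc_bd (key b)] at this
  exact Fin.ext this

theorem IndexInput.enc_injective : Function.Injective IndexInput.enc := by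
  rintro ⟨s, hs, f, a, b, c⟩ ⟨s', hs', f', a', b', c'⟩ h
  simp only [enc, l] at h
  obtain ⟨h1, h⟩ := prefixInj_encStr _ _ _ _ h
  have hss : s = s' := by rw [← bc_bd0 s, h1, bc_bd0]
  subst hss
  obtain ⟨-, -, hf, h⟩ := encCircuit_append_inj h
  obtain ⟨ha, h⟩ := prefixInj_encStr _ _ _ _ h
  obtain ⟨hb, h⟩ := prefixInj_encStr _ _ _ _ h
  obtain ⟨hc, -⟩ := prefixInj_encStr _ _ [] [] (by simpa using h)
  rw [eq_of_heq hf, bd_fin_injective ha, bd_fin_injective hb, bd_fin_injective hc]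

end PPPIndex

/-! Index is total by the pigeonhole principle. If no product of two elements of `[s]` leaves `[s]`,
then the indexing function maps `[s]` to itself. It then has a collision, or it is injective, hence
surjective, and attains the target (`IndexInput.exists_sol`). Checking a solution only means
evaluating the circuit along the bits of one or two numbers, so Index is a total NP search problem
(`isTFNP_index`).

Reduction to Pigeon. Extend the indexing function by the identity to the `l`-bit strings outside
`[s]`, and take the bitwise exclusive or with the target. A zero is a preimage of the target; it
lies in `[s]` because the target does. A collision of two elements of `[s]` is a solution of the
third kind. If `u` in `[s]` collides with `v` outside, then the index value of `u` is `v`, so some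
product in its computation left `[s]`; running the computation again finds the first such product, a
solution of the second kind (`Raw.trace_spec`). That rerun needs the instance, while the map back
sees only the solution. Hence the circuit has a further input block `w`, outputs `w` xor `x` for the
encoded instance `x`, and uses the indexing function only if `w = x` (`indexMap`). A zero forces `w
= x`. A collision forces equal blocks `w`, and these must be `x` because for other `w` the map is
injective in the remaining bits. So every Pigeon solution starts with the instance
(`reducible_index_pigeon`).

Reduction from Pigeon. For a circuit `C` on `n` bits take `s = 2 ^ (n + 2)`, so that no product can
leave `[s]`. The operation tells squaring from multiplication by the generator by the last bits of
its arguments: a square has equal last bits, while the generator ends in `1` and a fresh square ends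
in `0`. Squaring shifts the register to the left; multiplication by the generator sets the last bit.
Square-and-multiply therefore writes its own argument into the register. The first bit of the
register can be set only after all `n + 2` bits have been read, so a multiplication that applies `C`
to the interior when the first bit is set does so at most once, in the last round. The indexing
function sends `1m1` to `1C(m)1` and fixes all other strings (`PigeonInput.idx_raw`). With target
`10…01`, its solutions are zeros and collisions of `C`, up to removal of the outer bits
(`reducible_pigeon_index`). Every problem in PPP then reduces to Index by composing reductions
(`Reducible.trans`).

Polynomial time is proved for Turing machines. Structured stack programs compile to machines with
the same number of steps (`Prog.Runs.stepsTo`, `polyTime_of_runs`). Over them stands a calculus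
`PolyF` of functions on tree-coded data, closed under composition, case distinction and folds with
small intermediate values (`PolyF.foldl_of_le`); `PolyF.polyTime` returns to bit strings. Parsers
and circuit constructions are written in this calculus. Arbitrary polynomial-time functions, which
occur in the given reductions, are composed as machines (`PolyTime.comp`). -/

namespace PPPIndex
open Turing

/-! ### Structured programs on finitely many stacks of bits -/

/-- Structured stack programs. -/
inductive Prog (K : Type) where
  | skip
  | push (k : K) (b : Bool)
  | seq (p q : Prog K)
  | case (k : K) (pe pf pt : Prog K)
  | loop (k : K) (pf pt : Prog K)

namespace Prog

variable {K : Type}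

/-- `Runs p s s' n`: the program `p`, started with stacks `s`, ends with stacks `s'` after `n`
steps. `case` pops a bit and branches on it, `loop` does this until the stack is empty. -/
inductive Runs [DecidableEq K] :
    Prog K → (K → List Bool) → (K → List Bool) → ℕ → Prop where
  | skip (s : K → List Bool) : Runs .skip s s 1
  | push (k : K) (b : Bool) (s : K → List Bool) :
      Runs (.push k b) s (Function.update s k (b :: s k)) 1
  | seq {p q : Prog K} {s s' s'' : K → List Bool} {n n' : ℕ} :
      Runs p s s' n → Runs q s' s'' n' → Runs (.seq p q) s s'' (n + n')
  | case_nil {k : K} {pe pf pt : Prog K} {s s' : K → List Bool} {n : ℕ} :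
      s k = [] → Runs pe s s' n → Runs (.case k pe pf pt) s s' (n + 1)
  | case_cons {k : K} {pe pf pt : Prog K} {s s' : K → List Bool} {n : ℕ} {b : Bool}
      {u : List Bool} : s k = b :: u →
      Runs (cond b pt pf) (Function.update s k u) s' n → Runs (.case k pe pf pt) s s' (n + 1)
  | loop_nil {k : K} {pf pt : Prog K} {s : K → List Bool} :
      s k = [] → Runs (.loop k pf pt) s s 1
  | loop_cons {k : K} {pf pt : Prog K} {s s' s'' : K → List Bool} {n n' : ℕ} {b : Bool}
      {u : List Bool} : s k = b :: u →
      Runs (cond b pt pf) (Function.update s k u) s' n → Runs (.loop k pf pt) s' s'' n' →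
      Runs (.loop k pf pt) s s'' (n + n' + 1)

/-- Labels of the machine code of a program. -/
def Lbl : Prog K → Type
  | .skip => Unit
  | .push _ _ => Unit
  | .seq p q => Lbl p ⊕ Lbl q
  | .case _ pe pf pt => Option (Lbl pe ⊕ (Lbl pf ⊕ Lbl pt))
  | .loop _ pf pt => Option (Lbl pf ⊕ Lbl pt)

theorem finite_lbl (p : Prog K) : Finite p.Lbl := by
  induction p with
  | skip => exact inferInstanceAs (Finite Unit)
  | push => exact inferInstanceAs (Finite Unit)
  | seq p q hp hq => exact inferInstanceAs (Finite (p.Lbl ⊕ q.Lbl))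
  | case k pe pf pt he hf ht =>
    exact inferInstanceAs (Finite (Option (pe.Lbl ⊕ (pf.Lbl ⊕ pt.Lbl))))
  | loop k pf pt hf ht => exact inferInstanceAs (Finite (Option (pf.Lbl ⊕ pt.Lbl)))

/-- The label at which the code of a program starts. -/
def entry : (p : Prog K) → p.Lbl
  | .skip => ()
  | .push _ _ => ()
  | .seq p _ => Sum.inl p.entry
  | .case _ _ _ _ => none
  | .loop _ _ _ => none

/-- The machine code of a program that is placed at the labels `emb` and continues at the label
`e`. -/
def code {Λ : Type} : (p : Prog K) → (p.Lbl → Λ) → Λ → p.Lbl →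
    TM2.Stmt (fun _ : K => Bool) Λ (Option Bool)
  | .skip, _, e, _ => .goto fun _ => e
  | .push k b, _, e, _ => .push k (fun _ => b) (.goto fun _ => e)
  | .seq p q, emb, e, x => Sum.elim
      (p.code (fun y => emb (Sum.inl y)) (emb (Sum.inr q.entry)))
      (q.code (fun y => emb (Sum.inr y)) e) x
  | .case k pe pf pt, emb, e, x => Option.elim x
      (.pop k (fun _ y => y) (.goto fun v => Option.elim v (emb (some (Sum.inl pe.entry)))
        fun b => cond b (emb (some (Sum.inr (Sum.inr pt.entry))))
          (emb (some (Sum.inr (Sum.inl pf.entry))))))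
      (Sum.elim (pe.code (fun y => emb (some (Sum.inl y))) e)
        (Sum.elim (pf.code (fun y => emb (some (Sum.inr (Sum.inl y)))) e)
          (pt.code (fun y => emb (some (Sum.inr (Sum.inr y)))) e)))
  | .loop k pf pt, emb, e, x => Option.elim x
      (.pop k (fun _ y => y) (.goto fun v => Option.elim v e
        fun b => cond b (emb (some (Sum.inr pt.entry))) (emb (some (Sum.inl pf.entry)))))
      (Sum.elim (pf.code (fun y => emb (some (Sum.inl y))) (emb none))
        (pt.code (fun y => emb (some (Sum.inr y))) (emb none)))

end Prog

/-- A machine gets from one configuration to another in exactly `n` steps. -/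
def StepsTo {K : Type} [DecidableEq K] {Γ : K → Type} {Λ σ : Type} (M : Λ → TM2.Stmt Γ Λ σ)
    (n : ℕ) (c c' : TM2.Cfg Γ Λ σ) : Prop :=
  (flip bind (TM2.step M))^[n] (some c) = some c'

section StepsTo

variable {K : Type} [DecidableEq K] {Γ : K → Type} {Λ σ : Type} {M : Λ → TM2.Stmt Γ Λ σ}

theorem StepsTo.trans {n n' : ℕ} {c c' c'' : TM2.Cfg Γ Λ σ} (h : StepsTo M n c c')
    (h' : StepsTo M n' c' c'') : StepsTo M (n + n') c c'' := by
  rw [StepsTo, Nat.add_comm, Function.iterate_add_apply, h, h']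

theorem StepsTo.single {l : Λ} {v : σ} {s : ∀ k, List (Γ k)} {c : TM2.Cfg Γ Λ σ}
    (h : TM2.stepAux (M l) v s = c) : StepsTo M 1 ⟨some l, v, s⟩ c := by
  simp [StepsTo, flip, h]

theorem StepsTo.refl (c : TM2.Cfg Γ Λ σ) : StepsTo M 0 c c := rfl

end StepsTo

namespace Prog

variable {K : Type} [DecidableEq K]

/-- Induction on the run, with placement, exit and register content all general: a subprogram sits
at its own labels, leaves to the label where its parent continues, and may be entered with any
leftover bit in the register. The body of a loop exits to the test of that loop. -/
theorem Runs.stepsTo {p : Prog K} {s s' : K → List Bool} {n : ℕ} (h : Runs p s s' n) {Λ : Type}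
    {M : Λ → TM2.Stmt (fun _ : K => Bool) Λ (Option Bool)} {emb : p.Lbl → Λ} {e : Λ}
    (hM : ∀ x, M (emb x) = p.code emb e x) (v : Option Bool) :
    ∃ v', StepsTo M n ⟨some (emb p.entry), v, s⟩ ⟨some e, v', s'⟩ := by
  induction h generalizing e v with
  | skip s => exact ⟨v, .single (by rw [hM]; simp [code])⟩
  | push k b s => exact ⟨v, .single (by rw [hM]; simp [code])⟩
  | @seq p q s s' s'' n n' _ _ ih ih' =>
    obtain ⟨v1, h1⟩ := ih (emb := fun y => emb (Sum.inl y)) (e := emb (Sum.inr q.entry))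
      (fun x => hM (Sum.inl x)) v
    obtain ⟨v2, h2⟩ := ih' (emb := fun y => emb (Sum.inr y)) (e := e)
      (fun x => hM (Sum.inr x)) v1
    exact ⟨v2, h1.trans h2⟩
  | @case_nil k pe pf pt s s' n hk _ ih =>
    obtain ⟨v1, h1⟩ := ih (emb := fun y => emb (some (Sum.inl y))) (e := e)
      (fun x => hM (some (Sum.inl x))) none
    refine ⟨v1, ?_⟩
    rw [Nat.add_comm]
    refine StepsTo.trans (.single ?_) h1
    rw [hM]
    -- A pop from an empty stack writes the empty tail back.
    have hu : Function.update s k [] = s := by rw [← hk, Function.update_eq_self]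
    simp [code, entry, hk, hu]
  | @case_cons k pe pf pt s s' n b u hk _ ih =>
    cases b
    · obtain ⟨v1, h1⟩ := ih (emb := fun y => emb (some (Sum.inr (Sum.inl y)))) (e := e)
        (fun x => hM (some (Sum.inr (Sum.inl x)))) (some false)
      refine ⟨v1, ?_⟩
      rw [Nat.add_comm]
      refine StepsTo.trans (.single ?_) h1
      rw [hM]
      simp [code, entry, hk]
    · obtain ⟨v1, h1⟩ := ih (emb := fun y => emb (some (Sum.inr (Sum.inr y)))) (e := e)
        (fun x => hM (some (Sum.inr (Sum.inr x)))) (some true)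
      refine ⟨v1, ?_⟩
      rw [Nat.add_comm]
      refine StepsTo.trans (.single ?_) h1
      rw [hM]
      simp [code, entry, hk]
  | @loop_nil k pf pt s hk =>
    refine ⟨none, .single ?_⟩
    rw [hM]
    have hu : Function.update s k [] = s := by rw [← hk, Function.update_eq_self]
    simp [code, entry, hk, hu]
  | @loop_cons k pf pt s s' s'' n n' b u hk _ _ ih ih' =>
    cases b
    · obtain ⟨v1, h1⟩ := ih (emb := fun y => emb (some (Sum.inl y))) (e := emb none)
        (fun x => hM (some (Sum.inl x))) (some false)
      obtain ⟨v2, h2⟩ := ih' hM v1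
      refine ⟨v2, ?_⟩
      rw [Nat.add_comm]
      refine StepsTo.trans (.single ?_) (h1.trans h2)
      rw [hM]
      simp [code, entry, hk]
    · obtain ⟨v1, h1⟩ := ih (emb := fun y => emb (some (Sum.inr y))) (e := emb none)
        (fun x => hM (some (Sum.inr x))) (some true)
      obtain ⟨v2, h2⟩ := ih' hM v1
      refine ⟨v2, ?_⟩
      rw [Nat.add_comm]
      refine StepsTo.trans (.single ?_) (h1.trans h2)
      rw [hM]
      simp [code, entry, hk]

/-- The machine that runs a program, with input and output on the stack `k`. -/
noncomputable def machine [Fintype K] (p : Prog K) (k : K) : FinTM2 where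
  K := K
  k₀ := k
  k₁ := k
  Γ _ := Bool
  Λ := Option p.Lbl
  main := some p.entry
  ΛFin := have := p.finite_lbl; Fintype.ofFinite _
  σ := Option Bool
  initialState := none
  Γk₀Fin := inferInstanceAs (Fintype Bool)
  m x := Option.elim x (.load (fun _ => none) .halt) (p.code some none)

end Prog

/-! ### Initial and final configurations, and the passage to polynomial time -/

theorem initList_eq (tm : FinTM2) (u : List (tm.Γ tm.k₀)) :
    initList tm u = ⟨some tm.main, tm.initialState, Function.update (fun _ => []) tm.k₀ u⟩ := by
  rw [initList]
  congr 1
  funext j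
  by_cases hj : j = tm.k₀
  · subst hj; simp
  · simp [hj]

theorem haltList_eq (tm : FinTM2) (u : List (tm.Γ tm.k₁)) :
    haltList tm u = ⟨none, tm.initialState, Function.update (fun _ => []) tm.k₁ u⟩ := by
  rw [haltList]
  congr 1
  funext j
  by_cases hj : j = tm.k₁
  · subst hj; simp
  · simp [hj]

theorem nonempty_outputsInTime {tm : FinTM2} {u : List (tm.Γ tm.k₀)} {v : List (tm.Γ tm.k₁)}
    {n t : ℕ} (h : StepsTo tm.m n
      ⟨some tm.main, tm.initialState, Function.update (fun _ => []) tm.k₀ u⟩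
      ⟨none, tm.initialState, Function.update (fun _ => []) tm.k₁ v⟩) (hn : n ≤ t) :
    Nonempty (TM2OutputsInTime tm u (some v) t) := by
  refine ⟨⟨⟨n, ?_⟩, hn⟩⟩
  rw [initList_eq, Option.map_some, haltList_eq]
  exact h

/-- A function is computable in polynomial time if a structured program computes it. -/
theorem polyTime_of_runs {K : Type} [DecidableEq K] [Fintype K] (p : Prog K) (k : K)
    {α β : Type} {ea : α → List Bool} {eb : β → List Bool} {f : α → β} (q : Polynomial ℕ)
    (h : ∀ a, ∃ n ≤ q.eval (ea a).length,
      p.Runs (Function.update (fun _ => []) k (ea a))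
        (Function.update (fun _ => []) k (eb (f a))) n) : PolyTime ea eb f := by
  refine ⟨{ tm := p.machine k, inputAlphabet := Equiv.refl _, outputAlphabet := Equiv.refl _,
            time := q + 1, outputsFun := fun a => Classical.choice ?_ }⟩
  obtain ⟨n, hn, hr⟩ := h a
  obtain ⟨v, hv⟩ := hr.stepsTo (M := (p.machine k).m) (emb := some) (e := none)
    (fun x => rfl) none
  -- The exit label costs one more step: a halting configuration must carry the initial state, so
  -- the register is cleared first. This is the `1` in the time bound.
  have h2 := hv.trans (.single (M := (p.machine k).m) (l := none) (v := v) rfl)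
  have e1 : ∀ u : List Bool, List.map (Equiv.refl Bool).invFun u = u := fun u => List.map_id u
  refine nonempty_outputsInTime (n := n + 1) ?_ (by simpa using hn)
  exact (congrArg₂ (fun u w : List Bool => StepsTo (p.machine k).m (n + 1)
      ⟨some (some p.entry), none, Function.update (fun _ => []) k u⟩
      ⟨none, none, Function.update (fun _ => []) k w⟩) (e1 (ea a)).symm (e1 (eb (f a))).symm).mp h2

open Turing

/-! ### Composition of polynomial-time functions -/

theorem monotone_eval_nat (p : Polynomial ℕ) : Monotone fun n => p.eval n := by
  intro a b h
  simp only [Polynomial.eval_eq_sum, Polynomial.sum]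
  exact Finset.sum_le_sum fun i _ => Nat.mul_le_mul_left _ (Nat.pow_le_pow_left h i)

/-- The largest number of symbols that a statement pushes. -/
def pushes {K : Type} {Γ : K → Type} {Λ σ : Type} : TM2.Stmt Γ Λ σ → ℕ
  | .push _ _ q => pushes q + 1
  | .peek _ _ q => pushes q
  | .pop _ _ q => pushes q
  | .load _ q => pushes q
  | .branch _ q q' => pushes q + pushes q'
  | .goto _ => 0
  | .halt => 0

theorem length_stepAux_le {K : Type} [DecidableEq K] {Γ : K → Type} {Λ σ : Type}
    (q : TM2.Stmt Γ Λ σ) (v : σ) (S : ∀ k, List (Γ k)) (k : K) :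
    ((TM2.stepAux q v S).stk k).length ≤ (S k).length + pushes q := by
  induction q generalizing v S with
  | push j f q ih =>
    refine (ih _ _).trans ?_
    by_cases h : k = j
    · subst h; simp [pushes, Nat.add_assoc, Nat.add_comm]
    · simp [pushes, h, ← Nat.add_assoc]
  | peek j f q ih => exact ih _ _
  | pop j f q ih =>
    refine (ih _ _).trans ?_
    by_cases h : k = j
    · subst h; simp [pushes]
    · simp [pushes, h]
  | load f q ih => exact ih _ _
  | branch f q q' ih ih' =>
    simp only [TM2.stepAux, pushes]
    cases f v
    · exact (ih' _ _).trans (by omega)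
    · exact (ih _ _).trans (by omega)
  | goto f => simp [pushes]
  | halt => simp [pushes]

theorem StepsTo.succ_inv {K : Type} [DecidableEq K] {Γ : K → Type} {Λ σ : Type}
    {M : Λ → TM2.Stmt Γ Λ σ} {n : ℕ} {c c' : TM2.Cfg Γ Λ σ} (h : StepsTo M (n + 1) c c') :
    ∃ l, c.l = some l ∧ StepsTo M n (TM2.stepAux (M l) c.var c.stk) c' := by
  have stuck : ∀ n, (flip bind (TM2.step M))^[n] none = none := fun n => by
    induction n with
    | zero => rfl
    | succ n ih => rw [Function.iterate_succ_apply]; exact ih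
  rw [StepsTo, Function.iterate_succ_apply] at h
  obtain ⟨_ | l, v, S⟩ := c
  · have : flip bind (TM2.step M) (some ⟨none, v, S⟩) = none := rfl
    rw [this, stuck] at h
    simp at h
  · exact ⟨l, rfl, h⟩

/-- A step executes one statement, so it pushes at most as much as all statements of the machine
together. In a composition this bounds the output of the first machine, and the time of the second
machine is measured in the length of that output. -/
theorem StepsTo.length_le {K : Type} [DecidableEq K] {Γ : K → Type} {Λ σ : Type} [Fintype Λ]
    {M : Λ → TM2.Stmt Γ Λ σ} {n : ℕ} {c c' : TM2.Cfg Γ Λ σ} (h : StepsTo M n c c') (k : K) :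
    (c'.stk k).length ≤ (c.stk k).length + n * ∑ l, pushes (M l) := by
  induction n generalizing c with
  | zero =>
    obtain rfl : c = c' := Option.some.inj h
    simp
  | succ n ih =>
    obtain ⟨l, -, h⟩ := h.succ_inv
    refine (ih h).trans ?_
    have h1 := length_stepAux_le (M l) c.var c.stk k
    have h2 := Finset.single_le_sum (f := fun l => pushes (M l)) (fun _ _ => Nat.zero_le _)
      (Finset.mem_univ l)
    rw [Nat.succ_mul]
    omega

/-! ### Two machines run one after the other -/

namespace Compose

variable {K₁ K₂ : Type} (Γ₁ : K₁ → Type) (Γ₂ : K₂ → Type)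

/-- Alphabets of the composition: the stks of both machines, and one more stack. -/
abbrev Alph : Option (K₁ ⊕ K₂) → Type
  | none => Bool
  | some (Sum.inl k) => Γ₁ k
  | some (Sum.inr k) => Γ₂ k

variable {Γ₁ Γ₂}

def stks (S₁ : ∀ k, List (Γ₁ k)) (S₂ : ∀ k, List (Γ₂ k)) (u : List Bool) :
    ∀ k, List (Alph Γ₁ Γ₂ k)
  | none => u
  | some (Sum.inl k) => S₁ k
  | some (Sum.inr k) => S₂ k

variable [DecidableEq K₁] [DecidableEq K₂]

theorem update_inl (S₁ : ∀ k, List (Γ₁ k)) (S₂ : ∀ k, List (Γ₂ k)) (u : List Bool) (k : K₁)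
    (x : List (Γ₁ k)) : Function.update (stks S₁ S₂ u) (some (Sum.inl k)) x =
      stks (Function.update S₁ k x) S₂ u := by
  funext j
  rcases j with _ | j | j
  · rfl
  · by_cases h : j = k
    · subst h; simp [stks]
    · rw [Function.update_of_ne (by simpa using h)]; simp [stks, h]
  · rfl

theorem update_inr (S₁ : ∀ k, List (Γ₁ k)) (S₂ : ∀ k, List (Γ₂ k)) (u : List Bool) (k : K₂)
    (x : List (Γ₂ k)) : Function.update (stks S₁ S₂ u) (some (Sum.inr k)) x =
      stks S₁ (Function.update S₂ k x) u := by
  funext j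
  rcases j with _ | j | j
  · rfl
  · rfl
  · by_cases h : j = k
    · subst h; simp [stks]
    · rw [Function.update_of_ne (by simpa using h)]; simp [stks, h]

theorem update_none (S₁ : ∀ k, List (Γ₁ k)) (S₂ : ∀ k, List (Γ₂ k)) (u x : List Bool) :
    Function.update (stks S₁ S₂ u) none x = stks S₁ S₂ x := by
  funext j
  rcases j with _ | j | j <;> rfl

variable {Λ₁ Λ₂ σ₁ σ₂ : Type}

/-- Statements of the first machine; instead of halting, start the transfer of the output. -/
def stmt₁ : TM2.Stmt Γ₁ Λ₁ σ₁ →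
    TM2.Stmt (Alph Γ₁ Γ₂) (Λ₁ ⊕ Λ₂ ⊕ Bool) (σ₁ × σ₂ × Option Bool)
  | .push k f q => .push (some (Sum.inl k)) (fun v => f v.1) (stmt₁ q)
  | .peek k f q => .peek (some (Sum.inl k)) (fun v x => (f v.1 x, v.2)) (stmt₁ q)
  | .pop k f q => .pop (some (Sum.inl k)) (fun v x => (f v.1 x, v.2)) (stmt₁ q)
  | .load f q => .load (fun v => (f v.1, v.2)) (stmt₁ q)
  | .branch f q q' => .branch (fun v => f v.1) (stmt₁ q) (stmt₁ q')
  | .goto f => .goto fun v => Sum.inl (f v.1)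
  | .halt => .goto fun _ => Sum.inr (Sum.inr false)

def stmt₂ : TM2.Stmt Γ₂ Λ₂ σ₂ →
    TM2.Stmt (Alph Γ₁ Γ₂) (Λ₁ ⊕ Λ₂ ⊕ Bool) (σ₁ × σ₂ × Option Bool)
  | .push k f q => .push (some (Sum.inr k)) (fun v => f v.2.1) (stmt₂ q)
  | .peek k f q => .peek (some (Sum.inr k)) (fun v x => (v.1, f v.2.1 x, v.2.2)) (stmt₂ q)
  | .pop k f q => .pop (some (Sum.inr k)) (fun v x => (v.1, f v.2.1 x, v.2.2)) (stmt₂ q)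
  | .load f q => .load (fun v => (v.1, f v.2.1, v.2.2)) (stmt₂ q)
  | .branch f q q' => .branch (fun v => f v.2.1) (stmt₂ q) (stmt₂ q')
  | .goto f => .goto fun v => Sum.inr (Sum.inl (f v.2.1))
  | .halt => .halt

/-- The composed machine. Labels `false` and `true` move the output of the first machine to the
auxiliary stack and from there to the input of the second machine. -/
def code (M₁ : Λ₁ → TM2.Stmt Γ₁ Λ₁ σ₁) (M₂ : Λ₂ → TM2.Stmt Γ₂ Λ₂ σ₂) (k₁ : K₁) (k₂ : K₂)
    (e₁ : Γ₁ k₁ ≃ Bool) (e₂ : Γ₂ k₂ ≃ Bool) (main₂ : Λ₂) :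
    Λ₁ ⊕ Λ₂ ⊕ Bool → TM2.Stmt (Alph Γ₁ Γ₂) (Λ₁ ⊕ Λ₂ ⊕ Bool) (σ₁ × σ₂ × Option Bool)
  | Sum.inl l => stmt₁ (M₁ l)
  | Sum.inr (Sum.inl l) => stmt₂ (M₂ l)
  | Sum.inr (Sum.inr false) =>
    .pop (some (Sum.inl k₁)) (fun v x => (v.1, v.2.1, Option.map e₁ x))
      (.branch (fun v => v.2.2.isSome)
        (.push none (fun v => v.2.2.getD false) (.goto fun _ => Sum.inr (Sum.inr false)))
        (.goto fun _ => Sum.inr (Sum.inr true)))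
  | Sum.inr (Sum.inr true) =>
    .pop none (fun v x => (v.1, v.2.1, x))
      (.branch (fun v => v.2.2.isSome)
        (.push (some (Sum.inr k₂)) (fun v => e₂.symm (v.2.2.getD false))
          (.goto fun _ => Sum.inr (Sum.inr true)))
        (.goto fun _ => Sum.inr (Sum.inl main₂)))

variable {M₁ : Λ₁ → TM2.Stmt Γ₁ Λ₁ σ₁} {M₂ : Λ₂ → TM2.Stmt Γ₂ Λ₂ σ₂} {k₁ : K₁} {k₂ : K₂}
  {e₁ : Γ₁ k₁ ≃ Bool} {e₂ : Γ₂ k₂ ≃ Bool} {main₂ : Λ₂}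

def lift₁ (v₂ : σ₂) (r : Option Bool) (S₂ : ∀ k, List (Γ₂ k)) (u : List Bool)
    (c : TM2.Cfg Γ₁ Λ₁ σ₁) : TM2.Cfg (Alph Γ₁ Γ₂) (Λ₁ ⊕ Λ₂ ⊕ Bool) (σ₁ × σ₂ × Option Bool) :=
  ⟨some (c.l.elim (Sum.inr (Sum.inr false)) Sum.inl), (c.var, v₂, r), stks c.stk S₂ u⟩

def lift₂ (v₁ : σ₁) (r : Option Bool) (S₁ : ∀ k, List (Γ₁ k)) (u : List Bool)
    (c : TM2.Cfg Γ₂ Λ₂ σ₂) : TM2.Cfg (Alph Γ₁ Γ₂) (Λ₁ ⊕ Λ₂ ⊕ Bool) (σ₁ × σ₂ × Option Bool) :=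
  ⟨c.l.map fun l => Sum.inr (Sum.inl l), (v₁, c.var, r), stks S₁ c.stk u⟩

/-- A translated statement touches only the stacks and the state of its own machine, so stepping
commutes with the embedding of configurations. Halting turns into entering the transfer phase. -/
theorem stepAux_stmt₁ (q : TM2.Stmt Γ₁ Λ₁ σ₁) (v₁ : σ₁) (v₂ : σ₂) (r : Option Bool)
    (S₁ : ∀ k, List (Γ₁ k)) (S₂ : ∀ k, List (Γ₂ k)) (u : List Bool) :
    TM2.stepAux (stmt₁ (Λ₂ := Λ₂) q) (v₁, v₂, r) (stks S₁ S₂ u) =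
      lift₁ v₂ r S₂ u (TM2.stepAux q v₁ S₁) := by
  induction q generalizing v₁ S₁ with
  | push k f q ih => exact (congrArg _ (update_inl _ _ _ _ _)).trans (ih _ _)
  | peek k f q ih => exact ih _ _
  | pop k f q ih => exact (congrArg _ (update_inl _ _ _ _ _)).trans (ih _ _)
  | load f q ih => exact ih _ _
  | branch f q q' ih ih' =>
    simp only [stmt₁, TM2.stepAux]
    cases f v₁
    · exact ih' _ _
    · exact ih _ _
  | goto f => rfl
  | halt => rfl

theorem stepAux_stmt₂ (q : TM2.Stmt Γ₂ Λ₂ σ₂) (v₁ : σ₁) (v₂ : σ₂) (r : Option Bool)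
    (S₁ : ∀ k, List (Γ₁ k)) (S₂ : ∀ k, List (Γ₂ k)) (u : List Bool) :
    TM2.stepAux (stmt₂ (Λ₁ := Λ₁) q) (v₁, v₂, r) (stks S₁ S₂ u) =
      lift₂ v₁ r S₁ u (TM2.stepAux q v₂ S₂) := by
  induction q generalizing v₂ S₂ with
  | push k f q ih => exact (congrArg _ (update_inr _ _ _ _ _)).trans (ih _ _)
  | peek k f q ih => exact ih _ _
  | pop k f q ih => exact (congrArg _ (update_inr _ _ _ _ _)).trans (ih _ _)
  | load f q ih => exact ih _ _
  | branch f q q' ih ih' =>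
    simp only [stmt₂, TM2.stepAux]
    cases f v₂
    · exact ih' _ _
    · exact ih _ _
  | goto f => rfl
  | halt => rfl

theorem stepsTo_lift₁ {n : ℕ} {c c' : TM2.Cfg Γ₁ Λ₁ σ₁} (h : StepsTo M₁ n c c') (v₂ : σ₂)
    (r : Option Bool) (S₂ : ∀ k, List (Γ₂ k)) (u : List Bool) :
    StepsTo (code M₁ M₂ k₁ k₂ e₁ e₂ main₂) n (lift₁ v₂ r S₂ u c) (lift₁ v₂ r S₂ u c') := by
  induction n generalizing c with
  | zero =>
    obtain rfl : c = c' := Option.some.inj h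
    exact .refl _
  | succ n ih =>
    obtain ⟨l, hl, h⟩ := h.succ_inv
    rw [Nat.add_comm]
    refine StepsTo.trans ?_ (ih h)
    obtain ⟨_, v, S⟩ := c
    subst hl
    exact .single (stepAux_stmt₁ _ _ _ _ _ _ _)

theorem stepsTo_lift₂ {n : ℕ} {c c' : TM2.Cfg Γ₂ Λ₂ σ₂} (h : StepsTo M₂ n c c') (v₁ : σ₁)
    (r : Option Bool) (S₁ : ∀ k, List (Γ₁ k)) (u : List Bool) :
    StepsTo (code M₁ M₂ k₁ k₂ e₁ e₂ main₂) n (lift₂ v₁ r S₁ u c) (lift₂ v₁ r S₁ u c') := by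
  induction n generalizing c with
  | zero =>
    obtain rfl : c = c' := Option.some.inj h
    exact .refl _
  | succ n ih =>
    obtain ⟨l, hl, h⟩ := h.succ_inv
    rw [Nat.add_comm]
    refine StepsTo.trans ?_ (ih h)
    obtain ⟨_, v, S⟩ := c
    subst hl
    exact .single (stepAux_stmt₂ _ _ _ _ _ _ _)

/-- Moving a string to the auxiliary stack reverses it, and moving it on reverses it back. The
detour through `Bool` also translates between the two alphabets. -/
theorem stepsTo_out (v₁ : σ₁) (v₂ : σ₂) (r : Option Bool) (S₂ : ∀ k, List (Γ₂ k))
    (x u : List Bool) :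
    StepsTo (code M₁ M₂ k₁ k₂ e₁ e₂ main₂) (x.length + 1)
      ⟨some (Sum.inr (Sum.inr false)), (v₁, v₂, r),
        stks (Function.update (fun _ => []) k₁ (x.map e₁.symm)) S₂ u⟩
      ⟨some (Sum.inr (Sum.inr true)), (v₁, v₂, none), stks (fun _ => []) S₂ (x.reverse ++ u)⟩ := by
  induction x generalizing r u with
  | nil => exact .single (by simp [code, stks, update_inl])
  | cons b x ih =>
    rw [List.length_cons, Nat.add_comm]
    refine StepsTo.trans (.single ?_) (Eq.trans (ih (some b) (b :: u)) ?_)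
    · simp [code, stks, update_inl, update_none]
    · simp

theorem stepsTo_in (v₁ : σ₁) (v₂ : σ₂) (r : Option Bool) (S₁ : ∀ k, List (Γ₁ k))
    (x u : List Bool) :
    StepsTo (code M₁ M₂ k₁ k₂ e₁ e₂ main₂) (x.length + 1)
      ⟨some (Sum.inr (Sum.inr true)), (v₁, v₂, r),
        stks S₁ (Function.update (fun _ => []) k₂ (u.map e₂.symm)) x⟩
      ⟨some (Sum.inr (Sum.inl main₂)), (v₁, v₂, none),
        stks S₁ (Function.update (fun _ => []) k₂ ((x.reverse ++ u).map e₂.symm)) []⟩ := by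
  induction x generalizing r u with
  | nil => exact .single (by simp [code, stks, update_none])
  | cons b x ih =>
    rw [List.length_cons, Nat.add_comm]
    refine StepsTo.trans (.single ?_) (Eq.trans (ih (some b) (b :: u)) ?_)
    · simp [code, stks, update_inr, update_none]
    · simp

/-- The composed machine, with its finiteness data. -/
def machine (A B : FinTM2) (e₁ : A.Γ A.k₁ ≃ Bool) (e₂ : B.Γ B.k₀ ≃ Bool) : FinTM2 :=
  letI := A.kFin
  letI := B.kFin
  letI := A.ΛFin
  letI := B.ΛFin
  letI := A.σFin
  letI := B.σFin
  { K := Option (A.K ⊕ B.K)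
    k₀ := some (Sum.inl A.k₀)
    k₁ := some (Sum.inr B.k₁)
    Γ := Alph A.Γ B.Γ
    Λ := A.Λ ⊕ B.Λ ⊕ Bool
    main := Sum.inl A.main
    σ := A.σ × B.σ × Option Bool
    initialState := (A.initialState, B.initialState, none)
    Γk₀Fin := A.Γk₀Fin
    m := code A.m B.m A.k₁ B.k₀ e₁ e₂ B.main }

end Compose

/-- The reductions that witness membership in PPP are known only through their machines, so the
composition has to be built from machines rather than from programs. -/
theorem PolyTime.comp {α β γ : Type} {ea : α → List Bool} {eb : β → List Bool}
    {ec : γ → List Bool} {f : α → β} {g : β → γ} (hg : PolyTime eb ec g)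
    (hf : PolyTime ea eb f) : PolyTime ea ec fun a => g (f a) := by
  obtain ⟨⟨⟨A, iA, oA⟩, tA, hA⟩⟩ := hf
  obtain ⟨⟨⟨B, iB, oB⟩, tB, hB⟩⟩ := hg
  simp only at hA hB
  let := A.ΛFin
  obtain ⟨c, hc⟩ : ∃ c, c = ∑ l, pushes (A.m l) := ⟨_, rfl⟩
  -- Length of the intermediate string: the input, and at most `c` pushes in each of at most `tA`
  -- steps.
  let len : Polynomial ℕ := Polynomial.X + tA * Polynomial.C c
  refine ⟨{ tm := Compose.machine A B oA iB, inputAlphabet := iA, outputAlphabet := oB,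
            time := tA + (len + 1) + (len + 1) + tB.comp len,
            outputsFun := fun a => Classical.choice ?_ }⟩
  obtain ⟨⟨n, hn⟩, hnt⟩ := hA a
  obtain ⟨⟨m, hm⟩, hmt⟩ := hB (f a)
  rw [initList_eq, Option.map_some, haltList_eq] at hn hm
  have hlen : (eb (f a)).length ≤ len.eval (ea a).length := by
    have := StepsTo.length_le (M := A.m) (show StepsTo A.m n _ _ from hn) A.k₁
    simp only [Function.update_self, List.length_map] at this
    refine this.trans ?_
    simp only [len, Polynomial.eval_add, Polynomial.eval_X, Polynomial.eval_mul,
      Polynomial.eval_C, ← hc]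
    refine Nat.add_le_add ?_ (Nat.mul_le_mul_right _ hnt)
    -- The output stack starts with the input if it is also the input stack, and empty otherwise.
    by_cases h : A.k₁ = A.k₀
    · rw [h]; simp
    · simp [h]
  have s1 := Compose.stepsTo_lift₁ (M₂ := B.m) (k₁ := A.k₁) (k₂ := B.k₀) (e₁ := oA) (e₂ := iB)
    (main₂ := B.main) (show StepsTo A.m n _ _ from hn) B.initialState none (fun _ => []) []
  have s2 := Compose.stepsTo_out (M₁ := A.m) (M₂ := B.m) (k₁ := A.k₁) (k₂ := B.k₀) (e₁ := oA)
    (e₂ := iB) (main₂ := B.main) A.initialState B.initialState none (fun _ => []) (eb (f a)) []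
  have s3 := Compose.stepsTo_in (M₁ := A.m) (M₂ := B.m) (k₁ := A.k₁) (k₂ := B.k₀) (e₁ := oA)
    (e₂ := iB) (main₂ := B.main) A.initialState B.initialState none (fun _ => [])
    (eb (f a)).reverse []
  have s4 := Compose.stepsTo_lift₂ (M₁ := A.m) (k₁ := A.k₁) (k₂ := B.k₀) (e₁ := oA) (e₂ := iB)
    (main₂ := B.main) (show StepsTo B.m m _ _ from hm) A.initialState none (fun _ => []) []
  simp only [List.append_nil, List.reverse_reverse, List.length_reverse, List.map_nil,
    Function.update_eq_self] at s2 s3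
  have s := ((s1.trans s2).trans s3).trans s4
  have hs : (Compose.stks (fun _ => []) (fun _ => []) [] :
      ∀ k, List (Compose.Alph A.Γ B.Γ k)) = fun _ => [] := by
    funext k
    rcases k with _ | k | k <;> rfl
  refine nonempty_outputsInTime (tm := Compose.machine A B oA iB) 
    (n := n + ((eb (f a)).length + 1) + ((eb (f a)).length + 1) + m) ?_ ?_
  · refine (congrArg₂ (StepsTo _ _) ?_ ?_).mp s
    · refine congrArg (TM2.Cfg.mk _ _) ((Compose.update_inl _ _ _ _ _).symm.trans ?_)
      rw [hs]; rfl
    · refine congrArg (TM2.Cfg.mk _ _) ((Compose.update_inr _ _ _ _ _).symm.trans ?_)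
      rw [hs]; rfl
  · simp only [Polynomial.eval_add, Polynomial.eval_comp, Polynomial.eval_one]
    exact Nat.add_le_add (Nat.add_le_add (Nat.add_le_add hnt (Nat.add_le_add_right hlen _))
      (Nat.add_le_add_right hlen _)) (hmt.trans (monotone_eval_nat _ hlen))


/-! ### Programs that work on serialized trees -/

-- Every push costs a step. Hence a time bound is also a bound on the size of the result, which is
-- what makes `PolyF` closed under composition.
open Prog in
theorem Prog.Runs.length_le {K : Type} [DecidableEq K] {p : Prog K} {s s' : K → List Bool} {n : ℕ}
    (h : Runs p s s' n) (k : K) : (s' k).length ≤ (s k).length + n := by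
  induction h with
  | skip => omega
  | push j b s =>
    by_cases h : k = j
    · subst h; simp
    · simp [h]
  | seq _ _ ih ih' => omega
  | case_nil _ _ ih => omega
  | @case_cons j _ _ _ s _ _ b u hk _ ih =>
    by_cases h : k = j
    · subst h; simp [hk] at ih ⊢; omega
    · simp [h] at ih; omega
  | loop_nil => omega
  | @loop_cons j _ _ s _ _ _ _ b u hk _ _ ih ih' =>
    by_cases h : k = j
    · subst h; simp [hk] at ih ⊢; omega
    · simp [h] at ih; omega

/-- The program `p` leads from `s` to `s'` within `t` steps. -/
def Exec {K : Type} [DecidableEq K] (p : Prog K) (s s' : K → List Bool) (t : ℕ) : Prop :=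
  ∃ n ≤ t, p.Runs s s' n

namespace Exec

variable {K : Type} [DecidableEq K] {p q pe pf pt : Prog K} {s s' s'' : K → List Bool} {t t' : ℕ}

theorem mono (h : Exec p s s' t) (ht : t ≤ t') : Exec p s s' t' :=
  let ⟨n, hn, hr⟩ := h
  ⟨n, hn.trans ht, hr⟩

theorem skip : Exec .skip s s 1 := ⟨1, le_rfl, .skip s⟩

theorem push (k : K) (b : Bool) (h : s' = Function.update s k (b :: s k)) :
    Exec (.push k b) s s' 1 := ⟨1, le_rfl, h ▸ .push k b s⟩

theorem seq (h : Exec p s s' t) (h' : Exec q s' s'' t') : Exec (.seq p q) s s'' (t + t') :=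
  let ⟨n, hn, hr⟩ := h
  let ⟨n', hn', hr'⟩ := h'
  ⟨n + n', Nat.add_le_add hn hn', hr.seq hr'⟩

theorem case_cons (k : K) {b : Bool} {u : List Bool} (hk : s k = b :: u)
    (h : Exec (cond b pt pf) (Function.update s k u) s' t) :
    Exec (.case k pe pf pt) s s' (t + 1) :=
  let ⟨n, hn, hr⟩ := h
  ⟨n + 1, Nat.succ_le_succ hn, .case_cons hk hr⟩

theorem loop_nil {k : K} (hk : s k = []) : Exec (.loop k pf pt) s s 1 := ⟨1, le_rfl, .loop_nil hk⟩

theorem loop_cons {k : K} {b : Bool} {u : List Bool} (hk : s k = b :: u)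
    (h : Exec (cond b pt pf) (Function.update s k u) s' t) (h' : Exec (.loop k pf pt) s' s'' t') :
    Exec (.loop k pf pt) s s'' (t + t' + 1) :=
  let ⟨n, hn, hr⟩ := h
  let ⟨n', hn', hr'⟩ := h'
  ⟨n + n' + 1, by omega, .loop_cons hk hr hr'⟩

end Exec

/-- The state with the given contents of four stacks. -/
def st (m a b c : List Bool) : Fin 4 → List Bool := ![m, a, b, c]

section st
variable (m a b c x : List Bool)
@[simp] theorem st_zero : st m a b c 0 = m := rfl
@[simp] theorem st_one : st m a b c 1 = a := rfl
@[simp] theorem st_two : st m a b c 2 = b := rfl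
@[simp] theorem st_three : st m a b c 3 = c := rfl
@[simp] theorem update_st_zero : Function.update (st m a b c) 0 x = st x a b c := by
  funext i; fin_cases i <;> rfl
@[simp] theorem update_st_one : Function.update (st m a b c) 1 x = st m x b c := by
  funext i; fin_cases i <;> rfl
@[simp] theorem update_st_two : Function.update (st m a b c) 2 x = st m a x c := by
  funext i; fin_cases i <;> rfl
@[simp] theorem update_st_three : Function.update (st m a b c) 3 x = st m a b x := by
  funext i; fin_cases i <;> rfl
end st

/-- Binary trees, the universal data type. -/
inductive Tree2 where
  | nil
  | cons (a b : Tree2)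

namespace Tree2

/-- Serialization of a tree. -/
def ser : Tree2 → List Bool
  | nil => [false]
  | cons a b => true :: (ser a ++ ser b)

def size : Tree2 → ℕ
  | nil => 1
  | cons a b => size a + size b + 1

theorem length_ser (t : Tree2) : t.ser.length = t.size := by
  induction t with
  | nil => rfl
  | cons a b iha ihb => simp [ser, size, iha, ihb]

theorem size_pos (t : Tree2) : 0 < t.size := by cases t <;> simp [size]

end Tree2

open Tree2

namespace Prog

/-- Move all of stack `i` to stack `j`. -/
def mv (i j : Fin 4) : Prog (Fin 4) := .loop i (.push j false) (.push j true)

/-- Move one tree from stack `0` to stack `j`. -/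
def mvT (j : Fin 4) : Prog (Fin 4) :=
  .seq (.push 3 true) (.loop 3 .skip
    (.case 0 .skip (.push j false) (.seq (.push j true) (.seq (.push 3 true) (.push 3 true)))))

def dropT : Prog (Fin 4) := .seq (mvT 1) (.loop 1 .skip .skip)

def swapT : Prog (Fin 4) := .seq (mvT 1) (.seq (mvT 2) (.seq (mv 1 0) (mv 2 0)))

def dupT : Prog (Fin 4) :=
  .seq (mvT 1) (.seq (.loop 1 (.seq (.push 0 false) (.push 2 false))
    (.seq (.push 0 true) (.push 2 true))) (.seq (mv 2 1) (mv 1 0)))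

/-- Put `true` on the control stack if the tree on top has a left part other than `nil`. -/
def test : Prog (Fin 4) :=
  .case 0 .skip .skip (.case 0 .skip (.seq (.push 0 false) (.push 0 true))
    (.seq (.push 0 true) (.seq (.push 0 true) (.push 3 true))))

/-- Repeat `p` while the tree on top has a left part other than `nil`. -/
def whileT (p : Prog (Fin 4)) : Prog (Fin 4) := .seq test (.loop 3 .skip (.seq p test))

end Prog

open Prog

/-! ### Correctness and running time of the tree operations -/

theorem exec_mv {i j : Fin 4} (hij : i ≠ j) (u : List Bool) (s : Fin 4 → List Bool)
    (hs : s i = u) : Exec (mv i j) s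
      (Function.update (Function.update s i []) j (u.reverse ++ s j)) (2 * u.length + 1) := by
  induction u generalizing s with
  | nil =>
    have : Function.update (Function.update s i []) j (([] : List Bool).reverse ++ s j) = s := by
      rw [List.reverse_nil, List.nil_append, ← hs]; simp
    rw [this]
    exact (Exec.loop_nil hs).mono (by simp)
  | cons b u ih =>
    have h1 : Exec (cond b (Prog.push j true) (Prog.push j false)) (Function.update s i u)
        (Function.update (Function.update s i u) j (b :: s j)) 1 := by
      cases b <;> exact Exec.push _ _ (by simp [hij.symm])
    have h2 := ih (Function.update (Function.update s i u) j (b :: s j)) (by simp [hij])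
    have h : Exec (mv i j) s _ (2 * (b :: u).length + 1) :=
      (Exec.loop_cons hs h1 h2).mono (by simp; omega)
    convert h using 1
    funext k
    by_cases hk : k = j
    · subst hk; simp
    · by_cases hk' : k = i
      · subst hk'; simp [hk]
      · simp [hk, hk']

/-- Stack `3` counts in unary the trees still to be read: a leaf discharges one, an inner node
replaces one by two. The remainder of the loop enters as a hypothesis, so the induction can treat
the right subtree as the continuation of the left one. -/
theorem exec_mvT_loop (j : Fin 4) (hj : j = 1 ∨ j = 2) (t : Tree2) (x : List Bool)
    (s s' : Fin 4 → List Bool) (n : ℕ) (c : List Bool) (h0 : s 0 = t.ser ++ x)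
    (h3 : s 3 = true :: c)
    (h : Exec (.loop 3 .skip
      (.case 0 .skip (.push j false) (.seq (.push j true) (.seq (.push 3 true) (.push 3 true)))))
      (Function.update (Function.update (Function.update s 0 x) 3 c) j (t.ser.reverse ++ s j))
      s' n) :
    Exec (.loop 3 .skip
      (.case 0 .skip (.push j false) (.seq (.push j true) (.seq (.push 3 true) (.push 3 true)))))
      s s' (n + 5 * t.size) := by
  induction t generalizing x s s' n c with
  | nil =>
    refine (Exec.loop_cons h3 (Exec.case_cons 0 (b := false) (u := x) (t := 1) ?_
      (Exec.push _ _ ?_)) h).mono ?_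
    · simpa [ser] using h0
    · rcases hj with rfl | rfl <;> funext k <;> fin_cases k <;> simp [ser]
    · simp [size]; omega
  | cons a b iha ihb =>
    have hb := ihb x (Function.update (Function.update (Function.update s 0 (b.ser ++ x)) 3
      (true :: c)) j (a.ser.reverse ++ true :: s j)) s' n c (by
        rcases hj with rfl | rfl <;> simp) (by rcases hj with rfl | rfl <;> simp) (by
        convert h using 1
        rcases hj with rfl | rfl <;> funext k <;> fin_cases k <;> simp [ser])
    have ha := iha (b.ser ++ x) (Function.update (Function.update (Function.update s 0
      (a.ser ++ (b.ser ++ x))) 3 (true :: true :: c)) j (true :: s j)) s' _ (true :: c) (by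
        rcases hj with rfl | rfl <;> simp) (by rcases hj with rfl | rfl <;> simp) (by
        convert hb using 1
        rcases hj with rfl | rfl <;> funext k <;> fin_cases k <;> simp)
    refine (Exec.loop_cons h3 (Exec.case_cons 0 (b := true) (u := a.ser ++ (b.ser ++ x))
      (t := 1 + (1 + 1)) ?_ (Exec.seq (Exec.push _ _ rfl) (Exec.seq (Exec.push _ _ rfl)
      (Exec.push _ _ ?_)))) ha).mono ?_
    · simpa [ser] using h0
    · rcases hj with rfl | rfl <;> funext k <;> fin_cases k <;> simp
    · simp [size]; omega

theorem exec_mvT (j : Fin 4) (hj : j = 1 ∨ j = 2) (t : Tree2) (x : List Bool)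
    (s : Fin 4 → List Bool) (h0 : s 0 = t.ser ++ x) (h3 : s 3 = []) :
    Exec (mvT j) s
      (Function.update (Function.update s 0 x) j (t.ser.reverse ++ s j)) (5 * t.size + 2) := by
  have h1 : Exec (.loop 3 .skip
      (.case 0 .skip (.push j false) (.seq (.push j true) (.seq (.push 3 true) (.push 3 true)))))
      (Function.update (Function.update s 0 x) j (t.ser.reverse ++ s j))
      (Function.update (Function.update s 0 x) j (t.ser.reverse ++ s j)) 1 :=
    Exec.loop_nil (by rcases hj with rfl | rfl <;> simp [h3])
  refine ((Exec.push 3 true rfl).seq (exec_mvT_loop j hj t x _ _ 1 [] (by simpa using h0)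
    (by simp [h3]) ?_)).mono (by omega)
  convert h1 using 1
  rcases hj with rfl | rfl <;> funext k <;> fin_cases k <;> simp [h3]

/-- The program `p` replaces `u` by `v` on top of stack `0` within `t` steps, if the other stacks
are empty. -/
def Ev (p : Prog (Fin 4)) (u v : List Bool) (t : ℕ) : Prop :=
  ∀ x, Exec p (st (u ++ x) [] [] []) (st (v ++ x) [] [] []) t

namespace Ev

variable {p q pe pf pt : Prog (Fin 4)} {u v w : List Bool} {t t' : ℕ}

theorem mono (h : Ev p u v t) (ht : t ≤ t') : Ev p u v t' := fun x => (h x).mono ht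

theorem seq (h : Ev p u v t) (h' : Ev q v w t') : Ev (.seq p q) u w (t + t') :=
  fun x => (h x).seq (h' x)

/-- The string below the argument is arbitrary in `Ev`, so a program can run on top of data that
waits for later use. -/
theorem frame (h : Ev p u v t) (w : List Bool) : Ev p (u ++ w) (v ++ w) t := fun x => by
  simpa using h (w ++ x)

theorem skip : Ev .skip u u 1 := fun _ => Exec.skip

theorem push (b : Bool) : Ev (.push 0 b) u (b :: u) 1 := fun _ => Exec.push _ _ (by simp)

theorem case_true (h : Ev pt u v t) : Ev (.case 0 pe pf pt) (true :: u) v (t + 1) := fun x =>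
  Exec.case_cons 0 (b := true) (u := u ++ x) rfl (by simpa using h x)

theorem case_false (h : Ev pf u v t) : Ev (.case 0 pe pf pt) (false :: u) v (t + 1) := fun x =>
  Exec.case_cons 0 (b := false) (u := u ++ x) rfl (by simpa using h x)

theorem length_le (h : Ev p u v t) : v.length ≤ u.length + t := by
  obtain ⟨n, hn, hr⟩ := h []
  have := hr.length_le 0
  simp at this
  omega

theorem swapT (a b : Tree2) :
    Ev swapT (a.ser ++ b.ser) (b.ser ++ a.ser) (7 * (a.size + b.size) + 6) := fun x => by
  have h1 := exec_mvT 1 (Or.inl rfl) a (b.ser ++ x) (st (a.ser ++ b.ser ++ x) [] [] [])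
    (by simp) rfl
  have h2 := exec_mvT 2 (Or.inr rfl) b x (st (b.ser ++ x) a.ser.reverse [] []) (by simp) rfl
  have h3 := exec_mv (i := 1) (j := 0) (by simp) a.ser.reverse
    (st x a.ser.reverse b.ser.reverse []) (by simp)
  have h4 := exec_mv (i := 2) (j := 0) (by simp) b.ser.reverse
    (st (a.ser ++ x) [] b.ser.reverse []) (by simp)
  simp at h1 h2 h3 h4
  have h : Exec Prog.swapT _ _ _ := h1.seq (h2.seq (h3.seq h4))
  simpa using h.mono (t' := 7 * (a.size + b.size) + 6) (by simp only [length_ser]; omega)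

theorem dropT (a : Tree2) : Ev dropT a.ser [] (7 * a.size + 3) := fun x => by
  have h1 := exec_mvT 1 (Or.inl rfl) a x (st (a.ser ++ x) [] [] []) (by simp) rfl
  have h2 : ∀ u : List Bool, Exec (.loop 1 .skip .skip) (st x u [] []) (st x [] [] [])
      (2 * u.length + 1) := by
    intro u
    induction u with
    | nil => exact Exec.loop_nil rfl
    | cons b u ih =>
      refine (Exec.loop_cons (k := 1) (b := b) (u := u) rfl ?_ ih).mono (t := 1 + _ + 1) ?_
      · simp only [update_st_one]
        cases b <;> exact Exec.skip
      · simp; omega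
  simp at h1
  refine (h1.seq (h2 _)).mono ?_
  simp [length_ser]; omega

/-- The copy on stack `1` is reversed, so emptying it writes two copies the right way round. The one
on stack `2` returns to stack `0` via stack `1`, which preserves its order. -/
theorem dupT (a : Tree2) : Ev dupT a.ser (a.ser ++ a.ser) (12 * a.size + 5) := fun x => by
  have h1 := exec_mvT 1 (Or.inl rfl) a x (st (a.ser ++ x) [] [] []) (by simp) rfl
  have h2 : ∀ u m b : List Bool, Exec (.loop 1 (.seq (.push 0 false) (.push 2 false))
      (.seq (.push 0 true) (.push 2 true))) (st m u b [])
      (st (u.reverse ++ m) [] (u.reverse ++ b) []) (3 * u.length + 1) := by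
    intro u
    induction u with
    | nil => exact fun m b => Exec.loop_nil rfl
    | cons y u ih =>
      intro m b
      refine (Exec.loop_cons (k := 1) (b := y) (u := u) rfl (s' := st (y :: m) u (y :: b) []) ?_
        ?_).mono (t := (1 + 1) + (3 * u.length + 1) + 1) ?_
      · simp only [update_st_one]
        cases y <;> exact Exec.seq (Exec.push _ _ (by simp; rfl)) (Exec.push _ _ (by simp))
      · simpa using ih (y :: m) (y :: b)
      · simp; omega
  have h2 := h2 a.ser.reverse x []
  have h3 := exec_mv (i := 2) (j := 1) (by simp) a.ser (st (a.ser ++ x) [] a.ser []) (by simp)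
  have h4 := exec_mv (i := 1) (j := 0) (by simp) a.ser.reverse
    (st (a.ser ++ x) a.ser.reverse [] []) (by simp)
  simp at h1 h2 h3 h4
  have h : Exec Prog.dupT _ _ _ := h1.seq (h2.seq (h3.seq h4))
  simpa using h.mono (t' := 12 * a.size + 5) (by simp only [length_ser]; omega)

end Ev

open Tree2 Prog

/-! ### Polynomial-time functions between encoded types -/

/-- Types whose elements are represented by trees. -/
class Enc (α : Type) where
  enc : α → Tree2

/-- Size of the representation. -/
def sz {α : Type} [Enc α] (a : α) : ℕ := (Enc.enc a).size

/-- Serialized representation. -/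
def rep {α : Type} [Enc α] (a : α) : List Bool := (Enc.enc a).ser

theorem length_rep {α : Type} [Enc α] (a : α) : (rep a).length = sz a := Tree2.length_ser _

instance : Enc Bool := ⟨fun b => cond b (.cons .nil .nil) .nil⟩
instance : Enc Unit := ⟨fun _ => .nil⟩
instance {α β : Type} [Enc α] [Enc β] : Enc (α × β) := ⟨fun p => .cons (Enc.enc p.1) (Enc.enc p.2)⟩

/-- Lists are represented by right combs. -/
def encTreeList {α : Type} [Enc α] : List α → Tree2
  | [] => .nil
  | a :: l => .cons (Enc.enc a) (encTreeList l)

instance {α : Type} [Enc α] : Enc (List α) := ⟨encTreeList⟩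

/-- Natural numbers are represented in unary. -/
instance : Enc ℕ := ⟨fun n => Enc.enc (List.replicate n ())⟩

section sz
variable {α β : Type} [Enc α] [Enc β]

theorem sz_pos (a : α) : 0 < sz a := Tree2.size_pos _

@[simp] theorem sz_mk (a : α) (b : β) : sz (a, b) = sz a + sz b + 1 := rfl

@[simp] theorem sz_nil : sz ([] : List α) = 1 := rfl

@[simp] theorem sz_cons (a : α) (l : List α) : sz (a :: l) = sz a + sz l + 1 := rfl

@[simp] theorem sz_unit (a : Unit) : sz a = 1 := rfl

theorem sz_bool_le (b : Bool) : sz b ≤ 3 := by cases b <;> decide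

@[simp] theorem sz_nat (n : ℕ) : sz n = 2 * n + 1 := by
  show sz (List.replicate n ()) = _
  induction n with
  | zero => rfl
  | succ n ih => rw [List.replicate_succ, sz_cons, ih, sz_unit]; omega

theorem sz_append (l l' : List α) : sz (l ++ l') + 1 = sz l + sz l' := by
  induction l with
  | nil => simp [Nat.add_comm]
  | cons a l ih => simp only [List.cons_append, sz_cons]; omega

theorem length_le_sz (l : List α) : l.length + 1 ≤ sz l := by
  induction l with
  | nil => simp
  | cons a l ih => simp only [List.length_cons, sz_cons]; omega

theorem sz_list_le {l : List α} {n : ℕ} (h : ∀ a ∈ l, sz a ≤ n) :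
    sz l ≤ l.length * (n + 1) + 1 := by
  induction l with
  | nil => simp
  | cons a l ih =>
    have h1 := ih fun b hb => h b (List.mem_cons_of_mem _ hb)
    have h2 := h a List.mem_cons_self
    simp only [List.length_cons, sz_cons, Nat.succ_mul]
    omega

theorem sz_str_le (u : List Bool) : sz u ≤ 4 * u.length + 1 :=
  (sz_list_le fun b _ => sz_bool_le b).trans (by omega)

theorem sz_le_of_mem {l : List α} {a : α} (h : a ∈ l) : sz a ≤ sz l := by
  induction l with
  | nil => simp at h
  | cons b l ih =>
    simp only [sz_cons]
    rcases List.mem_cons.1 h with rfl | h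
    · omega
    · have := ih h; omega

end sz

/-- Bounded by a polynomial in the size of the argument. -/
def PB {α : Type} [Enc α] (f : α → ℕ) : Prop := ∃ k, ∀ a, f a ≤ (sz a + 2) ^ k

/-- Computable in polynomial time. -/
@[fun_prop]
def PolyF {α β : Type} [Enc α] [Enc β] (f : α → β) : Prop :=
  ∃ p k, ∀ a, Ev p (rep a) (rep (f a)) ((sz a + 2) ^ k)

namespace PB

variable {α β : Type} [Enc α] [Enc β] {f g : α → ℕ}

theorem mono (hg : PB g) (h : ∀ a, f a ≤ g a) : PB f :=
  let ⟨k, hk⟩ := hg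
  ⟨k, fun a => (h a).trans (hk a)⟩

theorem sz : PB (sz : α → ℕ) := ⟨1, fun a => by simp⟩

theorem const (c : ℕ) : PB fun _ : α => c :=
  ⟨c, fun a => (Nat.lt_pow_self (by omega)).le⟩

theorem mul (hf : PB f) (hg : PB g) : PB fun a => f a * g a := by
  obtain ⟨k, hk⟩ := hf
  obtain ⟨j, hj⟩ := hg
  exact ⟨k + j, fun a => by rw [pow_add]; exact Nat.mul_le_mul (hk a) (hj a)⟩

/-- The base `sz a + 2` is at least `2`, so the next power absorbs a sum of two powers. -/
theorem add (hf : PB f) (hg : PB g) : PB fun a => f a + g a := by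
  obtain ⟨k, hk⟩ := hf
  obtain ⟨j, hj⟩ := hg
  refine ⟨max k j + 1, fun a => ?_⟩
  have h1 := (hk a).trans (Nat.pow_le_pow_right (by omega : 0 < PPPIndex.sz a + 2) (le_max_left k j))
  have h2 := (hj a).trans (Nat.pow_le_pow_right (by omega : 0 < PPPIndex.sz a + 2) (le_max_right k j))
  rw [pow_succ]
  nlinarith [Nat.zero_le (PPPIndex.sz a), Nat.zero_le ((PPPIndex.sz a + 2) ^ max k j)]

theorem pow (hf : PB f) (j : ℕ) : PB fun a => f a ^ j := by
  obtain ⟨k, hk⟩ := hf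
  exact ⟨k * j, fun a => by rw [pow_mul]; exact Nat.pow_le_pow_left (hk a) j⟩

end PB

namespace PolyF

variable {α β γ δ : Type} [Enc α] [Enc β] [Enc γ] [Enc δ]

theorem of_ev {f : α → β} {t : α → ℕ} (p : Prog (Fin 4)) (ht : PB t)
    (h : ∀ a, Ev p (rep a) (rep (f a)) (t a)) : PolyF f :=
  let ⟨k, hk⟩ := ht
  ⟨p, k, fun a => (h a).mono (hk a)⟩

theorem pb_sz {f : α → β} (hf : PolyF f) : PB fun a => sz (f a) := by
  obtain ⟨p, k, h⟩ := hf
  have : PB fun a : α => sz a + (sz a + 2) ^ k := PB.sz.add ((PB.sz.add (PB.const 2)).pow k)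
  refine this.mono fun a => ?_
  simpa only [length_rep] using (h a).length_le

end PolyF

theorem PB.comp {α β : Type} [Enc α] [Enc β] {t : β → ℕ} {f : α → β} (ht : PB t)
    (hf : PolyF f) : PB fun a => t (f a) :=
  let ⟨k, hk⟩ := ht
  ((hf.pb_sz.add (PB.const 2)).pow k).mono fun a => hk (f a)

namespace PolyF

variable {α β γ δ : Type} [Enc α] [Enc β] [Enc γ] [Enc δ]

theorem pb_time (k : ℕ) : PB fun a : α => (sz a + 2) ^ k := ⟨k, fun _ => le_rfl⟩

theorem of_enc {f : α → β} (h : ∀ a, Enc.enc (f a) = Enc.enc a) : PolyF f :=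
  of_ev .skip (PB.const 1) fun a => by rw [rep, rep, h]; exact Ev.skip

@[fun_prop]
theorem id' : PolyF fun a : α => a := of_enc fun _ => rfl

@[fun_prop]
theorem comp {f : β → γ} {g : α → β} (hf : PolyF f) (hg : PolyF g) : PolyF fun a => f (g a) := by
  have hg' := hg
  obtain ⟨p, k, hp⟩ := hf
  obtain ⟨q, j, hq⟩ := hg
  exact of_ev (.seq q p) ((pb_time j).add ((pb_time k).comp hg')) fun a => (hq a).seq (hp (g a))

end PolyF

/-- Push a string. -/
def Prog.pushL : List Bool → Prog (Fin 4)
  | [] => .skip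
  | b :: u => .seq (pushL u) (.push 0 b)

theorem Ev.pushL (u : List Bool) : Ev (Prog.pushL u) [] u (u.length + 1) := by
  induction u with
  | nil => exact Ev.skip
  | cons b u ih => exact (ih.seq (Ev.push b)).mono (by simp)

namespace PolyF

variable {α β γ δ : Type} [Enc α] [Enc β] [Enc γ] [Enc δ]

@[fun_prop]
theorem const (c : β) : PolyF fun _ : α => c :=
  of_ev (.seq dropT (pushL (rep c)))
    ((((PB.const 7).mul PB.sz).add (PB.const 3)).add (PB.const ((rep c).length + 1)))
    fun a => (Ev.dropT (Enc.enc a)).seq (Ev.pushL (rep c))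

-- One copy of the argument is consumed by `g` while the other waits below. Running `g` first leaves
-- the value of `f` on top at the end, and a single `true` completes the pair.
@[fun_prop]
theorem prodMk {f : α → β} {g : α → γ} (hf : PolyF f) (hg : PolyF g) :
    PolyF fun a => (f a, g a) := by
  have hg' := hg
  obtain ⟨p, k, hp⟩ := hf
  obtain ⟨q, j, hq⟩ := hg
  refine of_ev (.seq dupT (.seq q (.seq swapT (.seq p (.push 0 true)))))
    ((((PB.const 12).mul PB.sz).add (PB.const 5)).add ((pb_time j).add
      ((((PB.const 7).mul (hg'.pb_sz.add PB.sz)).add (PB.const 6)).add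
        ((pb_time k).add (PB.const 1))))) fun a => ?_
  exact (Ev.dupT (Enc.enc a)).seq (((hq a).frame (rep a)).seq
    ((Ev.swapT (Enc.enc (g a)) (Enc.enc a)).seq (((hp a).frame (rep (g a))).seq (Ev.push true))))

@[fun_prop]
theorem fst : PolyF (Prod.fst : α × β → α) := by
  refine of_ev (.case 0 .skip .skip (.seq swapT dropT))
    (((((PB.const 7).mul PB.sz).add (PB.const 6)).add
      (((PB.const 7).mul PB.sz).add (PB.const 3))).add (PB.const 1)) fun a => ?_
  have h := ((Ev.swapT (Enc.enc a.1) (Enc.enc a.2)).seq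
    ((Ev.dropT (Enc.enc a.2)).frame (rep a.1)))
  refine (Ev.case_true (h.mono ?_)).mono le_rfl
  have : sz a = (Enc.enc a.1).size + (Enc.enc a.2).size + 1 := rfl
  omega

@[fun_prop]
theorem snd : PolyF (Prod.snd : α × β → β) := by
  refine of_ev (.case 0 .skip .skip dropT)
    ((((PB.const 7).mul PB.sz).add (PB.const 3)).add (PB.const 1)) fun a => ?_
  have h := ((Ev.dropT (Enc.enc a.1)).frame (rep a.2))
  refine (Ev.case_true (h.mono ?_)).mono le_rfl
  have : sz a = (Enc.enc a.1).size + (Enc.enc a.2).size + 1 := rfl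
  omega

@[fun_prop]
theorem cond {c : α → Bool} {f g : α → β} (hc : PolyF c) (hf : PolyF f) (hg : PolyF g) :
    PolyF fun a => bif c a then f a else g a := by
  obtain ⟨r, i, hr⟩ := hc
  obtain ⟨p, k, hp⟩ := hf
  obtain ⟨q, j, hq⟩ := hg
  refine of_ev (.seq dupT (.seq r (.case 0 .skip q (.seq (.case 0 .skip (.case 0 .skip .skip .skip)
    .skip) p)))) ((((PB.const 12).mul PB.sz).add (PB.const 5)).add ((pb_time i).add
      (((PB.const 3).add ((pb_time k).add (pb_time j))).add (PB.const 1)))) fun a => ?_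
  refine (Ev.dupT (Enc.enc a)).seq (((hr a).frame (rep a)).seq ?_)
  cases c a
  · exact (Ev.case_false (hq a)).mono (by omega)
  -- The serialization of `true` is `true, false, false`; after the branch on its first bit two more
  -- bits have to be removed.
  · exact (Ev.case_true (Ev.seq (Ev.case_false (Ev.case_false Ev.skip)) (hp a))).mono (by omega)

/-- A nonempty list and a pair are both inner nodes. After the branch has removed the leading `true`
of the list, pushing `true` again restores head and tail as a pair; a swap and one more `true` form
the argument of `g`. -/
theorem listCases {l : α → List β} {f : α → γ} {g : α × β × List β → γ} (hl : PolyF l)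
    (hf : PolyF f) (hg : PolyF g) :
    PolyF fun a => List.casesOn (motive := fun _ => γ) (l a) (f a) fun b t => g (a, b, t) := by
  have hl' := hl
  obtain ⟨r, i, hr⟩ := hl
  obtain ⟨p, k, hp⟩ := hf
  obtain ⟨q, j, hq⟩ := hg
  refine of_ev (.seq dupT (.seq r (.case 0 .skip p (.seq (.push 0 true) (.seq swapT
    (.seq (.push 0 true) q)))))) (t := fun a => (12 * sz a + 5) + ((sz a + 2) ^ i +
      ((sz a + 2) ^ k + (1 + ((7 * (sz (l a) + sz a) + 6) + (1 + (sz a + sz (l a) + 3) ^ j))) + 1)))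
    ?_ fun a => ?_
  · exact (((PB.const 12).mul PB.sz).add (PB.const 5)).add ((pb_time i).add (((pb_time k).add
      ((PB.const 1).add ((((PB.const 7).mul (hl'.pb_sz.add PB.sz)).add (PB.const 6)).add
        ((PB.const 1).add (((PB.sz.add hl'.pb_sz).add (PB.const 3)).pow j))))).add (PB.const 1)))
  · refine (Ev.dupT (Enc.enc a)).seq (((hr a).frame (rep a)).seq ?_)
    rcases l a with _ | ⟨b, t⟩
    · exact (Ev.case_false (hp a)).mono (by omega)
    · have h1 : Ev .skip (rep (b, t)) (rep (b, t)) 1 := Ev.skip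
      have h2 := (Ev.push (u := rep b ++ rep t ++ rep a) true).seq
        ((Ev.swapT (Enc.enc (b, t)) (Enc.enc a)).seq
          ((Ev.push true).seq (hq (a, b, t))))
      refine (Ev.case_true (h2.mono ?_)).mono le_rfl
      have e1 : sz (a, b, t) + 2 = sz a + sz (b :: t) + 3 := by
        simp only [sz_mk, sz_cons]
      have e2 : (Enc.enc (b, t)).size = sz (b :: t) := rfl
      have e3 : (Enc.enc a).size = sz a := rfl
      rw [e1, e2, e3]
      omega

end PolyF

/-! ### Loops over lists and left folds -/

theorem ev_whileT {β σ : Type} [Enc β] [Enc σ] {p : Prog (Fin 4)} (g : σ → β → σ) (T : ℕ)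
    (l : List β) (s : σ)
    (h : ∀ l₁ b l₂, l = l₁ ++ b :: l₂ →
      Ev p (rep (b :: l₂, l₁.foldl g s)) (rep (l₂, g (l₁.foldl g s) b)) T) :
    Ev (whileT p) (rep (l, s)) (rep (([] : List β), l.foldl g s)) ((T + 6) * l.length + 6) := by
  intro x
  -- The induction starts after the first test, because a round of the loop consists of the body
  -- followed by the test for the next round.
  suffices ∃ s', Exec test (st (rep (l, s) ++ x) [] [] []) s' 5 ∧
      Exec (.loop 3 .skip (.seq p test)) s'
        (st (rep (([] : List β), l.foldl g s) ++ x) [] [] []) ((T + 6) * l.length + 1) by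
    obtain ⟨s', h1, h2⟩ := this
    exact (h1.seq h2).mono (by omega)
  induction l generalizing s with
  | nil =>
    refine ⟨_, ((Exec.case_cons 0 (b := true) (u := false :: (rep s ++ x)) rfl
      (Exec.case_cons 0 (b := false) (u := rep s ++ x) (by simp) (Exec.seq (Exec.push 0 false rfl)
      (Exec.push 0 true rfl)))).mono (by omega)), ?_⟩
    simp only [update_st_zero, st_zero]
    exact Exec.loop_nil rfl
  | cons b l ih =>
    obtain ⟨s', h1, h2⟩ := ih (g s b) fun l₁ b' l₂ hl => h (b :: l₁) b' l₂ (by rw [hl]; rfl)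
    refine ⟨st (rep (b :: l, s) ++ x) [] [] [true], ((Exec.case_cons 0 (b := true)
      (u := true :: (rep b ++ rep l ++ rep s ++ x)) ?_
      (Exec.case_cons 0 (b := true) (u := rep b ++ rep l ++ rep s ++ x) (by simp)
      (Exec.seq (Exec.push 0 true rfl)
        (Exec.seq (Exec.push 0 true rfl) (Exec.push 3 true ?_))))).mono (by omega)), ?_⟩
    · simp [rep, Enc.enc, encTreeList, ser]
    · simp [rep, Enc.enc, encTreeList, ser]
    · refine (Exec.loop_cons (k := 3) (b := true) (u := []) rfl ?_ h2).mono (t := T + 5 + _ + 1) ?_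
      · exact Exec.seq (by simpa using h [] b l rfl x) h1
      · simp only [List.length_cons, Nat.mul_succ]; omega

namespace PolyF

variable {α β γ δ : Type} [Enc α] [Enc β] [Enc γ] [Enc δ]

@[fun_prop]
theorem tail : PolyF (List.tail : List α → List α) := by
  have := listCases (l := fun l : List α => l) (f := fun _ => ([] : List α))
    (g := fun x : List α × α × List α => x.2.2) (by fun_prop) (by fun_prop) (by fun_prop)
  refine cast (congrArg PolyF ?_) this
  funext l; cases l <;> rfl

/-- Left fold, if all intermediate values are small. -/
theorem foldl_of_le {σ : Type} [Enc σ] {l : α → List β} {s : α → σ} {g : α × σ × β → σ}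
    (hl : PolyF l) (hs : PolyF s) (hg : PolyF g) {B : α → ℕ} (hB : PB B)
    (h : ∀ a l₁, l₁ <+: l a → sz (l₁.foldl (fun s b => g (a, s, b)) (s a)) ≤ B a) :
    PolyF fun a => (l a).foldl (fun s b => g (a, s, b)) (s a) := by
  -- The loop body acts on the rest of the list, the argument and the accumulator; it removes the
  -- head and updates the accumulator.
  have hW : PolyF fun x : List β × α × σ => (x.1.tail, x.2.1,
      List.casesOn (motive := fun _ => σ) x.1 x.2.2 fun b _ => g (x.2.1, x.2.2, b)) :=
    (tail.comp fst).prodMk ((fst.comp snd).prodMk (listCases (l := fun x : List β × α × σ => x.1)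
      (f := fun x => x.2.2) (g := fun y => g (y.1.2.1, y.1.2.2, y.2.1))
      fst (by fun_prop) (hg.comp (by fun_prop))))
  obtain ⟨p, k, hp⟩ := hW
  have hS : PolyF fun a => (l a, a, s a) := hl.prodMk (id'.prodMk hs)
  have hR : PolyF fun a => (([] : List β), a, (l a).foldl (fun s b => g (a, s, b)) (s a)) := by
    obtain ⟨q, j, hq⟩ := hS
    -- Bound for one round. The rest of the list is no larger than the list and the accumulator is
    -- at most `B a`; `4` accounts for the two pair nodes and the `2` in the base.
    have hT : PB fun a => (sz (l a) + sz a + B a + 4) ^ k :=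
      (((hl.pb_sz.add PB.sz).add hB).add (PB.const 4)).pow k
    refine of_ev (.seq q (whileT p)) ((pb_time j).add
      (((hT.add (PB.const 6)).mul hl.pb_sz).add (PB.const 6))) fun a => (hq a).seq ?_
    have hfold : ∀ l₁ : List β, l₁.foldl (fun (x : α × σ) b => (x.1, g (x.1, x.2, b))) (a, s a) =
        (a, l₁.foldl (fun s b => g (a, s, b)) (s a)) := by
      intro l₁
      generalize s a = s₀
      induction l₁ generalizing s₀ with
      | nil => rfl
      | cons b l₁ ih => exact ih _
    have h1 := ev_whileT (p := p) (fun (x : α × σ) b => (x.1, g (x.1, x.2, b)))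
      ((sz (l a) + sz a + B a + 4) ^ k) (l a) (a, s a) fun l₁ b l₂ h12 => by
        rw [hfold]
        refine (hp (b :: l₂, a, l₁.foldl (fun s b => g (a, s, b)) (s a))).mono
          (Nat.pow_le_pow_left ?_ k)
        have h2 := h a l₁ ⟨b :: l₂, h12.symm⟩
        have h3 := sz_append l₁ (b :: l₂)
        have h4 := sz_pos l₁
        rw [h12]
        simp only [sz_mk, sz_cons] at h3 ⊢
        omega
    rw [hfold] at h1
    refine h1.mono ?_
    have h2 := length_le_sz (l a)
    have h3 := Nat.mul_le_mul_left ((sz (l a) + sz a + B a + 4) ^ k + 6)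
      (by omega : (l a).length ≤ sz (l a))
    omega
  exact snd.comp (snd.comp hR)

end PolyF

/-! ### Conversion between strings and their tree representation -/

def Prog.toTree : Prog (Fin 4) :=
  .seq (mv 0 1) (.seq (.push 0 false) (.loop 1 (.seq (.push 0 false) (.push 0 true))
    (.seq (.push 0 false) (.seq (.push 0 false) (.seq (.push 0 true) (.push 0 true))))))

def Prog.fromTree : Prog (Fin 4) :=
  .seq (.push 3 true) (.seq (.loop 3 .skip (.case 0 .skip .skip
    (.case 0 .skip (.seq (.push 1 false) (.push 3 true))
      (.seq (.case 0 .skip (.case 0 .skip .skip .skip) .skip)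
        (.seq (.push 1 true) (.push 3 true)))))) (mv 1 0))

/-- Stack `1` holds the reversed string, so the comb is built from its last entry. A bit `false`
prepends `10` and a bit `true` prepends `1100`: the node of the list, then the tree of the bit. -/
theorem exec_toTree (u : List Bool) :
    Exec Prog.toTree (st u [] [] []) (st (rep u) [] [] []) (9 * u.length + 3) := by
  have h1 := exec_mv (i := 0) (j := 1) (by simp) u (st u [] [] []) (by simp)
  have h2 : ∀ w v : List Bool, Exec (.loop 1 (.seq (.push 0 false) (.push 0 true))
      (.seq (.push 0 false) (.seq (.push 0 false) (.seq (.push 0 true) (.push 0 true))))) (st (rep v) w [] [])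
      (st (rep (w.reverse ++ v)) [] [] []) (7 * w.length + 1) := by
    intro w
    induction w with
    | nil => exact fun v => Exec.loop_nil rfl
    | cons b w ih =>
      intro v
      have h3 : Exec (_root_.cond b (.seq (.push 0 false) (.seq (.push 0 false)
          (.seq (.push 0 true) (.push 0 true)))) (.seq (.push 0 false) (.push 0 true)))
          (st (rep v) w [] []) (st (rep (b :: v)) w [] []) 4 := by
        cases b
        · exact ((Exec.push 0 false rfl).seq (Exec.push 0 true (by
            simp [rep, Enc.enc, encTreeList, ser]))).mono (by omega)
        · exact (Exec.push 0 false rfl).seq ((Exec.push 0 false rfl).seq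
            ((Exec.push 0 true rfl).seq (Exec.push 0 true (by
              simp [rep, Enc.enc, encTreeList, ser]))))
      have h4 := Exec.loop_cons (k := 1) (b := b) (u := w) (s := st (rep v) (b :: w) [] [])
        rfl (by rw [update_st_one]; exact h3) (ih (b :: v))
      have h5 := h4.mono (t' := 7 * (b :: w).length + 1) (by simp; omega)
      simpa using h5
  have h3 := h2 u.reverse []
  simp at h1 h3
  refine (h1.seq ((Exec.push 0 false rfl).seq (s'' := st (rep u) [] [] []) (t' := 7 * u.length + 1)
    ?_)).mono (by omega)
  simpa [rep, Enc.enc, encTreeList, ser] using h3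

/-- The control bit on stack `3` is renewed after every entry but not at the final leaf, which ends
the loop. -/
theorem exec_fromTree (u : List Bool) :
    Exec Prog.fromTree (st (rep u) [] [] []) (st u [] [] []) (11 * u.length + 6) := by
  have h2 : ∀ w v : List Bool, Exec (.loop 3 .skip (.case 0 .skip .skip
      (.case 0 .skip (.seq (.push 1 false) (.push 3 true))
        (.seq (.case 0 .skip (.case 0 .skip .skip .skip) .skip)
          (.seq (.push 1 true) (.push 3 true))))))
      (st (rep w) v [] [true]) (st [] (w.reverse ++ v) [] []) (9 * w.length + 4) := by
    intro w
    induction w with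
    | nil =>
      intro v
      have h3 : Exec (.case 0 .skip .skip
          (.case 0 .skip (.seq (.push 1 false) (.push 3 true))
            (.seq (.case 0 .skip (.case 0 .skip .skip .skip) .skip)
              (.seq (.push 1 true) (.push 3 true)))))
          (st (rep ([] : List Bool)) v [] []) (st [] v [] []) 2 :=
        Exec.case_cons 0 (b := false) (u := []) rfl (by simpa using Exec.skip)
      have h4 := Exec.loop_cons (k := 3) (b := true) (u := [])
        (s := st (rep ([] : List Bool)) v [] [true])
        (pf := .skip) rfl (by rw [update_st_three]; exact h3) (Exec.loop_nil rfl)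
      exact h4.mono (by simp)
    | cons b w ih =>
      intro v
      have h3 : Exec (.case 0 .skip .skip
          (.case 0 .skip (.seq (.push 1 false) (.push 3 true))
            (.seq (.case 0 .skip (.case 0 .skip .skip .skip) .skip)
              (.seq (.push 1 true) (.push 3 true)))))
          (st (rep (b :: w)) v [] []) (st (rep w) (b :: v) [] [true]) 7 := by
        cases b
        · exact (Exec.case_cons 0 (b := true) (u := false :: rep w) rfl
            (Exec.case_cons 0 (b := false) (u := rep w) (by simp)
              ((Exec.push 1 false rfl).seq (Exec.push 3 true (by simp))))).mono (by omega)
        · exact (Exec.case_cons 0 (b := true) (u := true :: false :: false :: rep w) rfl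
            (Exec.case_cons 0 (b := true) (u := false :: false :: rep w) (by simp)
              ((Exec.case_cons 0 (b := false) (u := false :: rep w) (by simp)
                (Exec.case_cons 0 (b := false) (u := rep w) (by simp) Exec.skip)).seq
                ((Exec.push 1 true rfl).seq (Exec.push 3 true (by simp)))))).mono (by omega)
      have h4 := Exec.loop_cons (k := 3) (b := true) (u := []) (s := st (rep (b :: w)) v [] [true])
        (pf := .skip) rfl (by rw [update_st_three]; exact h3) (ih (b :: v))
      have h5 := h4.mono (t' := 9 * (b :: w).length + 4) (by simp; omega)
      simpa using h5
  have h1 := exec_mv (i := 1) (j := 0) (by simp) u.reverse (st [] u.reverse [] []) (by simp)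
  have h3 := h2 u []
  simp at h1 h3
  have h4 : Exec (.push 3 true) (st (rep u) [] [] []) (st (rep u) [] [] [true]) 1 :=
    Exec.push 3 true (by simp)
  exact (h4.seq (h3.seq h1)).mono (by omega)

/-- Computability in polynomial time, from typed functions to Turing machines. -/
theorem PolyF.polyTime {α β : Type} {ea : α → List Bool} {eb : β → List Bool} {f : α → β}
    {F : List Bool → List Bool} (hF : PolyF F) (h : ∀ a, F (ea a) = eb (f a)) :
    PolyTime ea eb f := by
  have hF' := hF.pb_sz
  obtain ⟨p, k, hp⟩ := hF
  obtain ⟨j, hj⟩ := hF'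
  have hst : ∀ u : List Bool, Function.update (fun _ : Fin 4 => []) 0 u = st u [] [] [] := by
    intro u; funext i; fin_cases i <;> rfl
  let N : Polynomial ℕ := 4 * Polynomial.X + 3
  refine polyTime_of_runs (.seq .toTree (.seq p .fromTree)) (0 : Fin 4)
    (9 * Polynomial.X + 3 + (N ^ k + (11 * N ^ j + 6))) fun a => ?_
  rw [hst, hst]
  have h1 := hp (ea a) []
  have h2 := exec_fromTree (F (ea a))
  rw [h a] at h1 h2
  simp only [List.append_nil] at h1
  refine ((exec_toTree (ea a)).seq (h1.seq h2)).mono ?_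
  have h3 := sz_str_le (ea a)
  have h4 : sz (F (ea a)) ≤ _ := hj (ea a)
  rw [h a] at h4
  have h5 := length_le_sz (eb (f a))
  have h6 : ∀ i, (sz (ea a) + 2) ^ i ≤ (4 * (ea a).length + 3) ^ i := fun i =>
    Nat.pow_le_pow_left (by omega) i
  have h7 := h6 k
  have h8 := h6 j
  simp only [N, Polynomial.eval_add, Polynomial.eval_mul, Polynomial.eval_pow, Polynomial.eval_X,
    Polynomial.eval_ofNat]
  omega


/-! ### Basic polynomial-time functions -/

namespace PolyF

variable {α β γ δ σ : Type} [Enc α] [Enc β] [Enc γ] [Enc δ] [Enc σ]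

theorem of_eq {f g : α → β} (hf : PolyF f) (h : ∀ a, f a = g a) : PolyF g :=
  (funext h : f = g) ▸ hf

/-- Left fold, if the size of the accumulator grows by a bounded amount in each step. -/
theorem foldl_of_grow {l : α → List β} {s : α → σ} {g : α × σ × β → σ}
    (hl : PolyF l) (hs : PolyF s) (hg : PolyF g) {G : α × β → ℕ} (hG : PB G)
    (h : ∀ a s b, sz (g (a, s, b)) ≤ sz s + G (a, b)) :
    PolyF fun a => (l a).foldl (fun s b => g (a, s, b)) (s a) := by
  obtain ⟨k, hk⟩ := hG
  have hT : PB fun a => sz (s a) + sz (l a) * (sz a + sz (l a) + 3) ^ k :=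
    hs.pb_sz.add (hl.pb_sz.mul (((PB.sz.add hl.pb_sz).add (PB.const 3)).pow k))
  refine foldl_of_le hl hs hg hT fun a l₁ hl₁ => ?_
  have key : ∀ (l₁ : List β) (s₀ : σ) (M : ℕ), (∀ b ∈ l₁, G (a, b) ≤ M) →
      sz (l₁.foldl (fun s b => g (a, s, b)) s₀) ≤ sz s₀ + l₁.length * M := by
    intro l₁
    induction l₁ with
    | nil => intro s₀ M _; simp
    | cons b l₁ ih =>
      intro s₀ M hM
      have h1 := ih (g (a, s₀, b)) M fun b' hb' => hM b' (List.mem_cons_of_mem _ hb')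
      have h2 := h a s₀ b
      have h3 := hM b List.mem_cons_self
      rw [List.foldl_cons, List.length_cons, Nat.succ_mul]
      omega
  have h1 := key l₁ (s a) ((sz a + sz (l a) + 3) ^ k) fun b hb => by
    refine (hk (a, b)).trans (Nat.pow_le_pow_left ?_ k)
    have := sz_le_of_mem (hl₁.subset hb)
    simp only [sz_mk]
    omega
  have h2 := length_le_sz (l a)
  have h3 := hl₁.length_le
  exact h1.trans (Nat.add_le_add_left (Nat.mul_le_mul_right _ (by omega)) _)

@[fun_prop]
theorem listCons {f : α → β} {l : α → List β} (hf : PolyF f) (hl : PolyF l) :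
    PolyF fun a => f a :: l a :=
  (of_enc (f := fun x : β × List β => x.1 :: x.2) fun _ => rfl).comp (hf.prodMk hl)

@[fun_prop]
theorem headD {l : α → List β} {d : α → β} (hl : PolyF l) (hd : PolyF d) :
    PolyF fun a => (l a).headD (d a) :=
  (listCases (g := fun x => x.2.1) hl hd (by fun_prop)).of_eq fun a => by cases l a <;> rfl

@[fun_prop]
theorem isEmpty {l : α → List β} (hl : PolyF l) : PolyF fun a => (l a).isEmpty :=
  (listCases (f := fun _ => true) (g := fun _ => false) hl (by fun_prop) (by fun_prop)).of_eq
    fun a => by cases l a <;> rfl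

@[fun_prop]
theorem not {c : α → Bool} (hc : PolyF c) : PolyF fun a => !(c a) :=
  (hc.cond (const false) (const true)).of_eq fun a => by cases c a <;> rfl

@[fun_prop]
theorem and {c d : α → Bool} (hc : PolyF c) (hd : PolyF d) : PolyF fun a => c a && d a :=
  (hc.cond hd (const false)).of_eq fun a => by cases c a <;> rfl

@[fun_prop]
theorem or {c d : α → Bool} (hc : PolyF c) (hd : PolyF d) : PolyF fun a => c a || d a :=
  (hc.cond (const true) hd).of_eq fun a => by cases c a <;> rfl

@[fun_prop]
theorem beqBool {c d : α → Bool} (hc : PolyF c) (hd : PolyF d) : PolyF fun a => c a == d a :=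
  (hc.cond hd hd.not).of_eq fun a => by cases c a <;> cases d a <;> rfl

@[fun_prop]
theorem reverse {l : α → List β} (hl : PolyF l) : PolyF fun a => (l a).reverse :=
  (foldl_of_grow (g := fun x => x.2.2 :: x.2.1) hl (const ([] : List β)) (by fun_prop)
    (G := fun x => sz x) PB.sz (fun a s b => by simp only [sz_cons, sz_mk]; omega)).of_eq
    fun a => by simp

@[fun_prop]
theorem append {l l' : α → List β} (hl : PolyF l) (hl' : PolyF l') :
    PolyF fun a => l a ++ l' a :=
  (foldl_of_grow (g := fun x => x.2.2 :: x.2.1) hl.reverse hl' (by fun_prop)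
    (G := fun x => sz x) PB.sz (fun a s b => by simp only [sz_cons, sz_mk]; omega)).of_eq
    fun a => by simp

theorem flatMap {l : α → List β} {g : α → β → List γ} (hl : PolyF l)
    (hg : PolyF fun x : α × β => g x.1 x.2) : PolyF fun a => (l a).flatMap (g a) :=
  (foldl_of_grow (g := fun x : α × List γ × β => x.2.1 ++ g x.1 x.2.2) hl (const ([] : List γ))
    (append (by fun_prop) (hg.comp (g := fun x : α × List γ × β => (x.1, x.2.2)) (by fun_prop)))
    (G := fun x => sz (g x.1 x.2)) hg.pb_sz
    (fun a s b => by have := sz_append s (g a b); simp only; omega)).of_eq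
    fun a => by
      have : ∀ (l : List β) (s : List γ), l.foldl (fun s b => s ++ g a b) s = s ++ l.flatMap (g a) := by
        intro l
        induction l with
        | nil => simp
        | cons b l ih => intro s; simp [ih]
      simpa using this (l a) []

theorem map {l : α → List β} {g : α → β → γ} (hl : PolyF l)
    (hg : PolyF fun x : α × β => g x.1 x.2) : PolyF fun a => (l a).map (g a) :=
  (flatMap (g := fun a b => [g a b]) hl (by fun_prop)).of_eq fun a => by
    induction l a <;> simp_all

theorem all {l : α → List β} {g : α → β → Bool} (hl : PolyF l)
    (hg : PolyF fun x : α × β => g x.1 x.2) : PolyF fun a => (l a).all (g a) :=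
  (flatMap (g := fun a b => bif g a b then [] else [()]) hl (by fun_prop)).isEmpty.of_eq fun a => by
    induction l a with
    | nil => rfl
    | cons b l ih => simp only [List.flatMap_cons, List.all_cons, ← ih]; cases g a b <;> simp

theorem any {l : α → List β} {g : α → β → Bool} (hl : PolyF l)
    (hg : PolyF fun x : α × β => g x.1 x.2) : PolyF fun a => (l a).any (g a) :=
  (all (g := fun a b => !(g a b)) hl (by fun_prop)).not.of_eq fun a => by
    simp [List.all_eq_not_any_not]

@[fun_prop]
theorem tail' {l : α → List β} (hl : PolyF l) : PolyF fun a => (l a).tail := tail.comp hl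

/-! Natural numbers -/

@[fun_prop]
theorem units : PolyF fun n : ℕ => List.replicate n () := of_enc fun _ => rfl

-- Numbers are unary, so a list of units has the same representation as its length.
@[fun_prop]
theorem length {l : α → List β} (hl : PolyF l) : PolyF fun a => (l a).length := by
  have h1 : PolyF fun a => (l a).map fun _ => () := map hl (by fun_prop)
  refine (of_enc (f := fun u : List Unit => u.length) fun u => ?_).comp h1 |>.of_eq
    fun a => by simp
  show Enc.enc (List.replicate u.length ()) = _
  rw [← List.map_const']
  congr 1
  exact List.map_id u

@[fun_prop]
theorem natAdd {f g : α → ℕ} (hf : PolyF f) (hg : PolyF g) : PolyF fun a => f a + g a :=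
  ((units.comp hf).append (units.comp hg)).length.of_eq fun a => by simp

theorem replicate {f : α → ℕ} {g : α → β} (hf : PolyF f) (hg : PolyF g) :
    PolyF fun a => List.replicate (f a) (g a) :=
  (map (g := fun a (_ : Unit) => g a) (units.comp hf) (hg.comp fst)).of_eq fun a => by simp

@[fun_prop]
theorem natMul {f g : α → ℕ} (hf : PolyF f) (hg : PolyF g) : PolyF fun a => f a * g a :=
  (flatMap (g := fun a (_ : Unit) => List.replicate (g a) ()) (units.comp hf)
    (by fun_prop)).length.of_eq fun a => by simp

@[fun_prop]
theorem drop {n : α → ℕ} {l : α → List β} (hn : PolyF n) (hl : PolyF l) :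
    PolyF fun a => (l a).drop (n a) :=
  (foldl_of_grow (g := fun x => x.2.1.tail) (units.comp hn) hl (by fun_prop)
    (G := fun _ => 0) (PB.const 0) (fun a s b => by
      cases s with
      | nil => simp
      | cons c s => simp only [List.tail_cons, sz_cons]; omega)).of_eq fun a => by
      have : ∀ (n : ℕ) (l : List β),
          (List.replicate n ()).foldl (fun s _ => s.tail) l = l.drop n := by
        intro n
        induction n with
        | zero => simp
        | succ n ih => intro l; simp [List.replicate_succ, ih]
      exact this _ _

@[fun_prop]
theorem take {n : α → ℕ} {l : α → List β} (hn : PolyF n) (hl : PolyF l) :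
    PolyF fun a => (l a).take (n a) := by
  have h := (drop (drop hn hl).length hl.reverse).reverse
  refine h.of_eq fun a => ?_
  rw [List.drop_reverse, List.reverse_reverse, List.length_drop]
  rcases le_total (n a) (l a).length with h | h
  · rw [Nat.sub_sub_self h]
  · rw [Nat.sub_eq_zero_of_le h, Nat.sub_zero, List.take_length, List.take_of_length_le h]

@[fun_prop]
theorem natSub {f g : α → ℕ} (hf : PolyF f) (hg : PolyF g) : PolyF fun a => f a - g a :=
  (drop hg (units.comp hf)).length.of_eq fun a => by simp

@[fun_prop]
theorem natLt {f g : α → ℕ} (hf : PolyF f) (hg : PolyF g) : PolyF fun a => decide (f a < g a) :=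
  (units.comp (natSub hg hf)).isEmpty.not.of_eq fun a => by
    by_cases h : f a < g a
    · simp [h]; omega
    · simp [h]; omega

@[fun_prop]
theorem natEq {f g : α → ℕ} (hf : PolyF f) (hg : PolyF g) : PolyF fun a => decide (f a = g a) :=
  ((natLt hf hg).or (natLt hg hf)).not.of_eq fun a => by
    by_cases h : f a = g a
    · simp [h]
    · simp [h]; omega

@[fun_prop]
theorem getD {l : α → List β} {n : α → ℕ} {d : α → β} (hl : PolyF l) (hn : PolyF n)
    (hd : PolyF d) : PolyF fun a => (l a).getD (n a) (d a) :=
  ((drop hn hl).headD hd).of_eq fun a => by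
    generalize l a = l, n a = n
    induction l generalizing n with
    | nil => simp
    | cons b l ih => cases n <;> simp_all

-- The appended entry is the current length, so the growth of a step depends on the accumulator.
-- Therefore the intermediate lists are bounded explicitly: at most `n` entries, each at most `n`.
@[fun_prop]
theorem range {n : α → ℕ} (hn : PolyF n) : PolyF fun a => List.range (n a) := by
  have key : ∀ l : List Unit, l.foldl (fun (s : List ℕ) _ => s ++ [s.length]) [] =
      List.range l.length := by
    intro l
    induction l using List.reverseRecOn with
    | nil => rfl
    | append_singleton l u ih => simp [ih, List.range_succ]
  refine (foldl_of_le (g := fun x : α × List ℕ × Unit => x.2.1 ++ [x.2.1.length]) (units.comp hn)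
    (const ([] : List ℕ)) (by fun_prop)
    (B := fun a => sz (n a) * (2 * sz (n a) + 3) + 1) ?_ fun a l hl => ?_).of_eq fun a => ?_
  · exact ((hn.pb_sz.mul (((PB.const 2).mul hn.pb_sz).add (PB.const 3))).add (PB.const 1))
  · simp only
    rw [key]
    have h1 := hl.length_le
    rw [List.length_replicate] at h1
    refine (sz_list_le (n := 2 * sz (n a) + 2) fun b hb => ?_).trans ?_
    · have := List.mem_range.1 hb
      simp only [sz_nat]
      omega
    · rw [List.length_range]
      have h2 : l.length ≤ sz (n a) := by simp only [sz_nat]; omega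
      exact Nat.add_le_add_right (Nat.mul_le_mul_right (2 * sz (n a) + 3) h2) 1
  · simp only
    rw [key, List.length_replicate]

-- The fold over the first list carries the unread part of the second one along.
@[fun_prop]
theorem zip {l : α → List β} {l' : α → List γ} (hl : PolyF l) (hl' : PolyF l') :
    PolyF fun a => (l a).zip (l' a) := by
  have hg : PolyF fun x : α × (List γ × List (β × γ)) × β =>
      List.casesOn (motive := fun _ => List γ × List (β × γ)) x.2.1.1 x.2.1
        fun c t => (t, x.2.1.2 ++ [(x.2.2, c)]) :=
    listCases (l := fun x : α × (List γ × List (β × γ)) × β => x.2.1.1) (f := fun x => x.2.1)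
      (g := fun y : (α × (List γ × List (β × γ)) × β) × γ × List γ =>
        (y.2.2, y.1.2.1.2 ++ [(y.1.2.2, y.2.1)])) (by fun_prop) (by fun_prop) (by fun_prop)
  refine (snd.comp (foldl_of_grow (s := fun a => (l' a, ([] : List (β × γ)))) hl (by fun_prop) hg
    (G := fun x => sz x + 3) (PB.sz.add (PB.const 3)) fun a s b => ?_)).of_eq fun a => ?_
  · obtain ⟨_ | ⟨c, t⟩, s⟩ := s
    · simp
    · have := sz_append s [(b, c)]
      simp only [sz_mk, sz_cons, sz_nil] at this ⊢
      omega
  · have key : ∀ (l : List β) (l' : List γ) (s : List (β × γ)),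
        (l.foldl (fun (x : List γ × List (β × γ)) b =>
          List.casesOn (motive := fun _ => List γ × List (β × γ)) x.1 x
            fun c t => (t, x.2 ++ [(b, c)])) (l', s)).2 = s ++ l.zip l' := by
      intro l
      induction l with
      | nil => simp
      | cons b l ih =>
        intro l' s
        cases l' with
        | nil => simpa using ih [] s
        | cons c l' => simpa using ih l' (s ++ [(b, c)])
    exact key _ _ []

theorem zipWith {g : α → β → γ → δ} {l : α → List β} {l' : α → List γ} (hl : PolyF l)
    (hl' : PolyF l') (hg : PolyF fun x : α × β × γ => g x.1 x.2.1 x.2.2) :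
    PolyF fun a => List.zipWith (g a) (l a) (l' a) :=
  (map (g := fun a (x : β × γ) => g a x.1 x.2) (zip hl hl') hg).of_eq fun a => by
    rw [List.zip_eq_zipWith, List.map_zipWith]

@[fun_prop]
theorem beqStr {l l' : α → List Bool} (hl : PolyF l) (hl' : PolyF l') :
    PolyF fun a => l a == l' a :=
  ((natEq hl.length hl'.length).and (all (g := fun _ (x : Bool × Bool) => x.1 == x.2)
    (zip hl hl') (by fun_prop))).of_eq fun a => by
      generalize l a = l, l' a = l'
      induction l generalizing l' with
      | nil => cases l' <;> simp
      | cons b l ih =>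
        cases l' with
        | nil => simp
        | cons c l' =>
          have := ih l'
          rw [List.cons_beq_cons, ← this]
          cases h : b == c <;> simp [h]

end PolyF


/-! ### Gates and circuits as data -/

/-- A gate as a tuple. -/
def Gate.tuple : Gate → Bool × Bool × Bool × ℕ × ℕ
  | .const b => (false, false, b, 0, 0)
  | .not i => (false, true, false, i, 0)
  | .and i j => (true, false, false, i, j)
  | .or i j => (true, true, false, i, j)

instance : Enc Gate := ⟨fun g => Enc.enc g.tuple⟩

namespace PolyF

variable {α β γ δ σ : Type} [Enc α] [Enc β] [Enc γ] [Enc δ] [Enc σ]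

/-- The tuple has all fields for every constructor, with default values, so each branch can be
formed for any gate and the two tag bits select the right one. -/
theorem gateCases {g : α → Gate} {f₁ : α → Bool → δ} {f₂ : α → ℕ → δ} {f₃ f₄ : α → ℕ → ℕ → δ}
    (hg : PolyF g) (h₁ : PolyF fun x : α × Bool => f₁ x.1 x.2)
    (h₂ : PolyF fun x : α × ℕ => f₂ x.1 x.2) (h₃ : PolyF fun x : α × ℕ × ℕ => f₃ x.1 x.2.1 x.2.2)
    (h₄ : PolyF fun x : α × ℕ × ℕ => f₄ x.1 x.2.1 x.2.2) :
    PolyF fun a => Gate.casesOn (motive := fun _ => δ) (g a) (f₁ a) (f₂ a) (f₃ a) (f₄ a) := by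
  have ht : PolyF fun a => (g a).tuple := (of_enc (f := Gate.tuple) fun _ => rfl).comp hg
  have h₁' : PolyF fun a => f₁ a (g a).tuple.2.2.1 :=
    h₁.comp (g := fun a => (a, (g a).tuple.2.2.1)) (by fun_prop)
  have h₂' : PolyF fun a => f₂ a (g a).tuple.2.2.2.1 :=
    h₂.comp (g := fun a => (a, (g a).tuple.2.2.2.1)) (by fun_prop)
  have h₃' : PolyF fun a => f₃ a (g a).tuple.2.2.2.1 (g a).tuple.2.2.2.2 :=
    h₃.comp (g := fun a => (a, (g a).tuple.2.2.2)) (by fun_prop)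
  have h₄' : PolyF fun a => f₄ a (g a).tuple.2.2.2.1 (g a).tuple.2.2.2.2 :=
    h₄.comp (g := fun a => (a, (g a).tuple.2.2.2)) (by fun_prop)
  refine (cond (c := fun a => (g a).tuple.1) (by fun_prop)
    (cond (c := fun a => (g a).tuple.2.1) (by fun_prop) h₄' h₃')
    (cond (c := fun a => (g a).tuple.2.1) (by fun_prop) h₂' h₁')).of_eq fun a => ?_
  cases g a <;> rfl

theorem of_tuple {g : α → Gate} (h : PolyF fun a => (g a).tuple) : PolyF g := h

@[fun_prop]
theorem gateConst {f : α → Bool} (hf : PolyF f) : PolyF fun a => Gate.const (f a) :=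
  of_tuple (by simp only [Gate.tuple]; fun_prop)

@[fun_prop]
theorem gateNot {f : α → ℕ} (hf : PolyF f) : PolyF fun a => Gate.not (f a) :=
  of_tuple (by simp only [Gate.tuple]; fun_prop)

@[fun_prop]
theorem gateAnd {f g : α → ℕ} (hf : PolyF f) (hg : PolyF g) : PolyF fun a => Gate.and (f a) (g a) :=
  of_tuple (by simp only [Gate.tuple]; fun_prop)

@[fun_prop]
theorem gateOr {f g : α → ℕ} (hf : PolyF f) (hg : PolyF g) : PolyF fun a => Gate.or (f a) (g a) :=
  of_tuple (by simp only [Gate.tuple]; fun_prop)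

@[fun_prop]
theorem gateEval {w : α → List Bool} {g : α → Gate} (hw : PolyF w) (hg : PolyF g) :
    PolyF fun a => (g a).eval (w a) := by
  have hw1 : PolyF fun x : α × ℕ => w x.1 := by fun_prop
  have hw2 : PolyF fun x : α × ℕ × ℕ => w x.1 := by fun_prop
  refine (gateCases (f₁ := fun _ b => b) (f₂ := fun a i => !((w a).getD i false))
    (f₃ := fun a i j => (w a).getD i false && (w a).getD j false)
    (f₄ := fun a i j => (w a).getD i false || (w a).getD j false) hg
    (by fun_prop) (by fun_prop) (by fun_prop) (by fun_prop)).of_eq fun a => ?_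
  cases g a <;> rfl

end PolyF

/-- Values of all wires. -/
def wires (G : List Gate) (u : List Bool) : List Bool := G.foldl (fun w a => w ++ [a.eval w]) u

/-- Value of the circuit with the given gates and outputs. -/
def evalC (G : List Gate) (O : List ℕ) (u : List Bool) : List Bool :=
  O.map fun o => (wires G u).getD o false

namespace PolyF

variable {α : Type} [Enc α]

@[fun_prop]
theorem wires {G : α → List Gate} {u : α → List Bool} (hG : PolyF G) (hu : PolyF u) :
    PolyF fun a => wires (G a) (u a) :=
  foldl_of_grow (g := fun x : α × List Bool × Gate => x.2.1 ++ [x.2.2.eval x.2.1]) hG hu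
    (by fun_prop) (PB.const 4) fun a s b => by
      have h1 := sz_append s [b.eval s]
      have h2 := sz_bool_le (b.eval s)
      simp only [sz_cons, sz_nil] at h1 ⊢
      omega

@[fun_prop]
theorem evalC {G : α → List Gate} {O : α → List ℕ} {u : α → List Bool} (hG : PolyF G)
    (hO : PolyF O) (hu : PolyF u) : PolyF fun a => evalC (G a) (O a) (u a) :=
  map (g := fun a o => (PPPIndex.wires (G a) (u a)).getD o false) hO (by fun_prop)

end PolyF

/-! ### Encoding -/

theorem encList_eq {α : Type} (e : α → List Bool) (l : List α) :
    encList e l = l.flatMap (fun a => true :: e a) ++ [false] := by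
  induction l with
  | nil => rfl
  | cons a l ih => simp [encList, ih]

namespace PolyF

variable {α β : Type} [Enc α] [Enc β]

theorem encList {e : β → List Bool} {l : α → List β} (he : PolyF e) (hl : PolyF l) :
    PolyF fun a => encList e (l a) :=
  ((flatMap (g := fun _ b => true :: e b) hl (by fun_prop)).append (const [false])).of_eq
    fun a => (encList_eq e (l a)).symm

@[fun_prop]
theorem encStr {u : α → List Bool} (hu : PolyF u) : PolyF fun a => encStr (u a) :=
  encList (by fun_prop) hu

@[fun_prop]
theorem encUnary {n : α → ℕ} (hn : PolyF n) : PolyF fun a => encUnary (n a) :=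
  (replicate hn (const true)).append (const [false])

@[fun_prop]
theorem encGate {g : α → Gate} (hg : PolyF g) : PolyF fun a => encGate (g a) := by
  refine (gateCases (f₁ := fun _ b => [false, false, b])
    (f₂ := fun _ i => [false, true] ++ PPPIndex.encUnary i)
    (f₃ := fun _ i j => [true, false] ++ PPPIndex.encUnary i ++ PPPIndex.encUnary j)
    (f₄ := fun _ i j => [true, true] ++ PPPIndex.encUnary i ++ PPPIndex.encUnary j) hg
    (by fun_prop) (by fun_prop) (by fun_prop) (by fun_prop)).of_eq fun a => ?_
  cases g a <;> rfl

end PolyF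

/-! ### Parsing -/

/-- The parser `p` reads the encoding `e` off the front of a string. -/
def Parses {α : Type} (p : List Bool → α × List Bool) (e : α → List Bool) : Prop :=
  ∀ a u, p (e a ++ u) = (a, u)

def parseStep {α : Type} (p : List Bool → α × List Bool) (s : List α × List Bool) :
    List α × List Bool :=
  bif s.2.headD false then (s.1 ++ [(p s.2.tail).1], (p s.2.tail).2) else s

/-- The string itself serves as fuel: every entry of an encoded list takes at least one bit, and
spare rounds change nothing once the closing `0` is in front. Strings that are not encodings yield
arbitrary values; `indexDecide` detects them by encoding the result again. -/
def parseList {α : Type} (p : List Bool → α × List Bool) (x : List Bool) : List α × List Bool :=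
  let s := x.foldl (fun s _ => parseStep p s) ([], x)
  (s.1, s.2.tail)

theorem foldl_parseStep {α : Type} {p : List Bool → α × List Bool} {e : α → List Bool}
    (hp : Parses p e) (l : List α) (acc : List α) (u x : List Bool) (hx : l.length ≤ x.length) :
    x.foldl (fun s _ => parseStep p s) (acc, encList e l ++ u) = (acc ++ l, false :: u) := by
  induction x generalizing l acc with
  | nil =>
    obtain rfl : l = [] := List.length_eq_zero_iff.1 (by simpa using hx)
    simp [encList]
  | cons b x ih =>
    cases l with
    | nil => simpa [encList, parseStep] using ih [] acc (by simp)
    | cons a l =>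
      have h := ih l (acc ++ [a]) (by simpa using hx)
      simp only [encList, List.cons_append, List.append_assoc, List.foldl_cons]
      rw [parseStep]
      simp only [List.headD_cons, List.tail_cons, cond_true, hp a]
      simpa using h

theorem length_le_encList {α : Type} (e : α → List Bool) (l : List α) :
    l.length ≤ (encList e l).length := by
  induction l with
  | nil => simp
  | cons a l ih => simp [encList]; omega

theorem parses_parseList {α : Type} {p : List Bool → α × List Bool} {e : α → List Bool}
    (hp : Parses p e) : Parses (parseList p) (encList e) := by
  intro l u
  have := foldl_parseStep hp l [] u (encList e l ++ u) (by
    have := length_le_encList e l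
    simp; omega)
  simp [parseList, this]

theorem length_parseStep_le {α : Type} {p : List Bool → α × List Bool}
    (h : ∀ r, (p r).2.length ≤ r.length) (s : List α × List Bool) :
    (parseStep p s).2.length ≤ s.2.length := by
  rw [parseStep]
  cases s.2.headD false
  · simp
  · exact (h _).trans (by simp)

theorem length_parseList_le {α : Type} {p : List Bool → α × List Bool}
    (h : ∀ r, (p r).2.length ≤ r.length) (x : List Bool) :
    (parseList p x).2.length ≤ x.length := by
  have : ∀ (y : List Bool) (s : List α × List Bool),
      (y.foldl (fun s _ => parseStep p s) s).2.length ≤ s.2.length := by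
    intro y
    induction y with
    | nil => simp
    | cons b y ih => exact fun s => (ih _).trans (length_parseStep_le h s)
  simp only [parseList, List.length_tail]
  have := this x ([], x)
  simp only at this
  omega

/-- Since remainders never get longer, every entry is parsed from a string of length at most that of
the input. This bounds each entry separately, whereas composing the size bound of `p` with itself in
every round would not be polynomial. -/
theorem PolyF.parseList {α : Type} [Enc α] {p : List Bool → α × List Bool} (hp : PolyF p)
    (h : ∀ r, (p r).2.length ≤ r.length) : PolyF (parseList p) := by
  obtain ⟨k, hk⟩ := (fst.comp hp).pb_sz
  have hs : PolyF fun x : List Bool × (List α × List Bool) × Bool => parseStep p x.2.1 :=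
    cond (by fun_prop) (by fun_prop) (by fun_prop)
  have key := foldl_of_le (l := fun x : List Bool => x) (s := fun x => (([] : List α), x)) id'
    (by fun_prop) hs (B := fun x => sz x * ((4 * sz x + 3) ^ k + 1) + 1 + (4 * sz x + 1) + 1)
    ((((PB.sz.mul (((((PB.const 4).mul PB.sz).add (PB.const 3)).pow k).add (PB.const 1))).add
      (PB.const 1)).add (((PB.const 4).mul PB.sz).add (PB.const 1))).add (PB.const 1))
    fun x y hy => ?_
  · exact (fst.comp key).prodMk (tail'  (snd.comp key))
  · simp only
    have inv : ∀ (y : List Bool) (s : List α × List Bool), s.2.length ≤ x.length →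
        (∀ a ∈ s.1, sz a ≤ (4 * sz x + 3) ^ k) →
        let s' := y.foldl (fun s _ => parseStep p s) s
        s'.2.length ≤ x.length ∧ (∀ a ∈ s'.1, sz a ≤ (4 * sz x + 3) ^ k) ∧
          s'.1.length ≤ s.1.length + y.length := by
      intro y
      induction y with
      | nil => intro s h1 h2; exact ⟨h1, h2, by simp⟩
      | cons b y ih =>
        intro s h1 h2
        obtain ⟨h3, h4, h5⟩ := ih (parseStep p s) ((length_parseStep_le h s).trans h1) (by
          intro a ha
          rw [parseStep] at ha
          cases hb : s.2.headD false
          · rw [hb] at ha; exact h2 a ha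
          · rw [hb] at ha
            simp only [cond_true, List.mem_append, List.mem_singleton] at ha
            rcases ha with ha | rfl
            · exact h2 a ha
            · refine (hk _).trans (Nat.pow_le_pow_left ?_ k)
              have e1 := sz_str_le s.2.tail
              have e2 := length_le_sz x
              simp only [List.length_tail] at e1
              omega)
        refine ⟨h3, h4, h5.trans ?_⟩
        have : (parseStep p s).1.length ≤ s.1.length + 1 := by
          rw [parseStep]; cases s.2.headD false <;> simp
        simp only [List.length_cons]; omega
    obtain ⟨h1, h2, h3⟩ := inv y ([], x) le_rfl (by simp)
    set s' := y.foldl (fun s _ => parseStep p s) ([], x)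
    have e1 := sz_list_le h2
    have e2 := sz_str_le s'.2
    have e3 := length_le_sz x
    have e4 := hy.length_le
    simp only [List.length_nil] at h3
    have e5 := Nat.mul_le_mul_right ((4 * sz x + 3) ^ k + 1) (by omega : s'.1.length ≤ sz x)
    have e6 : sz s' = sz s'.1 + sz s'.2 + 1 := rfl
    omega

def parseBit (x : List Bool) : Bool × List Bool := (x.headD false, x.tail)

def parseStr : List Bool → List Bool × List Bool := parseList parseBit

def parseUnary (x : List Bool) : ℕ × List Bool :=
  ((parseList (fun r => ((), r)) x).1.length, (parseList (fun r => ((), r)) x).2)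

def parseGate (x : List Bool) : Gate × List Bool :=
  let r := x.tail.tail
  let i := parseUnary r
  let j := parseUnary i.2
  bif x.headD false then
    (bif x.tail.headD false then Gate.or i.1 j.1 else Gate.and i.1 j.1, j.2)
  else bif x.tail.headD false then (Gate.not i.1, i.2) else (Gate.const (r.headD false), r.tail)

def parseGates : List Bool → List Gate × List Bool := parseList parseGate

def parseNats : List Bool → List ℕ × List Bool := parseList parseUnary

theorem length_parseStr_le (x : List Bool) : (parseStr x).2.length ≤ x.length :=
  length_parseList_le (fun r => by simp [parseBit]) x

theorem length_parseUnary_le (x : List Bool) : (parseUnary x).2.length ≤ x.length :=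
  length_parseList_le (fun _ => le_rfl) x

theorem length_parseGate_le (x : List Bool) : (parseGate x).2.length ≤ x.length := by
  have h1 := length_parseUnary_le x.tail.tail
  have h2 := length_parseUnary_le (parseUnary x.tail.tail).2
  simp only [parseGate]
  cases x.headD false <;> cases x.tail.headD false <;>
    simp only [cond_true, cond_false, List.length_tail] at h1 h2 ⊢ <;> omega

theorem parses_parseStr : Parses parseStr encStr := parses_parseList fun b u => by simp [parseBit]

theorem parses_parseUnary : Parses parseUnary encUnary := by
  intro n u
  have h : encUnary n = encList (fun _ : Unit => []) (List.replicate n ()) := by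
    rw [encList_eq, encUnary]
    congr 1
    induction n with
    | zero => rfl
    | succ n ih => simp [List.replicate_succ, ih]
  have h2 : parseList (fun r => ((), r)) (encUnary n ++ u) = (List.replicate n (), u) := by
    rw [h]
    exact parses_parseList (fun b u => by simp) _ _
  simp [parseUnary, h2]

theorem parses_parseGate : Parses parseGate encGate := by
  intro g u
  cases g <;> simp [parseGate, encGate, parses_parseUnary _ _]

theorem PolyF.polyF_parseStr : PolyF parseStr :=
  parseList (by unfold parseBit; fun_prop) fun r => by simp [parseBit]

theorem PolyF.polyF_parseUnary : PolyF parseUnary := by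
  have : PolyF (PPPIndex.parseList fun r => ((), r)) := parseList (by fun_prop) fun _ => le_rfl
  exact (length (fst.comp this)).prodMk (snd.comp this)

@[fun_prop]
theorem PolyF.parseStr {α : Type} [Enc α] {u : α → List Bool} (hu : PolyF u) :
    PolyF fun a => parseStr (u a) := polyF_parseStr.comp hu

@[fun_prop]
theorem PolyF.parseUnary {α : Type} [Enc α] {u : α → List Bool} (hu : PolyF u) :
    PolyF fun a => parseUnary (u a) := polyF_parseUnary.comp hu

theorem parses_parseGates : Parses parseGates (encList encGate) := parses_parseList parses_parseGate

theorem parses_parseNats : Parses parseNats (encList encUnary) := parses_parseList parses_parseUnary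

theorem PolyF.polyF_parseGate : PolyF parseGate := by
  unfold PPPIndex.parseGate
  fun_prop

theorem PolyF.polyF_parseGates : PolyF parseGates := parseList polyF_parseGate length_parseGate_le

theorem PolyF.polyF_parseNats : PolyF parseNats := parseList polyF_parseUnary length_parseUnary_le

@[fun_prop]
theorem PolyF.parseGates {α : Type} [Enc α] {u : α → List Bool} (hu : PolyF u) :
    PolyF fun a => parseGates (u a) := polyF_parseGates.comp hu

@[fun_prop]
theorem PolyF.parseNats {α : Type} [Enc α] {u : α → List Bool} (hu : PolyF u) :
    PolyF fun a => parseNats (u a) := polyF_parseNats.comp hu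


/-! ### Instances of Index as raw data -/

/-- The data of an instance of Index, without the conditions that make it an instance. -/
structure Raw where
  s : List Bool
  n : ℕ
  G : List Gate
  O : List ℕ
  ident : List Bool
  gen : List Bool
  target : List Bool

def Raw.tuple (r : Raw) :
    List Bool × ℕ × List Gate × List ℕ × List Bool × List Bool × List Bool :=
  (r.s, r.n, r.G, r.O, r.ident, r.gen, r.target)

instance : Enc Raw := ⟨fun r => Enc.enc r.tuple⟩

namespace PolyF

variable {α : Type} [Enc α] {r : α → Raw}

theorem rawTuple : PolyF Raw.tuple := of_enc fun _ => rfl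

@[fun_prop]
theorem rawS (hr : PolyF r) : PolyF fun a => (r a).s :=
  fst.comp (rawTuple.comp hr)

@[fun_prop]
theorem rawN (hr : PolyF r) : PolyF fun a => (r a).n :=
  fst.comp (snd.comp (rawTuple.comp hr))

@[fun_prop]
theorem rawG (hr : PolyF r) : PolyF fun a => (r a).G :=
  fst.comp (snd.comp (snd.comp (rawTuple.comp hr)))

@[fun_prop]
theorem rawO (hr : PolyF r) : PolyF fun a => (r a).O :=
  fst.comp (snd.comp (snd.comp (snd.comp (rawTuple.comp hr))))

@[fun_prop]
theorem rawIdent (hr : PolyF r) : PolyF fun a => (r a).ident :=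
  fst.comp (snd.comp (snd.comp (snd.comp (snd.comp (rawTuple.comp hr)))))

@[fun_prop]
theorem rawGen (hr : PolyF r) : PolyF fun a => (r a).gen :=
  fst.comp (snd.comp (snd.comp (snd.comp (snd.comp (snd.comp (rawTuple.comp hr))))))

@[fun_prop]
theorem rawTarget (hr : PolyF r) : PolyF fun a => (r a).target :=
  snd.comp (snd.comp (snd.comp (snd.comp (snd.comp (snd.comp (rawTuple.comp hr))))))

theorem of_rawTuple (h : PolyF fun a => (r a).tuple) : PolyF r := h

end PolyF

def Raw.enc (r : Raw) : List Bool :=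
  encStr r.s ++ (encUnary r.n ++ encList encGate r.G ++ encList encUnary r.O ++
    (encStr r.ident ++ (encStr r.gen ++ encStr r.target)))

theorem PolyF.polyF_rawEnc : PolyF Raw.enc :=
  append (by fun_prop) (append (append (append (by fun_prop) (encList (by fun_prop) (by fun_prop)))
    (encList (by fun_prop) (by fun_prop))) (by fun_prop))

@[fun_prop]
theorem PolyF.rawEnc {α : Type} [Enc α] {r : α → Raw} (hr : PolyF r) :
    PolyF fun a => (r a).enc := polyF_rawEnc.comp hr

/-- Read an instance off the front of a string. -/
def parseRaw (x : List Bool) : Raw × List Bool :=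
  let s := parseStr x
  let n := parseUnary s.2
  let G := parseGates n.2
  let O := parseNats G.2
  let e := parseStr O.2
  let g := parseStr e.2
  let t := parseStr g.2
  (⟨s.1, n.1, G.1, O.1, e.1, g.1, t.1⟩, t.2)

theorem parses_parseRaw : Parses parseRaw Raw.enc := by
  intro r u
  simp [parseRaw, Raw.enc, parses_parseStr _ _, parses_parseUnary _ _,
    parses_parseGates _ _, parses_parseNats _ _]

theorem PolyF.polyF_parseRaw : PolyF parseRaw := by
  have h₁ := polyF_parseStr
  have h₂ := polyF_parseUnary.comp (snd.comp h₁)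
  have h₃ := polyF_parseGates.comp (snd.comp h₂)
  have h₄ := polyF_parseNats.comp (snd.comp h₃)
  have h₅ := polyF_parseStr.comp (snd.comp h₄)
  have h₆ := polyF_parseStr.comp (snd.comp h₅)
  have h₇ := polyF_parseStr.comp (snd.comp h₆)
  exact prodMk (of_rawTuple ((fst.comp h₁).prodMk ((fst.comp h₂).prodMk ((fst.comp h₃).prodMk
    ((fst.comp h₄).prodMk ((fst.comp h₅).prodMk ((fst.comp h₆).prodMk (fst.comp h₇)))))))) 
    (snd.comp h₇)

@[fun_prop]
theorem PolyF.parseRaw {α : Type} [Enc α] {u : α → List Bool} (hu : PolyF u) :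
    PolyF fun a => parseRaw (u a) := polyF_parseRaw.comp hu

/-! ### Comparison of binary numbers -/

/-- One step of the comparison, from the least significant bit upwards. -/
def ltStep (acc : Bool) (p : Bool × Bool) : Bool := bif p.1 == p.2 then acc else p.2

/-- `bc u < bc v`, for strings of the same length. -/
def ltEq (u v : List Bool) : Bool := (u.zip v).reverse.foldl ltStep false

/-- A left fold over the reversed list is a right fold, so the induction peels off the most
significant bit: a difference there decides, otherwise the lower bits do. -/
theorem ltEq_iff {u v : List Bool} (h : u.length = v.length) : ltEq u v = true ↔ bc u < bc v := by
  rw [ltEq, List.foldl_reverse]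
  induction u generalizing v with
  | nil =>
    obtain rfl : v = [] := List.length_eq_zero_iff.1 (by simpa using h.symm)
    simp [bc]
  | cons a u ih =>
    cases v with
    | nil => simp at h
    | cons b v =>
      have hl : u.length = v.length := by simpa using h
      have h1 := bc_lt u
      have h2 := bc_lt v
      have h3 := ih hl
      rw [List.zip_cons_cons, List.foldr_cons, bc, bc, hl]
      rw [hl] at h1
      generalize (u.zip v).foldr (fun x y => ltStep y x) false = acc at h3 ⊢
      cases a <;> cases b <;> simp [ltStep, h3] <;> omega

def pad (n : ℕ) (u : List Bool) : List Bool := List.replicate (n - u.length) false ++ u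

theorem length_pad {n : ℕ} {u : List Bool} (h : u.length ≤ n) : (pad n u).length = n := by
  simp [pad]; omega

theorem bc_pad (n : ℕ) (u : List Bool) : bc (pad n u) = bc u := by
  rw [pad]
  induction n - u.length with
  | zero => rfl
  | succ k ih => simpa [List.replicate_succ, bc] using ih

/-- `bc u < bc v`. -/
def ltB (u v : List Bool) : Bool := ltEq (pad (u.length + v.length) u) (pad (u.length + v.length) v)

theorem ltB_iff (u v : List Bool) : ltB u v = true ↔ bc u < bc v := by
  rw [ltB, ltEq_iff, bc_pad, bc_pad]
  rw [length_pad (by omega), length_pad (by omega)]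

namespace PolyF

variable {α : Type} [Enc α]

@[fun_prop]
theorem pad {n : α → ℕ} {u : α → List Bool} (hn : PolyF n) (hu : PolyF u) :
    PolyF fun a => pad (n a) (u a) :=
  (replicate (natSub hn (length hu)) (const false)).append hu

@[fun_prop]
theorem ltB {u v : α → List Bool} (hu : PolyF u) (hv : PolyF v) : PolyF fun a => ltB (u a) (v a) := by
  unfold PPPIndex.ltB ltEq
  refine foldl_of_grow (g := fun x : α × Bool × Bool × Bool => ltStep x.2.1 x.2.2) (by fun_prop)
    (by fun_prop) (by unfold ltStep; fun_prop) (PB.const 3) fun a s b => ?_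
  have := sz_bool_le (ltStep s b)
  show sz (ltStep s b) ≤ sz s + 3
  omega

end PolyF

/-! ### The indexing function on raw data -/

namespace Raw

variable (r : Raw)

def op (u v : List Bool) : List Bool := evalC r.G r.O (u ++ v)

/-- One step of the indexing function. The flag tells if a nonzero bit has been seen. -/
def idxStep (p : Bool × List Bool) (b : Bool) : Bool × List Bool :=
  let v := r.op p.2 p.2
  (p.1 || b, bif p.1 || b then (bif b then r.op r.gen v else v) else p.2)

/-- The indexing function on strings; leading zeros are allowed. -/
def idx (u : List Bool) : List Bool :=
  let p := u.foldl r.idxStep (false, r.ident)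
  bif p.1 then p.2 else r.op r.ident r.ident

/-- The circuit of an instance has `l` outputs. -/
def l : ℕ := r.O.length

/-- `u` represents an element of `[s]`. -/
def below (u : List Bool) : Bool := decide (u.length = r.l) && ltB u r.s

end Raw

namespace PolyF

variable {α : Type} [Enc α] {r : α → Raw} {u v : α → List Bool}

@[fun_prop]
theorem rawOp (hr : PolyF r) (hu : PolyF u) (hv : PolyF v) : PolyF fun a => (r a).op (u a) (v a) := by
  unfold Raw.op; fun_prop

@[fun_prop]
theorem rawL (hr : PolyF r) : PolyF fun a => (r a).l := by
  unfold Raw.l; fun_prop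

@[fun_prop]
theorem rawBelow (hr : PolyF r) (hu : PolyF u) : PolyF fun a => (r a).below (u a) := by
  unfold Raw.below; fun_prop

theorem sz_op_le (r : Raw) (u v : List Bool) : sz (r.op u v) ≤ 4 * r.l + 1 := by
  have := sz_str_le (r.op u v)
  rwa [Raw.op, PPPIndex.evalC, List.length_map] at this

-- The register is overwritten by values of length `l` and never lengthened, so each step adds at
-- most the size of one such value.
@[fun_prop]
theorem rawIdx (hr : PolyF r) (hu : PolyF u) : PolyF fun a => (r a).idx (u a) := by
  have hs : PolyF fun x : α × (Bool × List Bool) × Bool => (r x.1).idxStep x.2.1 x.2.2 := by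
    unfold Raw.idxStep; fun_prop
  have hG : PB fun x : α × Bool => 4 * sz (r x.1).l + 4 :=
    ((PB.const 4).mul (pb_sz (f := fun x : α × Bool => (r x.1).l) (by fun_prop))).add (PB.const 4)
  have key := foldl_of_grow hu (s := fun a => (false, (r a).ident)) (by fun_prop) hs hG
    fun a s b => by
      have h1 := sz_bool_le (s.1 || b)
      have h2 : sz s = sz s.1 + sz s.2 + 1 := rfl
      have h3 := sz_op_le (r a) s.2 s.2
      have h4 := sz_op_le (r a) (r a).gen ((r a).op s.2 s.2)
      have h5 := sz_pos s.1
      have h6 : sz false = 1 := rfl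
      have h7 : sz true = 3 := rfl
      simp only [Raw.idxStep, sz_mk, sz_nat]
      cases s.1 || b <;> cases b <;> simp only [cond_true, cond_false] at * <;> omega
  unfold Raw.idx
  exact cond (fst.comp key) (snd.comp key) (by fun_prop)

end PolyF

/-! ### Instances of Index -/

namespace IndexInput

def toRaw (i : IndexInput) : Raw :=
  ⟨bd0 i.s, 2 * i.l, i.f.gates, i.f.outputs, bd i.l i.ident, bd i.l i.gen, bd i.l i.target⟩

theorem enc_toRaw (i : IndexInput) : i.toRaw.enc = i.enc := by
  simp [toRaw, Raw.enc, enc, encCircuit, l]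

theorem toRaw_l (i : IndexInput) : i.toRaw.l = i.l := i.f.length_outputs

theorem op_toRaw (i : IndexInput) (u v : List Bool) : i.toRaw.op u v = i.op u v := rfl

theorem length_op (i : IndexInput) (u v : List Bool) : (i.op u v).length = i.l :=
  i.f.length_eval _

theorem lt_two_pow_l (i : IndexInput) {a : ℕ} (h : a < i.s) : a < 2 ^ i.l :=
  lt_of_lt_of_le h (Nat.le_pow_clog (by norm_num) i.s)

theorem below_toRaw_iff (i : IndexInput) (u : List Bool) :
    i.toRaw.below u = true ↔ ∃ x < i.s, u = bd i.l x := by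
  rw [Raw.below, Bool.and_eq_true, decide_eq_true_iff, ltB_iff, toRaw_l]
  simp only [toRaw, bc_bd0]
  constructor
  · rintro ⟨h1, h2⟩
    exact ⟨bc u, h2, by rw [← h1, bd_bc]⟩
  · rintro ⟨x, hx, rfl⟩
    rw [bc_bd (i.lt_two_pow_l hx)]
    exact ⟨length_bd _ _, hx⟩

end IndexInput

theorem bd0_bc {u : List Bool} (h : u.headD false = true) : bd0 (bc u) = u := by
  obtain _ | ⟨b, t⟩ := u
  · simp at h
  · obtain rfl : b = true := by simpa using h
    have h1 := bc_lt t
    have h2 : (bc (true :: t)).size = (true :: t).length := by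
      refine le_antisymm (Nat.size_le.2 (bc_lt _)) (Nat.lt_size.2 ?_)
      simp [bc]
    rw [bd0, h2, max_eq_right (by simp), bd_bc]

theorem headD_bd0 {a : ℕ} (h : 0 < a) : (bd0 a).headD false = true := by
  have h1 : 0 < a.size := Nat.size_pos.2 h
  obtain ⟨k, hk⟩ : ∃ k, a.size = k + 1 := ⟨a.size - 1, by omega⟩
  rw [bd0, max_eq_right (by omega), hk, bd, List.headD_cons]
  have h2 : 2 ^ k ≤ a := Nat.lt_size.1 (by omega)
  have h3 : a < 2 ^ (k + 1) := by rw [← hk]; exact Nat.lt_size_self a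
  rw [Nat.testBit_eq_decide_div_mod_eq, decide_eq_true_iff]
  have : a / 2 ^ k = 1 := by
    rw [Nat.div_eq_iff (by positivity)]
    rw [pow_succ] at h3
    omega
  rw [this]

theorem bc_replicate_false (k : ℕ) : bc (List.replicate k false) = 0 := by
  induction k with
  | zero => rfl
  | succ k ih => simpa [List.replicate_succ, bc] using ih

theorem exists_replicate_append (u : List Bool) :
    ∃ k v, u = List.replicate k false ++ v ∧ (v = [] ∨ v.headD false = true) := by
  induction u with
  | nil => exact ⟨0, [], rfl, Or.inl rfl⟩
  | cons b u ih =>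
    cases b
    · obtain ⟨k, v, rfl, hv⟩ := ih
      exact ⟨k + 1, v, rfl, hv⟩
    · exact ⟨0, true :: u, rfl, Or.inr rfl⟩

/-- Circuits and programs see `l`-bit strings, while the indexing function reads a number without
leading zeros. The flag in `Raw.idxStep` suppresses the leading zeros; from the first `1` on, both
computations take the same steps. -/
theorem IndexInput.idx_toRaw (i : IndexInput) (u : List Bool) :
    bc (i.toRaw.idx u) = i.indexFun (bc u) ∧ (i.toRaw.idx u).length = i.l := by
  suffices i.toRaw.idx u = (bd0 (bc u)).foldl (fun r b =>
      let r' := i.op r r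
      if b then i.op (bd i.l i.gen) r' else r') (bd i.l i.ident) by
    refine ⟨congrArg bc this, ?_⟩
    rw [this]
    have key : ∀ (v : List Bool) r, r.length = i.l → (v.foldl (fun r b =>
      let r' := i.op r r
      if b then i.op (bd i.l i.gen) r' else r') r).length = i.l := by
      intro v
      induction v with
      | nil => exact fun r hr => hr
      | cons b v ih =>
        intro r hr
        refine ih _ ?_
        cases b <;> exact i.length_op _ _
    exact key _ _ (length_bd _ _)
  obtain ⟨k, v, rfl, hv⟩ := exists_replicate_append u
  have h1 : ∀ k, (List.replicate k false).foldl i.toRaw.idxStep (false, i.toRaw.ident) =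
      (false, i.toRaw.ident) := by
    intro k
    induction k with
    | zero => rfl
    | succ k ih => rw [List.replicate_succ, List.foldl_cons]; exact ih
  have h2 : ∀ (v r : List Bool), v.foldl i.toRaw.idxStep (true, r) = (true, v.foldl (fun r b =>
      let r' := i.op r r
      if b then i.op (bd i.l i.gen) r' else r') r) := by
    intro v
    induction v with
    | nil => exact fun r => rfl
    | cons b v ih =>
      intro r
      rw [List.foldl_cons, List.foldl_cons, ← ih]
      cases b <;> rfl
  have h3 : bc (List.replicate k false ++ v) = bc v := by
    induction k with
    | zero => rfl
    | succ k ih => simpa [List.replicate_succ, bc] using ih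
  rw [Raw.idx, List.foldl_append, h1, h3]
  -- A string without a `1` stands for zero, whose representation is the single bit `0`: one
  -- squaring of the identity, the case of an unset flag.
  rcases hv with rfl | hv
  · rfl
  · rw [bd0_bc hv]
    obtain _ | ⟨b, t⟩ := v
    · simp at hv
    · obtain rfl : b = true := by simpa using hv
      have h4 : i.toRaw.idxStep (false, i.toRaw.ident) true = (true,
        i.op (bd i.l i.gen) (i.op (bd i.l i.ident) (bd i.l i.ident))) := rfl
      rw [List.foldl_cons, h4, h2]
      rfl


/-! ### Deciding which raw data are instances -/

def Gate.belowB (w : ℕ) : Gate → Bool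
  | .const _ => true
  | .not i => decide (i < w)
  | .and i j => decide (i < w) && decide (j < w)
  | .or i j => decide (i < w) && decide (j < w)

theorem Gate.belowB_iff (w : ℕ) (g : Gate) : g.belowB w = true ↔ g.Below w := by
  cases g <;> simp [belowB, Below]

def gatesBelowB (n : ℕ) (G : List Gate) : Bool :=
  (G.foldl (fun (p : ℕ × Bool) g => (p.1 + 1, p.2 && g.belowB p.1)) (n, true)).2

theorem gatesBelowB_iff (n : ℕ) (G : List Gate) : gatesBelowB n G = true ↔ GatesBelow n G := by
  have : ∀ (c : Bool) (n : ℕ),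
      (G.foldl (fun (p : ℕ × Bool) g => (p.1 + 1, p.2 && g.belowB p.1)) (n, c)).2 = true ↔
        c = true ∧ GatesBelow n G := by
    induction G with
    | nil => simp [GatesBelow]
    | cons g G ih =>
      intro c n
      rw [List.foldl_cons, ih]
      simp [GatesBelow, Gate.belowB_iff, and_assoc]
  exact (this true n).trans (by simp)

/-- `⌈log₂ (bc u)⌉`, for a string that starts with `1`. -/
def clogStr (u : List Bool) : ℕ := bif u.tail.any id then u.length else u.length - 1

/-- A string `1t` represents a number from `2 ^ |t|` up to below `2 ^ (|t| + 1)`, and the lower end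
is attained exactly if `t` contains no `1`. -/
theorem clogStr_eq {u : List Bool} (h : u.headD false = true) : clogStr u = Nat.clog 2 (bc u) := by
  obtain _ | ⟨b, t⟩ := u
  · simp at h
  · obtain rfl : b = true := by simpa using h
    have h1 := bc_lt t
    have h2 : bc (true :: t) = 2 ^ t.length + bc t := by simp [bc]
    rw [h2, clogStr, List.tail_cons]
    by_cases ht : bc t = 0
    · have h3 : t = List.replicate t.length false := by
        rw [← bd_bc (List.replicate t.length false), bc_replicate_false, ← ht,
          List.length_replicate, bd_bc]
      have h4 : t.any id = false := by rw [h3]; simp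
      rw [h4, ht, Nat.add_zero, Nat.clog_pow 2 _ (by norm_num)]
      simp
    · have h4 : t.any id = true := by
        by_contra hc
        rw [Bool.not_eq_true, List.any_eq_false] at hc
        apply ht
        have h3 : t = List.replicate t.length false :=
          List.eq_replicate_iff.2 ⟨rfl, fun b hb => by simpa using hc b hb⟩
        rw [h3, bc_replicate_false]
      rw [h4, cond_true, List.length_cons]
      refine le_antisymm ?_ (Nat.clog_le_of_le_pow (by rw [pow_succ]; omega))
      exact Nat.succ_le_of_lt ((Nat.lt_clog_iff_pow_lt (by norm_num)).2 (by omega))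

/-- The raw data are those of an instance. -/
def Raw.valid (r : Raw) : Bool :=
  r.s.headD false && (decide (1 < r.s.length) && (decide (r.l = clogStr r.s) &&
    (decide (r.n = 2 * r.l) && (gatesBelowB r.n r.G &&
      (r.O.all (fun o => decide (o < r.n + r.G.length)) &&
        (r.below r.ident && (r.below r.gen && r.below r.target)))))))

/-- The decision procedure uses this to recognize instances, and the reduction from Pigeon to obtain
an instance from the raw data that it writes down. -/
theorem Raw.valid_iff (r : Raw) : r.valid = true ↔ ∃ i : IndexInput, i.toRaw = r := by
  constructor
  · intro h
    simp only [Raw.valid, Bool.and_eq_true, decide_eq_true_iff, gatesBelowB_iff,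
      List.all_eq_true, Raw.below, ltB_iff] at h
    obtain ⟨h1, h2, h3, h4, h5, h6, ⟨h7, h7'⟩, ⟨h8, h8'⟩, h9, h9'⟩ := h
    rw [clogStr_eq h1] at h3
    refine ⟨⟨bc r.s, ?_, ⟨r.G, r.O, ?_, ?_, h3⟩, ⟨bc r.ident, h7'⟩, ⟨bc r.gen, h8'⟩,
      ⟨bc r.target, h9'⟩⟩, ?_⟩
    · generalize r.s = s at h1 h2
      obtain _ | ⟨b, _ | ⟨c, t⟩⟩ := s
      · simp at h2
      · simp at h2
      · obtain rfl : b = true := by simpa using h1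
        have := Nat.one_le_two_pow (n := t.length)
        simp only [bc, List.length_cons, pow_succ, Bool.toNat_true]
        omega
    · rw [← h3, ← h4]; exact h5
    · rw [← h3, ← h4]; exact h6
    · simp only [IndexInput.toRaw, IndexInput.l, ← h3, bd0_bc h1, ← h4]
      obtain ⟨s, n, G, O, a, b, c⟩ := r
      simp only [Raw.mk.injEq, true_and]
      exact ⟨by rw [← h7]; exact bd_bc a, by rw [← h8]; exact bd_bc b,
        by rw [← h9]; exact bd_bc c⟩
  · rintro ⟨i, rfl⟩
    have hs : 0 < i.s := by have := i.two_le; omega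
    simp only [Raw.valid, Bool.and_eq_true, decide_eq_true_iff, gatesBelowB_iff,
      List.all_eq_true, i.below_toRaw_iff]
    refine ⟨headD_bd0 hs, ?_, ?_, ?_, i.f.gates_below, i.f.outputs_below,
      ⟨_, i.ident.2, rfl⟩, ⟨_, i.gen.2, rfl⟩, ⟨_, i.target.2, rfl⟩⟩
    · simp only [IndexInput.toRaw, bd0, length_bd]
      have : 1 < i.s.size := Nat.lt_size.2 (by simpa using i.two_le)
      omega
    · rw [show i.toRaw.s = bd0 i.s from rfl, clogStr_eq (headD_bd0 hs), i.toRaw_l, bc_bd0]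
      rfl
    · rw [i.toRaw_l]; rfl

namespace PolyF

variable {α : Type} [Enc α]

theorem gateBelowB {w : α → ℕ} {g : α → Gate} (hw : PolyF w) (hg : PolyF g) :
    PolyF fun a => (g a).belowB (w a) := by
  refine (gateCases (f₁ := fun _ _ => true) (f₂ := fun a i => decide (i < w a))
    (f₃ := fun a i j => decide (i < w a) && decide (j < w a))
    (f₄ := fun a i j => decide (i < w a) && decide (j < w a)) hg
    (by fun_prop) (by fun_prop) (by fun_prop) (by fun_prop)).of_eq fun a => ?_
  cases g a <;> rfl

@[fun_prop]
theorem gatesBelowB {n : α → ℕ} {G : α → List Gate} (hn : PolyF n) (hG : PolyF G) :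
    PolyF fun a => gatesBelowB (n a) (G a) := by
  refine snd.comp (foldl_of_grow (g := fun x : α × (ℕ × Bool) × Gate =>
    (x.2.1.1 + 1, x.2.1.2 && x.2.2.belowB x.2.1.1)) hG (by fun_prop)
    (prodMk (by fun_prop) (and (by fun_prop) (gateBelowB (by fun_prop) (by fun_prop))))
    (PB.const 5) fun a s b => ?_)
  have h1 := sz_bool_le (s.2 && b.belowB s.1)
  have h2 : sz s = sz s.1 + sz s.2 + 1 := rfl
  have h3 := sz_pos s.2
  simp only [sz_mk, sz_nat] at *
  omega

@[fun_prop]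
theorem clogStr {u : α → List Bool} (hu : PolyF u) : PolyF fun a => clogStr (u a) := by
  unfold PPPIndex.clogStr
  exact cond (any (by fun_prop) (by fun_prop)) (by fun_prop) (by fun_prop)

@[fun_prop]
theorem rawValid {r : α → Raw} (hr : PolyF r) : PolyF fun a => (r a).valid := by
  have h : PolyF fun a => (r a).O.all (fun o => decide (o < (r a).n + (r a).G.length)) :=
    all (g := fun a o => decide (o < (r a).n + (r a).G.length)) (by fun_prop) (by fun_prop)
  unfold Raw.valid
  refine and (by fun_prop) (and (by fun_prop) (and (by fun_prop) (and (by fun_prop)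
    (and (by fun_prop) (and h (by fun_prop))))))

end PolyF

/-! ### Values outside of `[s]` -/

namespace Raw

variable (r : Raw)

/-- Record the pair `(u, v)` if `f (u, v)` is not below `s` and no pair has been recorded. -/
def record (w : Bool × List Bool × List Bool) (u v : List Bool) : Bool × List Bool × List Bool :=
  bif w.1 || r.below (r.op u v) then w else (true, u, v)

/-- One step of the indexing function that also records arguments with values outside of `[s]`. -/
def traceStep (p : (Bool × List Bool) × Bool × List Bool × List Bool) (b : Bool) :
    (Bool × List Bool) × Bool × List Bool × List Bool :=
  let v := r.op p.1.2 p.1.2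
  (r.idxStep p.1 b, bif p.1.1 || b then
    (bif b then r.record (r.record p.2 p.1.2 p.1.2) r.gen v else r.record p.2 p.1.2 p.1.2)
    else p.2)

/-- Arguments with values outside of `[s]` during the computation of the indexing function. -/
def trace (u : List Bool) : Bool × List Bool × List Bool :=
  let p := u.foldl r.traceStep ((false, r.ident), false, [], [])
  bif p.1.1 then p.2 else r.record p.2 r.ident r.ident

def Bad (p : List Bool × List Bool) : Prop :=
  r.below p.1 = true ∧ r.below p.2 = true ∧ r.below (r.op p.1 p.2) = false

variable {r}

theorem record_spec {w : Bool × List Bool × List Bool} {u v : List Bool}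
    (h : w.1 = true → r.Bad w.2) (hu : w.1 = false → r.below u = true)
    (hv : w.1 = false → r.below v = true) :
    ((r.record w u v).1 = true → r.Bad (r.record w u v).2) ∧
      ((r.record w u v).1 = false → w.1 = false ∧ r.below (r.op u v) = true) := by
  rw [record]
  cases hw : w.1
  · cases hb : r.below (r.op u v)
    · exact ⟨fun _ => ⟨hu hw, hv hw, hb⟩, fun h => by simp at h⟩
    · simp [hw]
  · simpa [hw] using h hw

/-- Invariant: a recorded pair consists of elements of `[s]` with product outside; as long as
nothing is recorded, the register is in `[s]`, so the next product again has both factors in `[s]`.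
-/
theorem trace_spec (hi : r.below r.ident = true) (hg : r.below r.gen = true) (u : List Bool) :
    ((r.trace u).1 = true → r.Bad (r.trace u).2) ∧
      ((r.trace u).1 = false → r.below (r.idx u) = true) := by
  have key : ∀ (u : List Bool) (p : (Bool × List Bool) × Bool × List Bool × List Bool),
      (p.2.1 = true → r.Bad p.2.2) → (p.2.1 = false → r.below p.1.2 = true) →
      let q := u.foldl r.traceStep p
      q.1 = u.foldl r.idxStep p.1 ∧ (q.2.1 = true → r.Bad q.2.2) ∧
        (q.2.1 = false → r.below q.1.2 = true) := by
    intro u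
    induction u with
    | nil => exact fun p h1 h2 => ⟨rfl, h1, h2⟩
    | cons b u ih =>
      intro p h1 h2
      refine ih (r.traceStep p b) ?_ ?_
      all_goals
        have h3 := record_spec h1 h2 h2
        have h4 := record_spec h3.1 (fun _ => hg) (fun h => (h3.2 h).2)
        rw [traceStep]
        cases hst : p.1.1 || b
        · simp only [cond_false]
          first | exact h1 | (intro h; simpa [idxStep, hst] using h2 h)
        · cases b
          · simp only [cond_true, cond_false]
            first | exact h3.1 | (intro h; simpa [idxStep, hst] using (h3.2 h).2)
          · simp only [cond_true]
            first | exact h4.1 | (intro h; simpa [idxStep, hst] using (h4.2 h).2)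
  obtain ⟨h1, h2, h3⟩ := key u ((false, r.ident), false, [], []) (by simp) (fun _ => hi)
  rw [trace, idx]
  simp only [← h1]
  cases (u.foldl r.traceStep ((false, r.ident), false, [], [])).1.1
  · have h4 := record_spec (u := r.ident) (v := r.ident) h2 (fun _ => hi) (fun _ => hi)
    exact ⟨h4.1, fun h => (h4.2 h).2⟩
  · exact ⟨h2, h3⟩

end Raw

/-! ### Solutions of Index -/

theorem bc_injective_of_length {u v : List Bool} (h : u.length = v.length) (hb : bc u = bc v) :
    u = v := by
  rw [← bd_bc u, ← bd_bc v, h, hb]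

namespace IndexInput

variable (i : IndexInput)

theorem length_of_below {u : List Bool} (h : i.toRaw.below u = true) : u.length = i.l := by
  obtain ⟨x, -, rfl⟩ := (i.below_toRaw_iff u).1 h
  exact length_bd _ _

theorem below_of_length {u : List Bool} (h : u.length = i.l) :
    i.toRaw.below u = true ↔ bc u < i.s := by
  rw [Raw.below, Bool.and_eq_true, decide_eq_true_iff, ltB_iff, toRaw_l]
  simp [toRaw, bc_bd0, h]

/-- Solutions, in terms of strings. -/
theorem sol_iff (y : List Bool) : i.Sol y ↔
    (∃ u, i.toRaw.below u = true ∧ y = encList encStr [u] ∧ i.toRaw.idx u = i.toRaw.target) ∨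
    (∃ p, i.toRaw.Bad p ∧ y = encList encStr [p.1, p.2]) ∨
    (∃ u v, i.toRaw.below u = true ∧ i.toRaw.below v = true ∧ y = encList encStr [u, v] ∧
      u ≠ v ∧ i.toRaw.idx u = i.toRaw.idx v) := by
  have hidx : ∀ x < i.s, bc (i.toRaw.idx (bd i.l x)) = i.indexFun x := fun x hx => by
    rw [(i.idx_toRaw _).1, bc_bd (i.lt_two_pow_l hx)]
  refine or_congr ?_ (or_congr ?_ ?_)
  · constructor
    · rintro ⟨x, hx, rfl, h⟩
      refine ⟨_, (i.below_toRaw_iff _).2 ⟨x, hx, rfl⟩, rfl, bc_injective_of_length ?_ ?_⟩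
      · rw [(i.idx_toRaw _).2]; exact (length_bd _ _).symm
      · rw [hidx x hx, h]; exact (bc_bd (i.lt_two_pow_l i.target.2)).symm
    · rintro ⟨u, hu, rfl, h⟩
      obtain ⟨x, hx, rfl⟩ := (i.below_toRaw_iff u).1 hu
      refine ⟨x, hx, rfl, ?_⟩
      rw [← hidx x hx, h]
      exact bc_bd (i.lt_two_pow_l i.target.2)
  · constructor
    · rintro ⟨x, hx, z, hz, rfl, h⟩
      refine ⟨(_, _), ⟨(i.below_toRaw_iff _).2 ⟨x, hx, rfl⟩, (i.below_toRaw_iff _).2 ⟨z, hz, rfl⟩,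
        ?_⟩, rfl⟩
      rw [← Bool.not_eq_true, op_toRaw, i.below_of_length (i.length_op _ _)]
      exact not_lt.2 h
    · rintro ⟨⟨u, v⟩, ⟨hu, hv, h⟩, rfl⟩
      obtain ⟨x, hx, rfl⟩ := (i.below_toRaw_iff u).1 hu
      obtain ⟨z, hz, rfl⟩ := (i.below_toRaw_iff v).1 hv
      refine ⟨x, hx, z, hz, rfl, ?_⟩
      rw [← Bool.not_eq_true, op_toRaw, i.below_of_length (i.length_op _ _)] at h
      exact not_lt.1 h
  · constructor
    · rintro ⟨x, hx, z, hz, rfl, hne, h⟩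
      refine ⟨_, _, (i.below_toRaw_iff _).2 ⟨x, hx, rfl⟩, (i.below_toRaw_iff _).2 ⟨z, hz, rfl⟩,
        rfl, fun h => hne ?_, bc_injective_of_length ?_ ?_⟩
      · rw [← bc_bd (i.lt_two_pow_l hx), h, bc_bd (i.lt_two_pow_l hz)]
      · rw [(i.idx_toRaw _).2, (i.idx_toRaw _).2]
      · rw [hidx x hx, hidx z hz, h]
    · rintro ⟨u, v, hu, hv, rfl, hne, h⟩
      obtain ⟨x, hx, rfl⟩ := (i.below_toRaw_iff u).1 hu
      obtain ⟨z, hz, rfl⟩ := (i.below_toRaw_iff v).1 hv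
      exact ⟨x, hx, z, hz, rfl, fun h => hne (by rw [h]), by rw [← hidx x hx, ← hidx z hz, h]⟩

theorem below_ident : i.toRaw.below i.toRaw.ident = true :=
  (i.below_toRaw_iff _).2 ⟨_, i.ident.2, rfl⟩

theorem below_gen : i.toRaw.below i.toRaw.gen = true := (i.below_toRaw_iff _).2 ⟨_, i.gen.2, rfl⟩

theorem length_encList_encStr (u v : List Bool) :
    (encList encStr [u, v]).length = 2 * u.length + 2 * v.length + 5 := by
  have h : ∀ u : List Bool, (encStr u).length = 2 * u.length + 1 := by
    intro u
    induction u with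
    | nil => rfl
    | cons b u ih =>
      rw [encStr] at ih ⊢
      simp [encList, ih]; omega
  simp [encList, h]; omega

/-- Without a bad pair the trace records nothing, so all index values stay in `[s]`, and a self-map
of a finite set is surjective or not injective. -/
theorem exists_sol : ∃ y, i.Sol y ∧ y.length ≤ 4 * i.l + 5 := by
  by_cases hb : ∃ p, i.toRaw.Bad p
  · obtain ⟨p, hp⟩ := hb
    refine ⟨_, (i.sol_iff _).2 (Or.inr (Or.inl ⟨p, hp, rfl⟩)), ?_⟩
    rw [length_encList_encStr, i.length_of_below hp.1, i.length_of_below hp.2.1]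
    omega
  · have h1 : ∀ x < i.s, i.indexFun x < i.s := by
      intro x hx
      have h2 := Raw.trace_spec i.below_ident i.below_gen (bd i.l x)
      have h3 : i.toRaw.below (i.toRaw.idx (bd i.l x)) = true :=
        h2.2 (by
          by_contra hc
          exact hb ⟨_, h2.1 (by simpa using hc)⟩)
      rw [i.below_of_length (i.idx_toRaw _).2, (i.idx_toRaw _).1, bc_bd (i.lt_two_pow_l hx)] at h3
      exact h3
    by_cases hinj : Function.Injective fun x : Fin i.s => (⟨i.indexFun x, h1 x x.2⟩ : Fin i.s)
    · obtain ⟨x, hx⟩ := (Finite.injective_iff_surjective.1 hinj) i.target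
      refine ⟨_, Or.inl ⟨x, x.2, rfl, congrArg Fin.val hx⟩, ?_⟩
      have := length_encList_encStr (bd i.l x) []
      simp [encList, length_bd] at this ⊢
      omega
    · simp only [Function.Injective, not_forall] at hinj
      obtain ⟨x, z, h, hne⟩ := hinj
      refine ⟨_, Or.inr (Or.inr ⟨x, x.2, z, z.2, rfl, fun h => hne (Fin.ext h),
        congrArg Fin.val h⟩), ?_⟩
      rw [length_encList_encStr, length_bd, length_bd]
      omega

end IndexInput

/-! ### Verification of solutions; Index is a total NP search problem -/

def parseStrs : List Bool → List (List Bool) × List Bool := parseList parseStr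

theorem parses_parseStrs : Parses parseStrs (encList encStr) := parses_parseList parses_parseStr

theorem PolyF.polyF_parseStrs : PolyF parseStrs := parseList polyF_parseStr length_parseStr_le

@[fun_prop]
theorem PolyF.parseStrs {α : Type} [Enc α] {u : α → List Bool} (hu : PolyF u) :
    PolyF fun a => parseStrs (u a) := polyF_parseStrs.comp hu

theorem parseStrs_encList (l : List (List Bool)) : (parseStrs (encList encStr l)).1 = l := by
  have := parses_parseStrs l []
  rw [List.append_nil] at this
  rw [this]

/-- Check a solution of an instance. -/
def Raw.check (r : Raw) (y : List Bool) : Bool :=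
  let ys := (parseStrs y).1
  let u := ys.headD []
  let v := ys.tail.headD []
  encList encStr ys == y && (r.below u && (
    (decide (ys.length = 1) && r.idx u == r.target) ||
    (decide (ys.length = 2) && (r.below v &&
      (!(r.below (r.op u v)) || (!(u == v) && r.idx u == r.idx v))))))

theorem IndexInput.check_iff (i : IndexInput) (y : List Bool) :
    i.toRaw.check y = true ↔ i.Sol y := by
  rw [sol_iff, Raw.check]
  simp only [Bool.and_eq_true, Bool.or_eq_true, beq_iff_eq, decide_eq_true_iff,
    Bool.not_eq_true']
  constructor
  · rintro ⟨hy, hu, ⟨h1, h2⟩ | ⟨h1, hv, h2⟩⟩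
    · obtain ⟨u, hl⟩ := List.length_eq_one_iff.1 h1
      rw [hl] at hy hu h2
      exact Or.inl ⟨u, hu, hy.symm, h2⟩
    · obtain ⟨u, v, hl⟩ := List.length_eq_two.1 h1
      rw [hl] at hy hu h2 hv
      rcases h2 with h2 | ⟨h2, h3⟩
      · exact Or.inr (Or.inl ⟨(u, v), ⟨hu, hv, h2⟩, hy.symm⟩)
      · exact Or.inr (Or.inr ⟨u, v, hu, hv, hy.symm, by simpa using h2, h3⟩)
  · rintro (⟨u, hu, rfl, h⟩ | ⟨⟨u, v⟩, ⟨hu, hv, h⟩, rfl⟩ | ⟨u, v, hu, hv, rfl, hne, h⟩)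
    · rw [parseStrs_encList]
      exact ⟨rfl, hu, Or.inl ⟨rfl, h⟩⟩
    · rw [parseStrs_encList]
      exact ⟨rfl, hu, Or.inr ⟨rfl, hv, Or.inl h⟩⟩
    · rw [parseStrs_encList]
      exact ⟨rfl, hu, Or.inr ⟨rfl, hv, Or.inr ⟨by simpa using hne, h⟩⟩⟩

@[fun_prop]
theorem PolyF.rawCheck {α : Type} [Enc α] {r : α → Raw} {y : α → List Bool} (hr : PolyF r)
    (hy : PolyF y) : PolyF fun a => (r a).check (y a) := by
  have h1 : PolyF fun a => (PPPIndex.parseStrs (y a)).1 := by fun_prop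
  unfold Raw.check
  exact and (beqStr (encList (by fun_prop) h1) hy) (by fun_prop)

theorem index_iff (x y : List Bool) : Index x y ↔
    (∀ i, IndexInput.enc i = x → i.Sol y) := Iff.rfl

/-- Decide if `y` is a solution for `x`. -/
def indexDecide (x y : List Bool) : Bool :=
  bif (parseRaw x).1.enc == x && (parseRaw x).1.valid then (parseRaw x).1.check y else true

theorem IndexInput.parseRaw_enc (i : IndexInput) (u : List Bool) :
    parseRaw (i.enc ++ u) = (i.toRaw, u) := by
  rw [← enc_toRaw, parses_parseRaw]

/-- By injectivity of the encoding, the parsed data belong to the only instance that matters; if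
parsing, encoding again or validation fails, there is no instance and every string is a solution. -/
theorem indexDecide_iff (x y : List Bool) : indexDecide x y = true ↔ Index x y := by
  rw [index_iff, indexDecide]
  by_cases h : ∃ i : IndexInput, i.enc = x
  · obtain ⟨i, rfl⟩ := h
    have h1 := i.parseRaw_enc []
    rw [List.append_nil] at h1
    have h2 : i.toRaw.valid = true := (Raw.valid_iff _).2 ⟨i, rfl⟩
    rw [h1]
    simp only [i.enc_toRaw, h2, beq_self_eq_true, Bool.and_self, cond_true, i.check_iff]
    exact ⟨fun h j hj => IndexInput.enc_injective hj ▸ h, fun h => h i rfl⟩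
  · have h1 : ((parseRaw x).1.enc == x && (parseRaw x).1.valid) = false := by
      rw [← Bool.not_eq_true, Bool.and_eq_true, beq_iff_eq, Raw.valid_iff]
      rintro ⟨h1, i, hi⟩
      exact h ⟨i, by rw [← i.enc_toRaw, hi, h1]⟩
    rw [h1]
    simp only [cond_false, true_iff]
    exact fun i hi => (h ⟨i, hi⟩).elim

theorem isTFNP_index : IsTFNP Index := by
  refine ⟨⟨fun p => indexDecide p.1 p.2, ?_, indexDecide_iff⟩, 4 * Polynomial.X + 5, fun x => ?_⟩
  · have h : PolyF fun z => [indexDecide (parseStr z).1 (parseStr z).2] := by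
      unfold indexDecide; fun_prop
    refine h.polyTime fun p => ?_
    rw [encPair, parses_parseStr]
  · by_cases h : ∃ i : IndexInput, i.enc = x
    · obtain ⟨i, rfl⟩ := h
      obtain ⟨y, hy, hl⟩ := i.exists_sol
      refine ⟨y, fun j hj => IndexInput.enc_injective hj ▸ hy, hl.trans ?_⟩
      -- The encoding contains the `l` bits of the identity, so a bound linear in `l` is linear in
      -- the length of the instance.
      have : i.l ≤ i.enc.length := by
        have := length_le_encList (fun b => [b]) (bd i.l i.ident)
        rw [length_bd] at this
        simp only [IndexInput.enc, List.length_append]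
        simp only [encStr]
        omega
      simp only [Polynomial.eval_add, Polynomial.eval_mul, Polynomial.eval_X,
        Polynomial.eval_ofNat]
      omega
    · exact ⟨[], fun i hi => (h ⟨i, hi⟩).elim, Nat.zero_le _⟩


/-! ### Building circuits -/

/-- The wires `ws` carry the values `bs`. -/
def Holds (w : List Bool) (ws : List ℕ) (bs : List Bool) : Prop :=
  List.Forall₂ (fun i b => w[i]? = some b) ws bs

/-- After the wires `w`, the gates `G` produce the wires `w'`. -/
def Emits (w : List Bool) (G : List Gate) (w' : List Bool) : Prop :=
  GatesBelow w.length G ∧ wires G w = w ++ w'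

theorem wires_append (G G' : List Gate) (u : List Bool) :
    wires (G ++ G') u = wires G' (wires G u) := List.foldl_append

theorem gatesBelow_append (n : ℕ) (G G' : List Gate) :
    GatesBelow n (G ++ G') ↔ GatesBelow n G ∧ GatesBelow (n + G.length) G' := by
  induction G generalizing n with
  | nil => simp [GatesBelow]
  | cons g G ih => simp [GatesBelow, ih, and_assoc, Nat.add_assoc, Nat.add_comm 1]

theorem exists_wires (G : List Gate) (u : List Bool) :
    ∃ w, wires G u = u ++ w ∧ w.length = G.length := by
  induction G generalizing u with
  | nil => exact ⟨[], by simp [wires]⟩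
  | cons g G ih =>
    obtain ⟨w, hw, hl⟩ := ih (u ++ [g.eval u])
    refine ⟨g.eval u :: w, ?_, by simp [hl]⟩
    rw [wires, List.foldl_cons]
    simpa [wires] using hw

theorem Emits.length {w w' : List Bool} {G : List Gate} (h : Emits w G w') :
    w'.length = G.length := by
  obtain ⟨x, hx, hl⟩ := exists_wires G w
  rw [h.2] at hx
  rw [← hl, List.append_cancel_left hx]

theorem Emits.append {w w₁ w₂ : List Bool} {G₁ G₂ : List Gate} (h₁ : Emits w G₁ w₁)
    (h₂ : Emits (w ++ w₁) G₂ w₂) : Emits w (G₁ ++ G₂) (w₁ ++ w₂) := by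
  refine ⟨(gatesBelow_append _ _ _).2 ⟨h₁.1, ?_⟩, ?_⟩
  · rw [← h₁.length, ← List.length_append]; exact h₂.1
  · rw [wires_append, h₁.2, h₂.2, List.append_assoc]

theorem Emits.nil (w : List Bool) : Emits w [] [] := ⟨trivial, by simp [wires]⟩

theorem Gate.Below.mono {g : Gate} {n m : ℕ} (h : g.Below n) (hnm : n ≤ m) : g.Below m := by
  cases g <;> simp only [Below] at * <;> omega

theorem Gate.eval_append {g : Gate} {w : List Bool} (h : g.Below w.length) (x : List Bool) :
    g.eval (w ++ x) = g.eval w := by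
  cases g with
  | const => rfl
  | not => simp only [eval, List.getD_append _ _ _ _ h]
  | and | or => simp only [eval, List.getD_append _ _ _ _ h.1, List.getD_append _ _ _ _ h.2]

/-- A layer of parallel gates: all read only the wires `w`, so the values appended by earlier gates
of the layer do not affect the later ones. -/
theorem emits_of_forall₂ {w bs : List Bool} {G : List Gate}
    (h : List.Forall₂ (fun (g : Gate) b => g.Below w.length ∧ g.eval w = b) G bs) :
    Emits w G bs := by
  have key : ∀ x : List Bool, Emits (w ++ x) G bs := by
    induction h with
    | nil => exact fun x => Emits.nil _
    | @cons g b G bs h _ ih =>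
      intro x
      have h1 : Emits (w ++ x) [g] [b] := by
        refine ⟨⟨h.1.mono (by simp), trivial⟩, ?_⟩
        simp [wires, Gate.eval_append h.1, h.2]
      have h2 := ih (x ++ [b])
      rw [← List.append_assoc] at h2
      exact h1.append h2
  simpa using key []

namespace Holds

variable {w x bs bs' : List Bool} {ws ws' : List ℕ}

theorem mono (h : Holds w ws bs) (x : List Bool) : Holds (w ++ x) ws bs :=
  List.Forall₂.imp (fun i b hi => by
    rw [List.getElem?_append_left (List.getElem?_eq_some_iff.1 hi).1, hi]) h

theorem append (h : Holds w ws bs) (h' : Holds w ws' bs') : Holds w (ws ++ ws') (bs ++ bs') :=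
  List.rel_append h h'

theorem cons {i : ℕ} {b : Bool} (h : Holds w [i] [b]) (h' : Holds w ws bs) :
    Holds w (i :: ws) (b :: bs) := h.append h'

theorem lt (h : Holds w ws bs) : ∀ i ∈ ws, i < w.length := by
  induction h with
  | nil => simp
  | cons h _ ih =>
    intro i hi
    rcases List.mem_cons.1 hi with rfl | hi
    · exact (List.getElem?_eq_some_iff.1 h).1
    · exact ih i hi

theorem map_getD (h : Holds w ws bs) : ws.map (fun o => w.getD o false) = bs := by
  induction h with
  | nil => rfl
  | cons h _ ih => rw [List.map_cons, ih, List.getD_eq_getElem?_getD, h]; rfl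

theorem length_eq (h : Holds w ws bs) : ws.length = bs.length := List.Forall₂.length_eq h

theorem replicate {i : ℕ} {b : Bool} (h : Holds w [i] [b]) (n : ℕ) :
    Holds w (List.replicate n i) (List.replicate n b) := by
  induction n with
  | zero => exact .nil
  | succ n ih => exact h.cons ih

theorem tail (h : Holds w ws bs) : Holds w ws.tail bs.tail := by
  cases h with
  | nil => exact .nil
  | cons _ h => exact h

end Holds

/-- The `k` wires from `N` on. -/
def rng (N k : ℕ) : List ℕ := (List.range k).map fun j => N + j

theorem length_rng (N k : ℕ) : (rng N k).length = k := by simp [rng]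

theorem holds_rng (w bs x : List Bool) : Holds (w ++ bs ++ x) (rng w.length bs.length) bs := by
  rw [Holds, List.forall₂_iff_get]
  refine ⟨length_rng _ _, fun i h1 h2 => ?_⟩
  simp only [rng, List.get_eq_getElem, List.getElem_map, List.getElem_range, List.append_assoc]
  rw [List.getElem?_append_right (by omega), Nat.add_sub_cancel_left,
    List.getElem?_append_left h2, List.getElem?_eq_getElem h2]

theorem holds_rng' {w bs : List Bool} {N k : ℕ} (hN : N = w.length) (hk : k = bs.length) :
    Holds (w ++ bs) (rng N k) bs := by
  have := holds_rng w bs []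
  rwa [List.append_nil, ← hN, ← hk] at this

/-- Number of wires, and gates, of a circuit under construction. -/
abbrev Bld := ℕ × List Gate

/-- The circuit under construction has the wires `w` on the input `u`. -/
def Ok (u : List Bool) (S : Bld) (w : List Bool) : Prop :=
  S.1 = w.length ∧ GatesBelow u.length S.2 ∧ wires S.2 u = w

def emit (S : Bld) (G : List Gate) : Bld := (S.1 + G.length, S.2 ++ G)

theorem ok_init (u : List Bool) : Ok u (u.length, []) u := ⟨rfl, trivial, rfl⟩

theorem Ok.emit {u w w' : List Bool} {S : Bld} {G : List Gate} (h : Ok u S w) (h' : Emits w G w') :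
    Ok u (emit S G) (w ++ w') := by
  obtain ⟨h1, h2, h3⟩ := h
  refine ⟨by simp [PPPIndex.emit, h1, h'.length], (gatesBelow_append _ _ _).2 ⟨h2, ?_⟩, ?_⟩
  · have : u.length + S.2.length = w.length := by
      obtain ⟨x, hx, hl⟩ := exists_wires S.2 u
      rw [← h3, hx, List.length_append, hl]
    rw [this]; exact h'.1
  · rw [PPPIndex.emit, wires_append, h3, h'.2]

theorem Ok.evalC {u w bs : List Bool} {S : Bld} {O : List ℕ} (h : Ok u S w) (hO : Holds w O bs) :
    evalC S.2 O u = bs := by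
  rw [PPPIndex.evalC, h.2.2]
  exact hO.map_getD

theorem Ok.outputs_below {u w bs : List Bool} {S : Bld} {O : List ℕ} (h : Ok u S w)
    (hO : Holds w O bs) : ∀ o ∈ O, o < u.length + S.2.length := by
  obtain ⟨x, hx, hl⟩ := exists_wires S.2 u
  have := hO.lt
  rwa [← h.2.2, hx, List.length_append, hl] at this

/-- Wires with constant values. -/
def consts (S : Bld) (bs : List Bool) : Bld × List ℕ :=
  (emit S (bs.map fun b => Gate.const b), rng S.1 bs.length)

/-- A step of a construction: new wires appear, and the wires `ws` carry the values `bs`. -/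
def Adds (u w : List Bool) (R : Bld × List ℕ) (bs : List Bool) : Prop :=
  ∃ x, Ok u R.1 (w ++ x) ∧ Holds (w ++ x) R.2 bs

theorem ok_consts {u w : List Bool} {S : Bld} (h : Ok u S w) (bs : List Bool) :
    Adds u w (consts S bs) bs := by
  refine ⟨bs, h.emit (emits_of_forall₂ ?_), holds_rng' h.1 rfl⟩
  rw [List.forall₂_map_left_iff]
  exact List.forall₂_same.2 fun b _ => ⟨trivial, rfl⟩

theorem Holds.getD {w : List Bool} {i : ℕ} {b : Bool} (h : w[i]? = some b) :
    i < w.length ∧ w.getD i false = b :=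
  ⟨(List.getElem?_eq_some_iff.1 h).1, by rw [List.getD_eq_getElem?_getD, h]; rfl⟩

/-- Bitwise exclusive or with a constant string. -/
def xorConst (S : Bld) (bs : List Bool) (ws : List ℕ) : Bld × List ℕ :=
  (emit S (List.zipWith (fun b i => bif b then Gate.not i else Gate.and i i) bs ws), rng S.1 ws.length)

theorem ok_xorConst {u w cs : List Bool} {S : Bld} {ws : List ℕ} (h : Ok u S w) {bs : List Bool}
    (hws : Holds w ws cs) (hl : bs.length = cs.length) :
    Adds u w (xorConst S bs ws) (List.zipWith xor bs cs) := by
  refine ⟨_, h.emit (emits_of_forall₂ ?_), holds_rng' h.1 (by simp [hl, hws.length_eq])⟩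
  induction hws generalizing bs with
  | nil => simp
  | @cons i c ws cs hi _ ih =>
    obtain _ | ⟨b, bs⟩ := bs
    · simp at hl
    · obtain ⟨h1, h2⟩ := Holds.getD hi
      refine .cons ?_ (ih (by simpa using hl))
      cases b
      · exact ⟨⟨h1, h1⟩, by simp only [Gate.eval, cond_false, h2, Bool.and_self, Bool.false_xor]⟩
      · exact ⟨h1, by simp only [Gate.eval, cond_true, h2, Bool.true_xor]⟩

/-- Choose between two strings. -/
def mux (S : Bld) (c : ℕ) (xs ys : List ℕ) : Bld × List ℕ :=
  (emit S (Gate.not c :: (xs.map (fun i => Gate.and c i) ++ (ys.map (fun i => Gate.and S.1 i) ++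
    List.zipWith (fun i j => Gate.or i j) (rng (S.1 + 1) xs.length)
      (rng (S.1 + 1 + xs.length) ys.length)))),
    rng (S.1 + 1 + xs.length + ys.length) xs.length)

theorem emits_and {w bs : List Bool} {c : ℕ} {b : Bool} {ws : List ℕ} (hc : Holds w [c] [b])
    (h : Holds w ws bs) : Emits w (ws.map fun i => Gate.and c i) (bs.map fun d => b && d) := by
  refine emits_of_forall₂ ?_
  obtain ⟨h1, h2⟩ := Holds.getD (List.forall₂_cons.1 hc).1
  rw [List.forall₂_map_left_iff, List.forall₂_map_right_iff]
  refine List.Forall₂.imp (fun i d hi => ?_) h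
  obtain ⟨h3, h4⟩ := Holds.getD hi
  exact ⟨⟨h1, h3⟩, by simp only [Gate.eval, h2, h4]⟩

theorem emits_or {w bs bs' : List Bool} {ws ws' : List ℕ} (h : Holds w ws bs)
    (h' : Holds w ws' bs') :
    Emits w (List.zipWith (fun i j => Gate.or i j) ws ws') (List.zipWith (fun c d => c || d) bs bs') := by
  refine emits_of_forall₂ ?_
  induction h generalizing ws' bs' with
  | nil => simp
  | cons hi _ ih =>
    cases h' with
    | nil => simp
    | cons hj h' =>
      obtain ⟨h1, h2⟩ := Holds.getD hi
      obtain ⟨h3, h4⟩ := Holds.getD hj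
      exact .cons ⟨⟨h1, h3⟩, by simp only [Gate.eval, h2, h4]⟩ (ih h')

theorem emits_not {w : List Bool} {c : ℕ} {b : Bool} (hc : Holds w [c] [b]) :
    Emits w [Gate.not c] [!b] := by
  obtain ⟨h1, h2⟩ := Holds.getD (List.forall₂_cons.1 hc).1
  exact emits_of_forall₂ (.cons ⟨h1, by simp only [Gate.eval, h2]⟩ .nil)

/-- The new wire `S.1` carries the negated selector. One alternative is masked with the selector,
the other with its negation, and the results are joined bitwise. -/
theorem ok_mux {u w xb yb : List Bool} {S : Bld} {c : ℕ} {b : Bool} {xs ys : List ℕ}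
    (h : Ok u S w) (hc : Holds w [c] [b]) (hx : Holds w xs xb) (hy : Holds w ys yb)
    (hl : xb.length = yb.length) : Adds u w (mux S c xs ys) (bif b then xb else yb) := by
  have e1 := emits_not hc
  have e2 := emits_and (hc.mono [!b]) (hx.mono [!b])
  have e3 := emits_and (w := w ++ [!b] ++ xb.map fun d => b && d) (c := S.1) (b := !b)
    (by have := (holds_rng' (w := w) (bs := [!b]) h.1 rfl).mono (xb.map fun d => b && d)
        simpa [rng] using this)
    ((hy.mono [!b]).mono (xb.map fun d => b && d))
  have f1 := holds_rng (w ++ [!b]) (xb.map fun d => b && d) (yb.map fun d => !b && d)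
  have f2 := holds_rng (w ++ [!b] ++ xb.map fun d => b && d) (yb.map fun d => !b && d) []
  rw [List.append_nil] at f2
  have e4 := emits_or f1 f2
  have e := e1.append (e2.append (e3.append e4))
  have hN := h.1
  have hz : List.zipWith (fun c d => c || d) (xb.map fun d => b && d) (yb.map fun d => !b && d) =
      bif b then xb else yb := by
    clear e e4 e3 e2 e1 f1 f2 hx hy
    induction xb generalizing yb with
    | nil =>
      obtain rfl : yb = [] := List.length_eq_zero_iff.1 (by simpa using hl.symm)
      cases b <;> rfl
    | cons x xb ih =>
      obtain _ | ⟨y, yb⟩ := yb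
      · simp at hl
      · have := ih (by simpa using hl)
        cases b <;> simp_all
  simp only [List.length_append, List.length_map, List.length_singleton] at e
  rw [← hN, ← hx.length_eq, ← hy.length_eq] at e
  refine ⟨_, h.emit (G := Gate.not c :: (xs.map (fun i => Gate.and c i) ++ _)) e, ?_⟩
  rw [← hz]
  have f3 := holds_rng (w ++ [!b] ++ (xb.map fun d => b && d) ++ (yb.map fun d => !b && d))
    (List.zipWith (fun c d => c || d) (xb.map fun d => b && d) (yb.map fun d => !b && d)) []
  simp only [List.append_nil, List.append_assoc, List.length_append, List.length_map,
    List.length_singleton, List.length_zipWith, ← hl, min_self] at f3 ⊢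
  convert f3 using 1
  simp only [mux]
  rw [hN, hx.length_eq, hy.length_eq, ← hl]
  simp [Nat.add_assoc]

/-- Shift the wire numbers of a gate. -/
def Gate.shift (d : ℕ) : Gate → Gate
  | .const b => .const b
  | .not i => .not (d + i)
  | .and i j => .and (d + i) (d + j)
  | .or i j => .or (d + i) (d + j)

/-- Insert a copy of the circuit with gates `G` and outputs `O`, with the given inputs. -/
def inst (S : Bld) (G : List Gate) (O ws : List ℕ) : Bld × List ℕ :=
  (emit S (ws.map (fun i => Gate.and i i) ++ G.map (Gate.shift S.1)), O.map fun o => S.1 + o)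

theorem emits_copy {w bs : List Bool} {ws : List ℕ} (h : Holds w ws bs) :
    Emits w (ws.map fun i => Gate.and i i) bs := by
  refine emits_of_forall₂ ?_
  rw [List.forall₂_map_left_iff]
  refine List.Forall₂.imp (fun i d hi => ?_) h
  obtain ⟨h3, h4⟩ := Holds.getD hi
  exact ⟨⟨h3, h3⟩, by simp only [Gate.eval, h4, Bool.and_self]⟩

theorem Gate.below_shift {g : Gate} {d n : ℕ} (h : g.Below n) : (g.shift d).Below (d + n) := by
  cases g <;> simp only [Below, shift] at * <;> omega

theorem Gate.eval_shift (g : Gate) (p u : List Bool) :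
    (g.shift p.length).eval (p ++ u) = g.eval u := by
  have h : ∀ i, (p ++ u).getD (p.length + i) false = u.getD i false := fun i => by
    rw [List.getD_append_right _ _ _ _ (by omega), Nat.add_sub_cancel_left]
  cases g <;> simp only [shift, eval, h]

theorem wires_shift (G : List Gate) (p u : List Bool) :
    wires (G.map (Gate.shift p.length)) (p ++ u) = p ++ wires G u := by
  induction G generalizing u with
  | nil => rfl
  | cons g G ih =>
    have := ih (u ++ [g.eval u])
    rw [← List.append_assoc] at this
    simp only [wires, List.map_cons, List.foldl_cons, Gate.eval_shift] at this ⊢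
    exact this

theorem gatesBelow_shift {G : List Gate} {d n : ℕ} (h : GatesBelow n G) :
    GatesBelow (d + n) (G.map (Gate.shift d)) := by
  induction G generalizing n with
  | nil => trivial
  | cons g G ih => exact ⟨Gate.below_shift h.1, ih h.2⟩

/-- The copying gates give the inputs consecutive numbers from `S.1` on. Relative to `S.1` the
inserted circuit then has its original numbering, so one uniform shift suffices. -/
theorem ok_inst {u w bs : List Bool} {S : Bld} {ws : List ℕ} {G : List Gate} {O : List ℕ}
    (h : Ok u S w) (hws : Holds w ws bs) (hG : GatesBelow bs.length G)
    (hO : ∀ o ∈ O, o < bs.length + G.length) : Adds u w (inst S G O ws) (evalC G O bs) := by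
  obtain ⟨x, hx, hl⟩ := exists_wires G bs
  have e : Emits (w ++ bs) (G.map (Gate.shift S.1)) x := by
    refine ⟨?_, ?_⟩
    · rw [List.length_append, h.1]; exact gatesBelow_shift hG
    · rw [h.1, wires_shift, hx, List.append_assoc]
  refine ⟨_, h.emit ((emits_copy hws).append e), ?_⟩
  simp only [inst, evalC, Holds, List.forall₂_map_left_iff, List.forall₂_map_right_iff]
  refine List.forall₂_same.2 fun o ho => ?_
  have := hO o ho
  rw [← hx, h.1, List.getElem?_append_right (by omega), Nat.add_sub_cancel_left,
    List.getD_eq_getElem?_getD, hx, List.getElem?_eq_getElem (by simp [hl]; omega)]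
  rfl

namespace PolyF

variable {α : Type} [Enc α] {S : α → Bld} {xs ys : α → List ℕ} {c : α → ℕ} {bs : α → List Bool}

@[fun_prop]
theorem rng {N k : α → ℕ} (hN : PolyF N) (hk : PolyF k) : PolyF fun a => rng (N a) (k a) :=
  map (g := fun a j => N a + j) (range hk) (by fun_prop)

@[fun_prop]
theorem emit {G : α → List Gate} (hS : PolyF S) (hG : PolyF G) : PolyF fun a => emit (S a) (G a) := by
  unfold PPPIndex.emit; fun_prop

@[fun_prop]
theorem consts (hS : PolyF S) (hb : PolyF bs) : PolyF fun a => consts (S a) (bs a) :=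
  prodMk (emit hS (map (g := fun _ b => Gate.const b) hb (by fun_prop))) (by fun_prop)

@[fun_prop]
theorem xorConst (hS : PolyF S) (hb : PolyF bs) (hx : PolyF xs) :
    PolyF fun a => xorConst (S a) (bs a) (xs a) :=
  prodMk (emit hS (zipWith (g := fun _ b i => bif b then Gate.not i else Gate.and i i) hb hx
    (by fun_prop))) (by fun_prop)

@[fun_prop]
theorem mux (hS : PolyF S) (hc : PolyF c) (hx : PolyF xs) (hy : PolyF ys) :
    PolyF fun a => mux (S a) (c a) (xs a) (ys a) :=
  prodMk (emit hS (listCons (by fun_prop) (append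
    (map (g := fun a i => Gate.and (c a) i) hx (by fun_prop)) (append
      (map (g := fun a i => Gate.and (S a).1 i) hy (by fun_prop))
      (zipWith (g := fun _ i j => Gate.or i j) (by fun_prop) (by fun_prop) (by fun_prop))))))
    (by fun_prop)

theorem gateShift {d : α → ℕ} {g : α → Gate} (hd : PolyF d) (hg : PolyF g) :
    PolyF fun a => (g a).shift (d a) := by
  refine (gateCases (f₁ := fun _ b => Gate.const b) (f₂ := fun a i => Gate.not (d a + i))
    (f₃ := fun a i j => Gate.and (d a + i) (d a + j))
    (f₄ := fun a i j => Gate.or (d a + i) (d a + j)) hg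
    (by fun_prop) (by fun_prop) (by fun_prop) (by fun_prop)).of_eq fun a => ?_
  cases g a <;> rfl

@[fun_prop]
theorem inst {G : α → List Gate} {O : α → List ℕ} (hS : PolyF S) (hG : PolyF G) (hO : PolyF O)
    (hx : PolyF xs) : PolyF fun a => inst (S a) (G a) (O a) (xs a) :=
  prodMk (emit hS (append (map (g := fun _ i => Gate.and i i) hx (by fun_prop))
    (map (g := fun a g => g.shift (S a).1) hG (gateShift (by fun_prop) (by fun_prop)))))
    (map (g := fun a o => (S a).1 + o) hO (by fun_prop))

end PolyF


/-! ### Iterated circuits -/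

theorem emit_append (S : Bld) (G G' : List Gate) : emit S (G ++ G') = emit (emit S G) G' := by
  simp [emit, Nat.add_assoc]

/-- Number of wires before the copy number `j` of the circuit in `scan`. -/
def scanBase (S : Bld) (G : List Gate) (O : List ℕ) (e j : ℕ) : ℕ :=
  S.1 + j * (O.length + e + G.length)

/-- The wires that carry the state before the copy number `j` of the circuit in `scan`. -/
def scanSt (S : Bld) (G : List Gate) (O : List ℕ) (e : ℕ) (st : List ℕ) (j : ℕ) : List ℕ :=
  bif decide (j = 0) then st else O.map fun o => scanBase S G O e (j - 1) + o

/-- Iterate the circuit with gates `G` and outputs `O`, whose inputs are the state and `e` further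
bits. -/
def scan (S : Bld) (G : List Gate) (O : List ℕ) (e : ℕ) (st : List ℕ) (exs : List (List ℕ)) :
    Bld × List ℕ :=
  (emit S (((List.range exs.length).zip exs).flatMap fun p =>
    (scanSt S G O e st p.1 ++ p.2).map (fun i => Gate.and i i) ++
      G.map (Gate.shift (scanBase S G O e p.1))), scanSt S G O e st exs.length)

/-- In `scan` the position of every copy is given in closed form, so the whole is a `flatMap` and
runs in polynomial time without an estimate for a circuit that grows in a fold. Here the recursive
description is recovered: one more round is one more inserted copy. -/
theorem scan_concat (S : Bld) (G : List Gate) {O : List ℕ} {e : ℕ} {st : List ℕ}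
    (hst : st.length = O.length) {exs : List (List ℕ)} (hexs : ∀ ex ∈ exs, ex.length = e)
    (ex : List ℕ) :
    scan S G O e st (exs ++ [ex]) =
      inst (scan S G O e st exs).1 G O ((scan S G O e st exs).2 ++ ex) := by
  have h1 : ∀ exs ex, scan S G O e st (exs ++ [ex]) = (emit (scan S G O e st exs).1
      ((scanSt S G O e st exs.length ++ ex).map (fun i => Gate.and i i) ++
        G.map (Gate.shift (scanBase S G O e exs.length))),
      O.map fun o => scanBase S G O e exs.length + o) := fun exs ex => by
    simp only [scan, List.length_append, List.length_singleton, List.range_succ]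
    rw [List.zip_append (by simp), List.flatMap_append, emit_append]
    simp [scanSt]
  have hlen : ∀ j, (scanSt S G O e st j).length = O.length := fun j => by
    unfold scanSt
    cases decide (j = 0) <;> simp [hst]
  have h2 : (scan S G O e st exs).1.1 = scanBase S G O e exs.length := by
    induction exs using List.reverseRecOn with
    | nil => simp [scan, scanBase, emit]
    | append_singleton exs ex ih =>
      rw [h1]
      simp only [emit, ih fun ex h => hexs ex (by simp [h]), List.length_append, List.length_map,
        hlen, hexs ex (by simp), List.length_singleton, scanBase]
      ring
  rw [h1, inst, h2]
  rfl

theorem ok_scan {u w s₀ : List Bool} {S : Bld} {G : List Gate} {O st : List ℕ} {e : ℕ}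
    (h : Ok u S w) (hst : Holds w st s₀) (hs : O.length = s₀.length)
    (hG : GatesBelow (O.length + e) G) (hO : ∀ o ∈ O, o < O.length + e + G.length)
    {exs : List (List ℕ)} {xs : List (List Bool)} (hexs : List.Forall₂ (Holds w) exs xs)
    (he : ∀ x ∈ xs, x.length = e) :
    Adds u w (scan S G O e st exs) (xs.foldl (fun s x => evalC G O (s ++ x)) s₀) := by
  induction exs using List.reverseRecOn generalizing xs with
  | nil =>
    cases hexs
    refine ⟨[], ?_, ?_⟩
    · simpa [scan, emit] using h
    · simpa [scan, scanSt] using hst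
  | append_singleton exs ex ih =>
    obtain ⟨xs, x, rfl⟩ : ∃ xs' x, xs = xs' ++ [x] := by
      rcases List.eq_nil_or_concat xs with rfl | ⟨xs', x, rfl⟩
      · have := hexs.length_eq; simp at this
      · exact ⟨xs', x, by simp⟩
    have hl : exs.length = xs.length := by simpa using hexs.length_eq
    have h1 : List.Forall₂ (Holds w) exs xs ∧ Holds w ex x := by
      rw [List.forall₂_iff_zip] at hexs ⊢
      rw [List.zip_append hl] at hexs
      exact ⟨⟨hl, fun hab => hexs.2 (by simp [hab])⟩, hexs.2 (by simp)⟩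
    have hlx : ∀ ex ∈ exs, ex.length = e := fun ex hex => by
      obtain ⟨j, hj, rfl⟩ := List.getElem_of_mem hex
      have hh := h1.1.get hj (hl ▸ hj)
      rw [List.get_eq_getElem, List.get_eq_getElem] at hh
      rw [hh.length_eq, he _ (by simp)]
    obtain ⟨y, ok1, hy⟩ := ih h1.1 fun x hx => he x (by simp [hx])
    rw [scan_concat S G (hst.length_eq.trans hs.symm) hlx, List.foldl_append]
    -- The state keeps its length: initially by assumption, later because it is an output of the
    -- circuit.
    have hlen : (xs.foldl (fun s x => evalC G O (s ++ x)) s₀ ++ x).length = O.length + e := by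
      rw [List.length_append, he x (by simp)]
      congr 1
      rcases List.eq_nil_or_concat xs with rfl | ⟨xs', x', rfl⟩
      · exact hs.symm
      · simp [evalC]
    obtain ⟨z, ok2, hz⟩ := ok_inst ok1 (hy.append (h1.2.mono y)) (hlen ▸ hG) (hlen ▸ hO)
    exact ⟨y ++ z, by rwa [← List.append_assoc], by rwa [← List.append_assoc]⟩

namespace PolyF

@[fun_prop]
theorem scan {α : Type} [Enc α] {S : α → Bld} {G : α → List Gate} {O st : α → List ℕ}
    {e : α → ℕ} {exs : α → List (List ℕ)} (hS : PolyF S) (hG : PolyF G) (hO : PolyF O)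
    (he : PolyF e) (hst : PolyF st) (hexs : PolyF exs) :
    PolyF fun a => PPPIndex.scan (S a) (G a) (O a) (e a) (st a) (exs a) := by
  have hB : PolyF fun x : α × ℕ => scanBase (S x.1) (G x.1) (O x.1) (e x.1) x.2 := by
    unfold scanBase; fun_prop
  have hC : PolyF fun x : α × ℕ => scanBase (S x.1) (G x.1) (O x.1) (e x.1) (x.2 - 1) :=
    hB.comp (g := fun x : α × ℕ => (x.1, x.2 - 1)) (by fun_prop)
  have hC' : PolyF fun y : (α × ℕ) × ℕ =>
      scanBase (S y.1.1) (G y.1.1) (O y.1.1) (e y.1.1) (y.1.2 - 1) :=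
    hC.comp (g := fun y : (α × ℕ) × ℕ => y.1) (by fun_prop)
  have hM : PolyF fun x : α × ℕ => (O x.1).map fun o =>
      scanBase (S x.1) (G x.1) (O x.1) (e x.1) (x.2 - 1) + o :=
    map (g := fun (x : α × ℕ) o => scanBase (S x.1) (G x.1) (O x.1) (e x.1) (x.2 - 1) + o)
      (hO.comp fst)
      (hC'.natAdd (g := fun y => y.2) (by fun_prop))
  have hT : PolyF fun x : α × ℕ => scanSt (S x.1) (G x.1) (O x.1) (e x.1) (st x.1) x.2 := by
    unfold scanSt
    exact cond (by fun_prop) (by fun_prop) hM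
  have h1 : PolyF fun x : α × ℕ × List ℕ =>
      (scanSt (S x.1) (G x.1) (O x.1) (e x.1) (st x.1) x.2.1 ++ x.2.2).map
        (fun i => Gate.and i i) :=
    map (g := fun _ i => Gate.and i i) (append (hT.comp
      (g := fun x : α × ℕ × List ℕ => (x.1, x.2.1)) (by fun_prop)) (by fun_prop)) (by fun_prop)
  have h2 : PolyF fun x : α × ℕ × List ℕ =>
      (G x.1).map (Gate.shift (scanBase (S x.1) (G x.1) (O x.1) (e x.1) x.2.1)) :=
    map (g := fun (x : α × ℕ × List ℕ) g =>
      g.shift (scanBase (S x.1) (G x.1) (O x.1) (e x.1) x.2.1)) (hG.comp fst)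
      (gateShift (hB.comp (g := fun x : (α × ℕ × List ℕ) × Gate => (x.1.1, x.1.2.1))
        (by fun_prop)) (by fun_prop))
  have h3 : PolyF fun a => ((List.range (exs a).length).zip (exs a)).flatMap fun p =>
      (scanSt (S a) (G a) (O a) (e a) (st a) p.1 ++ p.2).map (fun i => Gate.and i i) ++
        (G a).map (Gate.shift (scanBase (S a) (G a) (O a) (e a) p.1)) :=
    flatMap (g := fun a (p : ℕ × List ℕ) =>
      (scanSt (S a) (G a) (O a) (e a) (st a) p.1 ++ p.2).map (fun i => Gate.and i i) ++
        (G a).map (Gate.shift (scanBase (S a) (G a) (O a) (e a) p.1))) (by fun_prop) (h1.append h2)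
  have h4 : PolyF fun a => scanSt (S a) (G a) (O a) (e a) (st a) (exs a).length :=
    hT.comp (g := fun a => (a, (exs a).length)) (by fun_prop)
  unfold PPPIndex.scan
  exact prodMk (emit hS h3) h4

end PolyF


/-! ### The circuit for an instance of Index -/

theorem Holds.headD {w bs : List Bool} {b : Bool} {ws : List ℕ} (h : Holds w ws (b :: bs)) :
    Holds w [ws.headD 0] [b] := by
  cases h with
  | cons h _ => exact List.Forall₂.cons h .nil

theorem Holds.singletons {w bs : List Bool} {ws : List ℕ} (h : Holds w ws bs) :
    List.Forall₂ (Holds w) (ws.map fun i => [i]) (bs.map fun b => [b]) := by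
  rw [List.forall₂_map_left_iff, List.forall₂_map_right_iff]
  exact List.Forall₂.imp (fun _ _ hi => List.Forall₂.cons hi .nil) h

theorem Holds.pairs {w bs bs' : List Bool} {ws ws' : List ℕ} (h : Holds w ws bs)
    (h' : Holds w ws' bs') : List.Forall₂ (Holds w) (List.zipWith (fun i j => [i, j]) ws ws')
      (List.zipWith (fun b c => [b, c]) bs bs') := by
  induction h generalizing ws' bs' with
  | nil => simp
  | cons hi _ ih =>
    cases h' with
    | nil => simp
    | cons hj h' => exact .cons (List.Forall₂.cons hi (.cons hj .nil)) (ih h')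

theorem Adds.trans {u w y bs : List Bool} {R : Bld × List ℕ} (h : Adds u (w ++ y) R bs) :
    Adds u w R bs := by
  obtain ⟨x, h1, h2⟩ := h
  exact ⟨y ++ x, by rwa [← List.append_assoc], by rwa [← List.append_assoc]⟩

/-- Is the string on the wires `ws` equal to `x`? -/
def eqCircuit (S : Bld) (x : List Bool) (ws : List ℕ) : Bld × List ℕ :=
  let d := xorConst S x ws
  let t := consts d.1 [true]
  scan t.1 [Gate.not 1, Gate.and 0 2] [3] 1 t.2 (d.2.map fun i => [i])

theorem zipWith_xor_cancel {x u v : List Bool} (hu : x.length = u.length)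
    (h : List.zipWith xor x u = List.zipWith xor x v) (hv : x.length = v.length) : u = v := by
  induction x generalizing u v with
  | nil =>
    rw [List.length_eq_zero_iff.1 hu.symm, List.length_eq_zero_iff.1 hv.symm]
  | cons b x ih =>
    obtain _ | ⟨c, u⟩ := u
    · simp at hu
    obtain _ | ⟨d, v⟩ := v
    · simp at hv
    simp only [List.zipWith_cons_cons, List.cons.injEq] at h
    rw [ih (by simpa using hu) h.2 (by simpa using hv), Bool.xor_right_inj.1 h.1]

theorem zipWith_xor_self (x : List Bool) : List.zipWith xor x x = List.replicate x.length false := by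
  induction x with
  | nil => rfl
  | cons b x ih =>
    rw [List.zipWith_cons_cons, ih, Bool.xor_self]
    rfl

/-- The exclusive or with `x` marks the differing positions, and the scan keeps its state bit true
as long as no mark occurs. -/
theorem ok_eqCircuit {u w cs : List Bool} {S : Bld} {ws : List ℕ} {x : List Bool} (h : Ok u S w)
    (hws : Holds w ws cs) (hl : x.length = cs.length) :
    Adds u w (eqCircuit S x ws) [x == cs] := by
  obtain ⟨y, ok1, h1⟩ := ok_xorConst h hws hl
  obtain ⟨z, ok2, h2⟩ := ok_consts ok1 [true]
  have h3 := ok_scan (G := [Gate.not 1, Gate.and 0 2]) (O := [3]) (e := 1) ok2 h2 rfl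
    (by simp [GatesBelow, Gate.Below]) (by simp) (h1.mono z).singletons fun a ha => by
      obtain ⟨_, _, rfl⟩ := List.mem_map.1 ha
      rfl
  have key : ∀ (x cs : List Bool) (b : Bool), x.length = cs.length →
      ((List.zipWith xor x cs).map fun b => [b]).foldl
        (fun s x => evalC [Gate.not 1, Gate.and 0 2] [3] (s ++ x)) [b] = [b && x == cs] := by
    intro x
    induction x with
    | nil =>
      intro cs b h
      rw [List.length_eq_zero_iff.1 h.symm]
      cases b <;> rfl
    | cons c x ih =>
      intro cs b h
      obtain _ | ⟨d, cs⟩ := cs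
      · simp at h
      have h1 : evalC [Gate.not 1, Gate.and 0 2] [3] ([b] ++ [xor c d]) = [b && c == d] := by
        cases b <;> cases c <;> cases d <;> rfl
      have h2 := ih cs (b && c == d) (by simpa using h)
      rw [List.zipWith_cons_cons, List.map_cons, List.foldl_cons, h1, h2, Bool.and_assoc]
      rfl
  rw [key x cs true hl] at h3
  exact h3.trans.trans

/-- The circuit for one step of the comparison of binary representations. -/
def ltGates : List Gate :=
  [Gate.not 1, Gate.not 2, Gate.and 1 2, Gate.and 3 4, Gate.or 5 6, Gate.and 0 7, Gate.and 2 3,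
    Gate.or 8 9]

/-- Does the string on the wires `ws` represent a number below the one represented by `s`? -/
def ltCircuit (S : Bld) (s : List Bool) (ws : List ℕ) : Bld × List ℕ :=
  let z := consts S [false]
  let c := consts z.1 (pad (ws.length + s.length) s)
  scan c.1 ltGates [10] 2 z.2 (List.zipWith (fun i j => [i, j])
    (List.replicate (ws.length + s.length - ws.length) (z.2.headD 0) ++ ws) c.2).reverse

theorem ok_ltCircuit {u w cs : List Bool} {S : Bld} {ws : List ℕ} {s : List Bool} (h : Ok u S w)
    (hws : Holds w ws cs) : Adds u w (ltCircuit S s ws) [ltB cs s] := by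
  obtain ⟨y, ok1, h1⟩ := ok_consts h [false]
  obtain ⟨z, ok2, h2⟩ := ok_consts ok1 (pad (ws.length + s.length) s)
  have h3 := (((h1.headD.mono z).replicate (ws.length + s.length - ws.length)).append
    ((hws.mono y).mono z)).pairs h2
  have h4 := ok_scan (G := ltGates) (O := [10]) (e := 2) ok2 (h1.mono z) rfl
    (by simp [ltGates, GatesBelow, Gate.Below]) (by simp [ltGates]) (List.rel_reverse h3) (by
      intro x hx
      obtain ⟨i, hi, rfl⟩ := List.getElem_of_mem (List.mem_reverse.1 hx)
      rw [List.getElem_zipWith]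
      rfl)
  have key : ∀ (l : List (Bool × Bool)) (b : Bool), (l.map fun p => [p.1, p.2]).foldl
      (fun s x => evalC ltGates [10] (s ++ x)) [b] = [l.foldl ltStep b] := by
    intro l
    induction l with
    | nil => exact fun b => rfl
    | cons p l ih =>
      intro b
      -- Wire `0` is the accumulator and wires `1`, `2` are the two bits. Wire `7` says that the
      -- bits agree, wire `9` that only the second one is set.
      have h1 : evalC ltGates [10] ([b] ++ [p.1, p.2]) = [ltStep b p] := by
        obtain ⟨c, d⟩ := p
        cases b <;> cases c <;> cases d <;> rfl
      rw [List.map_cons, List.foldl_cons, h1, ih, List.foldl_cons]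
  have h5 : List.zipWith (fun b c => [b, c])
      (List.replicate (ws.length + s.length - ws.length) false ++ cs)
        (pad (ws.length + s.length) s) =
      ((pad (cs.length + s.length) cs).zip (pad (cs.length + s.length) s)).map
        fun p => [p.1, p.2] := by
    rw [List.zip, List.map_zipWith, hws.length_eq]
    rfl
  rw [h5, ← List.map_reverse, key] at h4
  exact h4.trans.trans

/-- The circuit for one step of the indexing function. -/
def stepCircuit (r : Raw) : Bld × List ℕ :=
  let c := consts (r.l + 2, []) r.gen
  let v := inst c.1 r.G r.O (rng 1 r.l ++ rng 1 r.l)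
  let g := inst v.1 r.G r.O (c.2 ++ v.2)
  let m := mux g.1 (r.l + 1) g.2 v.2
  let q := mux (emit m.1 [Gate.or 0 (r.l + 1)]) m.1.1 m.2 (rng 1 r.l)
  (q.1, m.1.1 :: q.2)

theorem Raw.length_op (r : Raw) (u v : List Bool) : (r.op u v).length = r.l := by
  simp [Raw.op, evalC, Raw.l]

/-- Input layout: wire `0` is the flag, wires `1` to `l` the register, wire `l + 1` the bit that is
read. Both possible products are always computed, and two selections pick the new register. -/
theorem ok_stepCircuit {r : Raw} (hG : GatesBelow (2 * r.l) r.G)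
    (hO : ∀ o ∈ r.O, o < 2 * r.l + r.G.length) (hg : r.gen.length = r.l) {v : List Bool}
    (hv : v.length = r.l) (st b : Bool) :
    Adds (st :: v ++ [b]) (st :: v ++ [b]) (stepCircuit r)
      ((r.idxStep (st, v) b).1 :: (r.idxStep (st, v) b).2) := by
  have hop : ∀ {u w p q : List Bool} {S : Bld} {ps qs : List ℕ}, Ok u S w → Holds w ps p →
      Holds w qs q → p.length = r.l → q.length = r.l →
      Adds u w (inst S r.G r.O (ps ++ qs)) (r.op p q) := fun h hp hq h1 h2 => by
    refine ok_inst h (hp.append hq) ?_ ?_ <;> rw [List.length_append, h1, h2, ← two_mul] <;>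
      assumption
  have ok0 : Ok (st :: v ++ [b]) (r.l + 2, []) (st :: v ++ [b]) := by
    have := ok_init (st :: v ++ [b])
    simpa [hv] using this
  have hst : Holds (st :: v ++ [b]) [0] [st] := List.Forall₂.cons rfl .nil
  have hb : Holds (st :: v ++ [b]) [r.l + 1] [b] := by
    refine List.Forall₂.cons ?_ .nil
    rw [List.getElem?_append_right (by simp [hv])]
    simp [hv]
  have hr : Holds (st :: v ++ [b]) (rng 1 r.l) v := by
    have := holds_rng [st] v [b]
    simpa [hv] using this
  obtain ⟨x1, ok1, h1⟩ := ok_consts ok0 r.gen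
  obtain ⟨x2, ok2, h2⟩ := hop ok1 (hr.mono x1) (hr.mono x1) hv hv
  obtain ⟨x3, ok3, h3⟩ := hop ok2 (h1.mono x2) h2 hg (r.length_op _ _)
  obtain ⟨x4, ok4, h4⟩ := ok_mux ok3 (((hb.mono x1).mono x2).mono x3) h3 (h2.mono x3)
    ((r.length_op _ _).trans (r.length_op _ _).symm)
  have hor := emits_or ((((hst.mono x1).mono x2).mono x3).mono x4)
    ((((hb.mono x1).mono x2).mono x3).mono x4)
  have ok5 := ok4.emit hor
  have h5 := holds_rng' (bs := [st || b]) ok4.1 (k := 1) rfl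
  have hl : (bif b then r.op r.gen (r.op v v) else r.op v v).length = v.length := by
    cases b <;> simp [Raw.length_op, hv]
  obtain ⟨x6, ok6, h6⟩ := ok_mux ok5 (c := _) (by simpa [rng] using h5) (h4.mono _)
    (((((hr.mono x1).mono x2).mono x3).mono x4).mono _) hl
  have h7 : Adds (st :: v ++ [b]) (st :: v ++ [b]) (stepCircuit r) ((st || b) ::
      bif st || b then (bif b then r.op r.gen (r.op v v) else r.op v v) else v) :=
    Adds.trans (y := x1) (Adds.trans (y := x2) (Adds.trans (y := x3) (Adds.trans (y := x4)
      (Adds.trans ⟨x6, ok6, Holds.cons (h5.mono x6) h6⟩))))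
  exact h7


/-- The circuit for the indexing function, on the wires `ws`. -/
def idxCircuit (S : Bld) (r : Raw) (ws : List ℕ) : Bld × List ℕ :=
  let c := consts S (false :: r.ident)
  let q := scan c.1 (stepCircuit r).1.2 (stepCircuit r).2 1 c.2 (ws.map fun i => [i])
  let e := inst q.1 r.G r.O (c.2.tail ++ c.2.tail)
  mux e.1 (q.2.headD 0) q.2.tail e.2

/-- The conditions on the lengths and wire numbers in an instance of Index. -/
structure Raw.Ok (r : Raw) : Prop where
  gates : GatesBelow (2 * r.l) r.G
  outputs : ∀ o ∈ r.O, o < 2 * r.l + r.G.length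
  ident : r.ident.length = r.l
  gen : r.gen.length = r.l
  target : r.target.length = r.l

theorem IndexInput.ok_toRaw (i : IndexInput) : i.toRaw.Ok where
  gates := i.toRaw_l ▸ i.f.gates_below
  outputs := i.toRaw_l ▸ i.f.outputs_below
  ident := (length_bd _ _).trans i.toRaw_l.symm
  gen := (length_bd _ _).trans i.toRaw_l.symm
  target := (length_bd _ _).trans i.toRaw_l.symm

theorem Raw.length_foldl_idxStep (r : Raw) (u : List Bool) {p : Bool × List Bool}
    (hp : p.2.length = r.l) : (u.foldl r.idxStep p).2.length = r.l := by
  induction u generalizing p with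
  | nil => exact hp
  | cons b u ih =>
    refine ih ?_
    rw [idxStep]
    cases p.1 || b
    · exact hp
    · cases b <;> exact r.length_op _ _

theorem Raw.length_idx (r : Raw) (hr : r.Ok) (u : List Bool) : (r.idx u).length = r.l := by
  rw [idx]
  have := r.length_foldl_idxStep u (p := (false, r.ident)) hr.ident
  cases h : (u.foldl r.idxStep (false, r.ident)).1
  · simp only [cond_false]
    exact r.length_op _ _
  · simp only [cond_true]
    exact this

theorem ok_idxCircuit {u w cs : List Bool} {S : Bld} {ws : List ℕ} {r : Raw} (h : Ok u S w)
    (hr : r.Ok) (hws : Holds w ws cs) : Adds u w (idxCircuit S r ws) (r.idx cs) := by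
  obtain ⟨y, ok1, h1⟩ := ok_consts h (false :: r.ident)
  -- The construction is verified on one input at a time, but wire bounds and output length depend
  -- only on the input length; they are read off below at a dummy input.
  have hQ : ∀ {v : List Bool} (_ : v.length = r.l) (st b : Bool),
      GatesBelow (r.l + 2) (stepCircuit r).1.2 ∧
      (∀ o ∈ (stepCircuit r).2, o < r.l + 2 + (stepCircuit r).1.2.length) ∧
      (stepCircuit r).2.length = r.l + 1 ∧
      evalC (stepCircuit r).1.2 (stepCircuit r).2 (st :: v ++ [b]) =
        (r.idxStep (st, v) b).1 :: (r.idxStep (st, v) b).2 := fun {v} hv st b => by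
    obtain ⟨x, ok, hh⟩ := ok_stepCircuit hr.gates hr.outputs hr.gen hv st b
    have hl : (st :: v ++ [b]).length = r.l + 2 := by simp [hv]
    refine ⟨hl ▸ ok.2.1, hl ▸ ok.outputs_below hh, ?_, ok.evalC hh⟩
    rw [hh.length_eq, List.length_cons]
    exact congrArg (· + 1) (r.length_foldl_idxStep [b] (p := (st, v)) hv)
  have hl := (hQ hr.ident false false).2.2.1
  have key : ∀ (cs : List Bool) (p : Bool × List Bool), p.2.length = r.l →
      (cs.map fun b => [b]).foldl (fun s x => evalC (stepCircuit r).1.2 (stepCircuit r).2 (s ++ x))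
        (p.1 :: p.2) = (cs.foldl r.idxStep p).1 :: (cs.foldl r.idxStep p).2 := by
    intro cs
    induction cs with
    | nil => exact fun p _ => rfl
    | cons b cs ih =>
      intro p hp
      rw [List.map_cons, List.foldl_cons, (hQ hp p.1 b).2.2.2]
      exact ih _ (r.length_foldl_idxStep [b] hp)
  have h2 := ok_scan (e := 1) ok1 h1 (hl.trans (by rw [List.length_cons, hr.ident]))
    (by rw [hl]; exact (hQ hr.ident false false).1) (by rw [hl]; exact (hQ hr.ident false false).2.1)
    (hws.mono y).singletons fun a ha => by
      obtain ⟨_, _, rfl⟩ := List.mem_map.1 ha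
      rfl
  rw [key cs (false, r.ident) hr.ident] at h2
  obtain ⟨z, ok2, h2⟩ := h2
  have ht := h1.tail.mono z
  have hlen : (r.ident ++ r.ident).length = 2 * r.l := by
    rw [List.length_append, hr.ident, two_mul]
  -- The square of the identity, used when the flag is never set.
  obtain ⟨t, ok3, h3⟩ := ok_inst (bs := r.ident ++ r.ident) ok2 (ht.append ht) (hlen ▸ hr.gates)
    (hlen ▸ hr.outputs)
  have h4 := ok_mux ok3 (h2.headD.mono t) (h2.tail.mono t) h3
    ((r.length_foldl_idxStep cs (p := (false, r.ident)) hr.ident).trans (r.length_op _ _).symm)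
  exact h4.trans.trans.trans

/-- The circuit that maps `(w, u)` to `w` with `x` added, followed by `u` or the value of the
indexing function on `u` with the target added. The indexing function is used if `w = x` and `u`
is below `s`. -/
def indexCircuit (x : List Bool) (r : Raw) : Bld × List ℕ :=
  let ws := rng 0 x.length
  let us := rng x.length r.l
  let e := eqCircuit (x.length + r.l, []) x ws
  let t := ltCircuit e.1 r.s us
  let i := idxCircuit t.1 r us
  let m := mux i.1 (t.2.headD 0) i.2 us
  let m' := mux m.1 (e.2.headD 0) m.2 us
  let a := xorConst m'.1 x ws
  let b := xorConst a.1 r.target m'.2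
  (b.1, a.2 ++ b.2)

/-- The map computed by the circuit. -/
def indexMap (x : List Bool) (r : Raw) (w u : List Bool) : List Bool :=
  List.zipWith xor x w ++ List.zipWith xor r.target
    (bif x == w then (bif ltB u r.s then r.idx u else u) else u)

theorem ok_indexCircuit {x : List Bool} {r : Raw} (hr : r.Ok) {w u : List Bool}
    (hw : w.length = x.length) (hu : u.length = r.l) :
    Adds (w ++ u) (w ++ u) (indexCircuit x r) (indexMap x r w u) := by
  have ok0 : Ok (w ++ u) (x.length + r.l, []) (w ++ u) := by
    have := ok_init (w ++ u)
    rwa [List.length_append, hw, hu] at this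
  have hws : Holds (w ++ u) (rng 0 x.length) w := by
    have := holds_rng [] w u
    rwa [hw] at this
  have hus : Holds (w ++ u) (rng x.length r.l) u := holds_rng' hw.symm hu.symm
  obtain ⟨y1, ok1, h1⟩ := ok_eqCircuit ok0 hws hw.symm
  obtain ⟨y2, ok2, h2⟩ := ok_ltCircuit (s := r.s) ok1 (hus.mono y1)
  have hus2 := (hus.mono y1).mono y2
  obtain ⟨y3, ok3, h3⟩ := ok_idxCircuit ok2 hr hus2
  have hl : (r.idx u).length = u.length := (r.length_idx hr u).trans hu.symm
  obtain ⟨y4, ok4, h4⟩ := ok_mux ok3 (h2.headD.mono y3) h3 (hus2.mono y3) hl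
  have hl' : (bif ltB u r.s then r.idx u else u).length = u.length := by
    cases ltB u r.s
    · rfl
    · exact hl
  obtain ⟨y5, ok5, h5⟩ := ok_mux ok4 (((h1.headD.mono y2).mono y3).mono y4) h4
    ((hus2.mono y3).mono y4) hl'
  have hl'' : (bif x == w then (bif ltB u r.s then r.idx u else u) else u).length = u.length := by
    cases x == w
    · rfl
    · exact hl'
  obtain ⟨y6, ok6, h6⟩ := ok_xorConst ok5
    (((((hws.mono y1).mono y2).mono y3).mono y4).mono y5) hw.symm
  obtain ⟨y7, ok7, h7⟩ := ok_xorConst (bs := r.target) ok6 (h5.mono y6)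
    (hr.target.trans (hu.symm.trans hl''.symm))
  have h8 : Adds (w ++ u) (w ++ u) (indexCircuit x r) (indexMap x r w u) :=
    Adds.trans (y := y1) (Adds.trans (y := y2) (Adds.trans (y := y3) (Adds.trans (y := y4)
      (Adds.trans (y := y5) (Adds.trans (y := y6) ⟨y7, ok7, (h6.mono y7).append h7⟩)))))
  exact h8

namespace PolyF

variable {α : Type} [Enc α] {S : α → Bld} {ws : α → List ℕ} {x : α → List Bool} {r : α → Raw}

@[fun_prop]
theorem singletons (hw : PolyF ws) : PolyF fun a => (ws a).map fun i => [i] :=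
  map (g := fun _ i => [i]) hw (by fun_prop)

@[fun_prop]
theorem eqCircuit (hS : PolyF S) (hx : PolyF x) (hw : PolyF ws) :
    PolyF fun a => PPPIndex.eqCircuit (S a) (x a) (ws a) := by
  have h1 := xorConst hS hx hw
  have h2 := consts (fst.comp h1) (const [true])
  exact scan (fst.comp h2) (const _) (const _) (const _) (snd.comp h2) (singletons (snd.comp h1))

@[fun_prop]
theorem ltCircuit (hS : PolyF S) (hx : PolyF x) (hw : PolyF ws) :
    PolyF fun a => PPPIndex.ltCircuit (S a) (x a) (ws a) := by
  have h1 : PolyF fun a => PPPIndex.consts (S a) [false] := by fun_prop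
  have h2 : PolyF fun a => PPPIndex.consts (PPPIndex.consts (S a) [false]).1
      (PPPIndex.pad ((ws a).length + (x a).length) (x a)) := by fun_prop
  have h3 : PolyF fun a => (List.zipWith (fun i j => [i, j])
    (List.replicate ((ws a).length + (x a).length - (ws a).length)
      ((PPPIndex.consts (S a) [false]).2.headD 0) ++ ws a) (PPPIndex.consts (PPPIndex.consts (S a) [false]).1
      (PPPIndex.pad ((ws a).length + (x a).length) (x a))).2).reverse :=
    reverse (zipWith (g := fun _ i j => [i, j]) (append (replicate (by fun_prop)
      (headD (snd.comp h1) (const 0))) hw) (snd.comp h2) (by fun_prop))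
  exact scan (fst.comp h2) (const _) (const _) (const _) (snd.comp h1) h3

@[fun_prop]
theorem stepCircuit (hr : PolyF r) : PolyF fun a => PPPIndex.stepCircuit (r a) := by
  have h1 : PolyF fun a => PPPIndex.consts ((r a).l + 2, []) (r a).gen := by fun_prop
  have h0 : PolyF fun a => PPPIndex.rng 1 (r a).l := by fun_prop
  have h2 := inst (fst.comp h1) (rawG hr) (rawO hr) (append h0 h0)
  have h3 := inst (fst.comp h2) (rawG hr) (rawO hr) (append (snd.comp h1) (snd.comp h2))
  have h4 := mux (fst.comp h3) (c := fun a => (r a).l + 1) (by fun_prop) (snd.comp h3)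
    (snd.comp h2)
  have h5 : PolyF fun a => [Gate.or 0 ((r a).l + 1)] := by fun_prop
  have h6 := mux (emit (fst.comp h4) h5) (fst.comp (fst.comp h4)) (snd.comp h4) h0
  exact prodMk (fst.comp h6) (listCons (fst.comp (fst.comp h4)) (snd.comp h6))

@[fun_prop]
theorem idxCircuit (hS : PolyF S) (hr : PolyF r) (hw : PolyF ws) :
    PolyF fun a => PPPIndex.idxCircuit (S a) (r a) (ws a) := by
  have h1 : PolyF fun a => PPPIndex.consts (S a) (false :: (r a).ident) := by fun_prop
  have h2 := stepCircuit hr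
  have h3 := scan (fst.comp h1) (snd.comp (fst.comp h2)) (snd.comp h2) (const 1) (snd.comp h1)
    (singletons hw)
  have h4 := inst (fst.comp h3) (rawG hr) (rawO hr)
    (append (tail' (snd.comp h1)) (tail' (snd.comp h1)))
  exact mux (fst.comp h4) (headD (snd.comp h3) (const 0)) (tail' (snd.comp h3)) (snd.comp h4)

@[fun_prop]
theorem indexCircuit (hx : PolyF x) (hr : PolyF r) : PolyF fun a => PPPIndex.indexCircuit (x a) (r a) := by
  have h0 : PolyF fun a => PPPIndex.rng 0 (x a).length := by fun_prop
  have h1 : PolyF fun a => PPPIndex.rng (x a).length (r a).l := by fun_prop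
  have h2 := eqCircuit (S := fun a => ((x a).length + (r a).l, [])) (by fun_prop) hx h0
  have h3 := ltCircuit (fst.comp h2) (rawS hr) h1
  have h4 := idxCircuit (fst.comp h3) hr h1
  have h5 := mux (fst.comp h4) (headD (snd.comp h3) (const 0)) (snd.comp h4) h1
  have h6 := mux (fst.comp h5) (headD (snd.comp h2) (const 0)) (snd.comp h5) h1
  have h7 := xorConst (fst.comp h6) hx h0
  have h8 := xorConst (fst.comp h7) (rawTarget hr) (snd.comp h6)
  exact prodMk (fst.comp h8) (append (snd.comp h7) (snd.comp h8))

end PolyF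


/-! ### Index is reducible to Pigeon -/

namespace PolyF

variable {α : Type} [Enc α] {r : α → Raw} {u v : α → List Bool}
  {w : α → Bool × List Bool × List Bool}

theorem rawRecord (hr : PolyF r) (hw : PolyF w) (hu : PolyF u) (hv : PolyF v) :
    PolyF fun a => (r a).record (w a) (u a) (v a) :=
  cond (or (fst.comp hw) (rawBelow hr (rawOp hr hu hv))) hw
    (prodMk (const true) (prodMk hu hv))

theorem rawTraceStep {p : α → (Bool × List Bool) × Bool × List Bool × List Bool} {b : α → Bool}
    (hr : PolyF r) (hp : PolyF p) (hb : PolyF b) : PolyF fun a => (r a).traceStep (p a) (b a) := by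
  have h1 : PolyF fun a => (r a).idxStep (p a).1 (b a) := by
    unfold Raw.idxStep; fun_prop
  have h2 : PolyF fun a => (p a).1.2 := by fun_prop
  have h3 := rawRecord hr (snd.comp hp) h2 h2
  have h4 := rawRecord hr h3 (rawGen hr) (rawOp hr h2 h2)
  exact prodMk h1 (cond (or (fst.comp (fst.comp hp)) hb) (cond hb h4 h3) (snd.comp hp))

theorem rawTrace (hr : PolyF r) (hu : PolyF u) : PolyF fun a => (r a).trace (u a) := by
  have hs : PolyF fun x : α × ((Bool × List Bool) × Bool × List Bool × List Bool) × Bool =>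
      (r x.1).traceStep x.2.1 x.2.2 :=
    rawTraceStep (hr.comp fst) (fst.comp snd) (snd.comp snd)
  -- The register and the two recorded strings are each the identity, the generator, a value of the
  -- circuit, or empty, hence of size at most `M` below. The `10` covers two flags and four pair
  -- nodes.
  have hB : PB fun a => 3 * (4 * sz (r a).l + sz (r a).ident + sz (r a).gen + 4) + 10 :=
    ((PB.const 3).mul (((((PB.const 4).mul (rawL hr).pb_sz).add (rawIdent hr).pb_sz).add
      (rawGen hr).pb_sz).add (PB.const 4))).add (PB.const 10)
  have key : PolyF fun a => (u a).foldl (r a).traceStep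
      (((false, (r a).ident), false, [], []) :
        (Bool × List Bool) × Bool × List Bool × List Bool) := by
    refine foldl_of_le (g := fun x => (r x.1).traceStep x.2.1 x.2.2) hu
      (s := fun a => ((false, (r a).ident), false, [], [])) (by fun_prop) hs hB fun a l₁ _ => ?_
    set M := 4 * sz (r a).l + sz (r a).ident + sz (r a).gen + 4 with hM
    have hop : ∀ u v, sz ((r a).op u v) ≤ M := fun u v => by
      have := sz_op_le (r a) u v
      rw [hM, sz_nat]; omega
    have hgen : sz (r a).gen ≤ M := by omega
    have hrec : ∀ (w : Bool × List Bool × List Bool) (u v : List Bool), sz w.2.1 ≤ M →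
        sz w.2.2 ≤ M → sz u ≤ M → sz v ≤ M → sz ((r a).record w u v).2.1 ≤ M ∧
          sz ((r a).record w u v).2.2 ≤ M := fun w u v h1 h2 h3 h4 => by
      rw [Raw.record]
      cases w.1 || (r a).below ((r a).op u v)
      · exact ⟨h3, h4⟩
      · exact ⟨h1, h2⟩
    have hinv : ∀ (l₁ : List Bool) (p : (Bool × List Bool) × Bool × List Bool × List Bool),
        sz p.1.2 ≤ M → sz p.2.2.1 ≤ M → sz p.2.2.2 ≤ M →
        sz (l₁.foldl (r a).traceStep p) ≤ 3 * M + 10 := by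
      intro l₁
      induction l₁ with
      | nil =>
        intro p h1 h2 h3
        have h4 := sz_bool_le p.1.1
        have h5 := sz_bool_le p.2.1
        have h6 : sz p = (sz p.1.1 + sz p.1.2 + 1) + (sz p.2.1 + (sz p.2.2.1 + sz p.2.2.2 + 1) + 1) + 1 :=
          rfl
        rw [List.foldl_nil, h6]
        omega
      | cons b l ih =>
        intro p h1 h2 h3
        have h4 := hrec p.2 p.1.2 p.1.2 h2 h3 h1 h1
        have h5 := hrec _ (r a).gen ((r a).op p.1.2 p.1.2) h4.1 h4.2 hgen (hop _ _)
        have h6 : sz ((r a).idxStep p.1 b).2 ≤ M := by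
          rw [Raw.idxStep]
          cases p.1.1 || b
          · exact h1
          · cases b <;> exact hop _ _
        have h7 : sz ((r a).traceStep p b).2.2.1 ≤ M ∧ sz ((r a).traceStep p b).2.2.2 ≤ M := by
          rw [Raw.traceStep]
          cases p.1.1 || b
          · exact ⟨h2, h3⟩
          · cases b
            · exact h4
            · exact h5
        exact ih _ h6 h7.1 h7.2
    exact hinv l₁ _ (by simp only; omega) (by simp only [sz_nil]; omega)
      (by simp only [sz_nil]; omega)
  exact cond (fst.comp (fst.comp key)) (snd.comp key)
    (rawRecord hr (snd.comp key) (rawIdent hr) (rawIdent hr))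

end PolyF

/-- The instance of Pigeon for an instance of Index. -/
def indexToPigeon (x : List Bool) : List Bool :=
  let r := (parseRaw x).1
  let q := indexCircuit x r
  encUnary (x.length + r.l) ++ encList encGate q.1.2 ++ encList encUnary q.2

/-- Translate solutions of Pigeon to solutions of Index. -/
def pigeonSolToIndex (y : List Bool) : List Bool :=
  let ys := (parseStrs y).1
  let p := parseRaw (ys.headD [])
  let v := (parseRaw (ys.tail.headD [])).2
  let t := p.1.trace (bif p.1.below p.2 then p.2 else v)
  bif decide (ys.length = 1) then encList encStr [p.2] else
    bif p.1.below p.2 && p.1.below v then encList encStr [p.2, v] else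
      encList encStr [t.2.1, t.2.2]

theorem polyF_indexToPigeon : PolyF indexToPigeon := by
  have h1 : PolyF fun x : List Bool => (parseRaw x).1 := by fun_prop
  have h2 := PolyF.indexCircuit PolyF.id' h1
  exact ((PolyF.encUnary (n := fun x => x.length + (parseRaw x).1.l) (by fun_prop)).append
    (PolyF.encList (PolyF.encGate PolyF.id') (PolyF.snd.comp (PolyF.fst.comp h2)))).append
    (PolyF.encList (PolyF.encUnary PolyF.id') (PolyF.snd.comp h2))

theorem polyF_pigeonSolToIndex : PolyF pigeonSolToIndex := by
  have h1 : PolyF fun y : List Bool => (parseStrs y).1 := by fun_prop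
  have hp : PolyF fun y : List Bool => parseRaw ((parseStrs y).1.headD []) := by fun_prop
  have hv : PolyF fun y : List Bool => (parseRaw ((parseStrs y).1.tail.headD [])).2 := by fun_prop
  have hu := PolyF.snd.comp hp
  have hr := PolyF.fst.comp hp
  have ht := PolyF.snd.comp
    (PolyF.rawTrace hr (PolyF.cond (PolyF.rawBelow hr hu) hu hv))
  have hE : PolyF encStr := PolyF.encStr PolyF.id'
  have hn := PolyF.const (α := List Bool) ([] : List (List Bool))
  refine PolyF.cond (by fun_prop) (hE.encList (hu.listCons hn))
    (PolyF.cond ((PolyF.rawBelow hr hu).and (PolyF.rawBelow hr hv))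
      (hE.encList (hu.listCons (hv.listCons hn)))
      (hE.encList ((PolyF.fst.comp ht).listCons ((PolyF.snd.comp ht).listCons hn))))

theorem length_indexMap {x : List Bool} {r : Raw} (hr : r.Ok) {w u : List Bool}
    (hw : w.length = x.length) (hu : u.length = r.l) :
    (indexMap x r w u).length = x.length + r.l := by
  have h1 : (bif x == w then (bif ltB u r.s then r.idx u else u) else u).length = r.l := by
    cases x == w
    · exact hu
    · cases ltB u r.s
      · exact hu
      · exact r.length_idx hr u
  rw [indexMap, List.length_append, List.length_zipWith, List.length_zipWith, h1, hw, hr.target,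
    min_self, min_self]

theorem exists_pigeonInput {u w bs : List Bool} {R : Bld × List ℕ} (h : Adds u w R bs)
    (hl : bs.length = u.length) : ∃ p : PigeonInput, p.n = u.length ∧
      p.enc = encUnary u.length ++ encList encGate R.1.2 ++ encList encUnary R.2 ∧
      ∀ v, p.C.eval v = evalC R.1.2 R.2 v := by
  obtain ⟨x, hx, hh⟩ := h
  exact ⟨⟨u.length, ⟨R.1.2, R.2, hx.2.1, hx.outputs_below hh, hh.length_eq.trans hl⟩⟩, rfl, rfl,
    fun _ => rfl⟩

theorem IndexInput.indexToPigeon_spec (i : IndexInput) :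
    ∃ p : PigeonInput, p.enc = indexToPigeon i.enc ∧ p.n = i.enc.length + i.l ∧
      ∀ w u : List Bool, w.length = i.enc.length → u.length = i.l →
        p.C.eval (w ++ u) = indexMap i.enc i.toRaw w u := by
  have h1 := i.parseRaw_enc []
  rw [List.append_nil] at h1
  have h2 : indexToPigeon i.enc = encUnary (i.enc.length + i.l) ++
      encList encGate (indexCircuit i.enc i.toRaw).1.2 ++
      encList encUnary (indexCircuit i.enc i.toRaw).2 := by
    simp only [indexToPigeon, h1, i.toRaw_l]
  have hok := i.ok_toRaw
  have hrl := i.toRaw_l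
  generalize i.enc = x at *
  generalize i.toRaw = r at *
  rw [← hrl] at *
  -- The circuit is well formed because it is so on the zero input; this depends only on the length
  -- of the input.
  have hw₀ : (List.replicate x.length false).length = x.length := List.length_replicate
  have hu₀ : (List.replicate r.l false).length = r.l := List.length_replicate
  obtain ⟨p, hp1, hp2, hp3⟩ := exists_pigeonInput (ok_indexCircuit hok hw₀ hu₀) (by
    rw [length_indexMap hok hw₀ hu₀, List.length_append, hw₀, hu₀])
  rw [List.length_append, hw₀, hu₀] at hp1 hp2
  refine ⟨p, hp2.trans h2.symm, hp1, fun w u hw hu => ?_⟩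
  obtain ⟨y, hy, hh⟩ := ok_indexCircuit hok hw hu
  rw [hp3]
  exact hy.evalC hh

/-- Every Pigeon solution has the form `x ++ u` or the pair `x ++ u`, `x ++ v` with `x` the encoded
instance, so the map back can parse the instance and evaluate its circuit. -/
theorem reducible_index_pigeon : Reducible Index Pigeon := by
  refine ⟨indexToPigeon, pigeonSolToIndex, polyF_indexToPigeon.polyTime fun _ => rfl,
    polyF_pigeonSolToIndex.polyTime fun _ => rfl, fun x y hy i hi => ?_⟩
  subst hi
  obtain ⟨p, hp, hn, hev⟩ := i.indexToPigeon_spec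
  have hsel : ∀ u : List Bool, u.length = i.l →
      i.toRaw.below u = ltB u i.toRaw.s := fun u hu => by
    simp [Raw.below, hu, i.toRaw_l]
  have hparse : ∀ u, parseRaw (i.enc ++ u) = (i.toRaw, u) := i.parseRaw_enc
  have hsplit : ∀ z : List Bool, z.length = p.n → ∃ w u, z = w ++ u ∧
      w.length = i.enc.length ∧ u.length = i.l := fun z hz =>
    ⟨z.take i.enc.length, z.drop i.enc.length, by simp, by simp [hz, hn], by simp [hz, hn]⟩
  have hlen : ∀ b u, u.length = i.l →
      (bif b then (bif ltB u i.toRaw.s then i.toRaw.idx u else u) else u).length = i.l := by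
    intro b u hu
    cases b
    · exact hu
    · cases ltB u i.toRaw.s
      · exact hu
      · exact (i.idx_toRaw u).2
  have htl : i.toRaw.target.length = i.l := i.ok_toRaw.target.trans i.toRaw_l
  rw [i.sol_iff]
  rcases hy p hp with ⟨z, hz, rfl, h⟩ | ⟨z, z', hz, hz', rfl, hne, h⟩
  · obtain ⟨w, u, rfl, hw, hu⟩ := hsplit z hz
    rw [hev w u hw hu, hn, List.replicate_add, indexMap] at h
    obtain ⟨h1, h2⟩ := List.append_inj h (by simp [hw])
    rw [← zipWith_xor_self] at h1
    obtain rfl := zipWith_xor_cancel hw.symm h1 rfl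
    rw [beq_self_eq_true, cond_true, ← htl, ← zipWith_xor_self] at h2
    have h3 := zipWith_xor_cancel (htl.trans (hlen true u hu).symm) h2 rfl
    rw [cond_true] at h3
    -- Outside of `[s]` the map is the identity before the target is added, so `u` would be the
    -- target itself, which lies in `[s]`.
    have hb : i.toRaw.below u = true := by
      rw [hsel u hu]
      by_contra hb
      rw [Bool.not_eq_true] at hb
      rw [hb, cond_false] at h3
      have h4 := (i.below_toRaw_iff _).2 ⟨_, i.target.2, rfl⟩
      have h5 := hsel _ hu
      rw [h3] at h5 hb
      rw [hb] at h5
      exact absurd (h4.symm.trans h5) (by simp)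
    refine Or.inl ⟨u, hb, ?_, ?_⟩
    · rw [pigeonSolToIndex]
      simp only [parseStrs_encList, List.headD_cons, hparse, List.length_singleton]
      rfl
    · rwa [← hsel u hu, hb, cond_true] at h3
  · obtain ⟨w, u, rfl, hw, hu⟩ := hsplit z hz
    obtain ⟨w', v, rfl, hw', hv⟩ := hsplit z' hz'
    rw [hev w u hw hu, hev w' v hw' hv, indexMap, indexMap] at h
    obtain ⟨h1, h2⟩ := List.append_inj h (by simp [hw, hw'])
    obtain rfl := zipWith_xor_cancel hw.symm h1 hw'.symm
    have h3 := zipWith_xor_cancel (htl.trans (hlen _ u hu).symm) h2 (htl.trans (hlen _ v hv).symm)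
    have huv : u ≠ v := fun h => hne (by rw [h])
    -- If `w` is not the instance, only the target is added to `u` and `v`, so they cannot collide.
    cases hx : i.enc == w
    · rw [hx] at h3
      exact (huv h3).elim
    obtain rfl := beq_iff_eq.1 hx
    rw [beq_self_eq_true, cond_true, cond_true, ← hsel u hu, ← hsel v hv] at h3
    have htr : ∀ u, i.toRaw.below (i.toRaw.idx u) = false → i.toRaw.Bad (i.toRaw.trace u).2 :=
      fun u hb => by
        have h4 := Raw.trace_spec i.below_ident i.below_gen u
        cases ht : (i.toRaw.trace u).1
        · rw [h4.2 ht] at hb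
          exact absurd hb (by simp)
        · exact h4.1 ht
    have hg : pigeonSolToIndex (encList encStr [i.enc ++ u, i.enc ++ v]) =
        bif i.toRaw.below u && i.toRaw.below v then encList encStr [u, v] else
          encList encStr [(i.toRaw.trace (bif i.toRaw.below u then u else v)).2.1,
            (i.toRaw.trace (bif i.toRaw.below u then u else v)).2.2] := by
      rw [pigeonSolToIndex]
      simp only [parseStrs_encList, List.headD_cons, List.tail_cons, hparse]
      rfl
    rw [hg]
    -- If neither string is below `s`, both are fixed and hence equal. If exactly one is, its index
    -- value is the other string, which is outside of `[s]`, so its trace contains a bad pair. If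
    -- both are, their index values collide.
    cases hbu : i.toRaw.below u <;> cases hbv : i.toRaw.below v <;> rw [hbu, hbv] at h3 <;>
      simp only [cond_true, cond_false, Bool.and_true, Bool.and_false] at h3 ⊢
    · exact (huv h3).elim
    · exact Or.inr (Or.inl ⟨_, htr v (h3 ▸ hbu), rfl⟩)
    · exact Or.inr (Or.inl ⟨_, htr u (h3 ▸ hbv), rfl⟩)
    · exact Or.inr (Or.inr ⟨u, v, hbu, hbv, rfl, huv, h3⟩)


/-! ### Pigeon is reducible to Index -/

/-- For a circuit with `n` inputs and outputs, a circuit on two strings of length `n + 2`. If the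
last bits of the strings agree, then it shifts the second string to the left. Otherwise it sets the
last bit of the second string, and applies the given circuit to its interior if its first bit is
set. -/
def pushCircuit (n : ℕ) (G : List Gate) (O : List ℕ) : Bld × List ℕ :=
  let c := consts (2 * (n + 2), []) [false, true]
  let k := inst c.1 G O (rng (n + 3) n)
  let m := mux k.1 (n + 2) k.2 (rng (n + 3) n)
  let sh := rng (n + 3) (n + 1) ++ [c.2.headD 0]
  let ap := (n + 2) :: (m.2 ++ [c.2.tail.headD 0])
  let p := mux m.1 (2 * n + 3) sh ap
  let p' := mux p.1 (2 * n + 3) ap sh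
  mux p'.1 (n + 1) p.2 p'.2

theorem PolyF.polyF_pushCircuit : PolyF fun x : ℕ × List Gate × List ℕ =>
    pushCircuit x.1 x.2.1 x.2.2 := by
  have h0 : PolyF fun x : ℕ × List Gate × List ℕ => PPPIndex.rng (x.1 + 3) x.1 := by fun_prop
  have h1 : PolyF fun x : ℕ × List Gate × List ℕ =>
      PPPIndex.consts (2 * (x.1 + 2), []) [false, true] := by fun_prop
  have h2 := inst (fst.comp h1) (fst.comp snd) (snd.comp snd) h0
  have h3 := mux (c := fun x : ℕ × List Gate × List ℕ => x.1 + 2) (fst.comp h2) (by fun_prop)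
    (snd.comp h2) h0
  have hn := const (α := ℕ × List Gate × List ℕ) ([] : List ℕ)
  have h4 : PolyF fun x : ℕ × List Gate × List ℕ => PPPIndex.rng (x.1 + 3) (x.1 + 1) := by fun_prop
  have h5 := append h4 (listCons (headD (snd.comp h1) (const 0)) hn)
  have h6 := listCons (f := fun x : ℕ × List Gate × List ℕ => x.1 + 2) (by fun_prop)
    (append (snd.comp h3) (listCons (headD (tail' (snd.comp h1)) (const 0)) hn))
  have h7 : PolyF fun x : ℕ × List Gate × List ℕ => 2 * x.1 + 3 := by fun_prop
  have h8 := mux (fst.comp h3) h7 h5 h6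
  have h9 := mux (fst.comp h8) h7 h6 h5
  exact mux (c := fun x : ℕ × List Gate × List ℕ => x.1 + 1) (fst.comp h9) (by fun_prop)
    (snd.comp h8) (snd.comp h9)

theorem holds_of_eq {w p bs x : List Bool} {N k : ℕ} (h : w = p ++ bs ++ x) (hN : N = p.length)
    (hk : k = bs.length) : Holds w (rng N k) bs := by
  rw [h, hN, hk]
  exact holds_rng p bs x

theorem holds_singleton_of_eq {w p x : List Bool} {b : Bool} {N : ℕ} (h : w = p ++ [b] ++ x)
    (hN : N = p.length) : Holds w [N] [b] := by
  have := holds_of_eq (k := 1) h hN rfl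
  simpa [rng] using this

/-- The two arguments occupy the wires from `0` and from `n + 2`, so their last bits are the wires
`n + 1` and `2 * n + 3`. Selecting by one last bit in both orders, and then by the other, selects by
whether they agree. -/
theorem ok_pushCircuit (p : PigeonInput) {a z a' z' : Bool} {m m' : List Bool}
    (hm : m.length = p.n) (hm' : m'.length = p.n) :
    Adds (a :: (m ++ [z]) ++ a' :: (m' ++ [z'])) (a :: (m ++ [z]) ++ a' :: (m' ++ [z']))
      (pushCircuit p.n p.C.gates p.C.outputs)
      (bif xor z z' then a' :: ((bif a' then p.C.eval m' else m') ++ [true])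
        else m' ++ [z'] ++ [false]) := by
  set w := a :: (m ++ [z]) ++ a' :: (m' ++ [z']) with hw
  have ok0 : Ok w (2 * (p.n + 2), []) w := by
    have := ok_init w
    rwa [show w.length = 2 * (p.n + 2) by simp [hw, hm, hm']; ring] at this
  have hz : Holds w [p.n + 1] [z] :=
    holds_singleton_of_eq (p := a :: m) (x := a' :: (m' ++ [z'])) (by simp [hw]) (by simp [hm])
  have ha : Holds w [p.n + 2] [a'] :=
    holds_singleton_of_eq (p := a :: (m ++ [z])) (x := m' ++ [z']) (by simp [hw]) (by simp [hm])
  have hm1 : Holds w (rng (p.n + 3) p.n) m' :=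
    holds_of_eq (p := a :: (m ++ [z] ++ [a'])) (x := [z']) (by simp [hw]) (by simp [hm]) hm'.symm
  have hz' : Holds w [2 * p.n + 3] [z'] :=
    holds_singleton_of_eq (p := a :: (m ++ [z] ++ [a'] ++ m')) (x := []) (by simp [hw])
      (by simp [hm, hm']; ring)
  have ht : Holds w (rng (p.n + 3) (p.n + 1)) (m' ++ [z']) :=
    holds_of_eq (p := a :: (m ++ [z] ++ [a'])) (x := []) (by simp [hw]) (by simp [hm])
      (by simp [hm'])
  obtain ⟨x1, ok1, h1⟩ := ok_consts ok0 [false, true]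
  have h2 : Adds w (w ++ x1) (inst (consts (2 * (p.n + 2), []) [false, true]).1 p.C.gates
      p.C.outputs (rng (p.n + 3) p.n)) (p.C.eval m') :=
    ok_inst ok1 (hm1.mono x1) (by rw [hm']; exact p.C.gates_below)
      (by rw [hm']; exact p.C.outputs_below)
  obtain ⟨x2, ok2, h2⟩ := h2
  have hl : (p.C.eval m').length = m'.length := (p.C.length_eval m').trans hm'.symm
  obtain ⟨x3, ok3, h3⟩ := ok_mux ok2 ((ha.mono x1).mono x2) h2 ((hm1.mono x1).mono x2) hl
  have hl' : (bif a' then p.C.eval m' else m').length = m'.length := by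
    cases a'
    · rfl
    · exact hl
  have hsh := (((ht.mono x1).append h1.headD).mono x2).mono x3
  have hap := (((ha.mono x1).mono x2).mono x3).cons
    (h3.append ((h1.tail.headD.mono x2).mono x3))
  have hz1 := ((hz'.mono x1).mono x2).mono x3
  have hle : (m' ++ [z'] ++ [false]).length =
      (a' :: ((bif a' then p.C.eval m' else m') ++ [true])).length := by simp [hl']
  obtain ⟨x4, ok4, h4⟩ := ok_mux ok3 hz1 hsh hap hle
  obtain ⟨x5, ok5, h5⟩ := ok_mux ok4 (hz1.mono x4) (hap.mono x4) (hsh.mono x4) hle.symm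
  have h6 := ok_mux ok5 (((((hz.mono x1).mono x2).mono x3).mono x4).mono x5) (h4.mono x5) h5
    (by cases z' <;> simp [hl'])
  have h7 : Adds w w (pushCircuit p.n p.C.gates p.C.outputs) _ :=
    Adds.trans (y := x1) (Adds.trans (y := x2) (Adds.trans (y := x3) (Adds.trans (y := x4)
      (Adds.trans (y := x5) h6))))
  cases z <;> cases z' <;> exact h7

/-- The instance of Index for an instance of Pigeon. -/
def pushRaw (n : ℕ) (G : List Gate) (O : List ℕ) : Raw where
  s := true :: List.replicate (n + 2) false
  n := 2 * (n + 2)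
  G := (pushCircuit n G O).1.2
  O := (pushCircuit n G O).2
  ident := List.replicate (n + 2) false
  gen := false :: (List.replicate n false ++ [true])
  target := true :: (List.replicate n false ++ [true])

/-- The string without its first and last bits. -/
def interior (u : List Bool) : List Bool := u.tail.take (u.tail.length - 1)

theorem interior_cons_append (a : Bool) (m : List Bool) (z : Bool) :
    interior (a :: (m ++ [z])) = m := by
  simp [interior]

theorem exists_cons_append {u : List Bool} {n : ℕ} (h : u.length = n + 2) :
    ∃ a m z, u = a :: (m ++ [z]) ∧ m.length = n := by
  obtain _ | ⟨a, u⟩ := u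
  · simp at h
  rcases List.eq_nil_or_concat u with rfl | ⟨m, z, rfl⟩
  · simp at h
  · exact ⟨a, m, z, by simp, by simpa using h⟩

/-! ### The indexing function of the instance built from a Pigeon circuit -/

section
variable (p : PigeonInput)

/-- The instance of Index for an instance of Pigeon. -/
abbrev PigeonInput.raw : Raw := pushRaw p.n p.C.gates p.C.outputs

theorem PigeonInput.op_raw {a z a' z' : Bool} {m m' : List Bool} (hm : m.length = p.n)
    (hm' : m'.length = p.n) : p.raw.op (a :: (m ++ [z])) (a' :: (m' ++ [z'])) =
      bif xor z z' then a' :: ((bif a' then p.C.eval m' else m') ++ [true])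
        else m' ++ [z'] ++ [false] := by
  obtain ⟨x, hx, hh⟩ := ok_pushCircuit p (a := a) (z := z) (a' := a') (z' := z') hm hm'
  exact hx.evalC hh

theorem PigeonInput.raw_l : p.raw.l = p.n + 2 := by
  obtain ⟨x, hx, hh⟩ := ok_pushCircuit p (a := false) (z := false) (a' := false) (z' := false)
    (m := List.replicate p.n false) (m' := List.replicate p.n false) (by simp) (by simp)
  have h : (pushCircuit p.n p.C.gates p.C.outputs).2.length = p.n + 2 := by simpa using hh.length_eq
  exact h

/-- Here `s = 2 ^ (n + 2)`, so membership in `[s]` is a condition on the length alone, and solutions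
of the second kind cannot occur. -/
theorem PigeonInput.below_raw (u : List Bool) : p.raw.below u = true ↔ u.length = p.n + 2 := by
  rw [Raw.below, Bool.and_eq_true, decide_eq_true_iff, ltB_iff, p.raw_l]
  refine and_iff_left_of_imp fun h => ?_
  have := bc_lt u
  simp only [pushRaw, bc, bc_replicate_false, List.length_replicate]
  rw [h] at this
  simpa using this

theorem PigeonInput.valid_raw : p.raw.valid = true := by
  obtain ⟨x, hx, hh⟩ := ok_pushCircuit p (a := false) (z := false) (a' := false) (z' := false)
    (m := List.replicate p.n false) (m' := List.replicate p.n false) (by simp) (by simp)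
  have hb := hx.outputs_below hh
  have hg := hx.2.1
  simp only [Raw.valid, Bool.and_eq_true, decide_eq_true_iff, gatesBelowB_iff, List.all_eq_true,
    p.below_raw, p.raw_l]
  have hl : ∀ n, (false :: (List.replicate n false ++ [false]) ++
      false :: (List.replicate n false ++ [false])).length = 2 * (n + 2) := fun n => by
    simp; ring
  rw [hl] at hb hg
  exact ⟨rfl, by simp [pushRaw], by simp [pushRaw, clogStr], rfl, hg, hb, by simp [pushRaw],
    by simp [pushRaw], by simp [pushRaw]⟩

/-- The map computed by the indexing function of the instance. -/
def PigeonInput.push (u : List Bool) : List Bool :=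
  bif u.headD false && u.getLastD false then true :: (p.C.eval (interior u) ++ [true]) else u

theorem PigeonInput.push_cons_append (a : Bool) (m : List Bool) (z : Bool) :
    p.push (a :: (m ++ [z])) = a :: ((bif a && z then p.C.eval m else m) ++ [z]) := by
  rw [push, interior_cons_append, ← List.cons_append, List.getLastD_concat]
  cases a <;> cases z <;> simp

/-- After a prefix has been read, the register is that prefix, padded on the left with zeros, with
`push` applied. A proper prefix leaves the first bit of the register `0`, so `push` is the identity
there, and the next squaring shifts out only a `0`. Only the last of `n + 2` bits can trigger the
circuit. -/
theorem PigeonInput.foldl_raw (u : List Bool) (hu : u.length ≤ p.n + 2) :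
    u.foldl p.raw.idxStep (false, p.raw.ident) =
      (u.any id, p.push (List.replicate (p.n + 2 - u.length) false ++ u)) := by
  induction u using List.reverseRecOn with
  | nil => simp [push, pushRaw, List.replicate_succ]
  | append_singleton q b ih =>
    rw [List.length_append, List.length_singleton] at hu
    rw [List.foldl_append, ih (by omega)]
    set T := List.replicate (p.n + 1 - q.length) false ++ q with hT
    have hTl : T.length = p.n + 1 := by simp [hT]; omega
    have h1 : List.replicate (p.n + 2 - q.length) false ++ q = false :: T := by
      rw [show p.n + 2 - q.length = p.n + 1 - q.length + 1 by omega, List.replicate_succ]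
      rfl
    have h2 : List.replicate (p.n + 2 - (q ++ [b]).length) false ++ (q ++ [b]) = T ++ [b] := by
      rw [hT, List.append_assoc, List.length_append, List.length_singleton]
      congr 2
      omega
    have h3 : p.push (false :: T) = false :: T := by simp [push]
    obtain ⟨c, m, z, hc, hm⟩ := exists_cons_append (u := false :: T) (n := p.n) (by simp [hTl])
    obtain ⟨a', m', z', ha', hm'⟩ := exists_cons_append (u := T ++ [false]) (n := p.n)
      (by simp [hTl])
    obtain ⟨hT', rfl⟩ : T = a' :: m' ∧ false = z' := by
      rw [← List.cons_append] at ha'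
      simpa using List.append_inj' ha' rfl
    have hv : p.raw.op (false :: T) (false :: T) = T ++ [false] := by
      obtain ⟨-, hmz⟩ := List.cons.inj hc
      rw [hc, p.op_raw hm hm, Bool.xor_self, cond_false, ← hmz]
    -- The generator ends in `1` and a fresh square in `0`, so the other branch of the operation is
    -- taken.
    have hg : p.raw.op p.raw.gen (T ++ [false]) = p.push (T ++ [true]) := by
      rw [ha', hT', List.cons_append, p.push_cons_append, Bool.and_true]
      exact p.op_raw (by simp) hm'
    have hs : p.push (T ++ [false]) = T ++ [false] := by
      rw [ha', p.push_cons_append, Bool.and_false, cond_false]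
    -- While only zeros have been read, no squaring is performed; this agrees with the shift because
    -- the register is all zeros.
    have hz : q.any id = false → false :: T = T ++ [false] := fun hq => by
      have hq' : q = List.replicate q.length false := List.eq_replicate_iff.2
        ⟨rfl, fun b hb => by simpa using List.any_eq_false.1 hq b hb⟩
      have : T = List.replicate (p.n + 1) false := by
        rw [hT, hq', List.length_replicate, List.replicate_append_replicate]
        congr 1
        omega
      rw [this, ← List.replicate_succ, ← List.replicate_succ']
    rw [h1, h2, h3, List.foldl_cons, List.foldl_nil, Raw.idxStep]
    simp only [hv, hg, List.any_append, List.any_cons, List.any_nil, Bool.or_false, id]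
    refine Prod.ext rfl ?_
    cases b
    · rw [hs]
      cases hq : q.any id
      · exact hz hq
      · rfl
    · rw [Bool.or_true]
      rfl

/-- At full length no padding remains. The zero string is treated separately, since there the value
is a square of the identity; that square is again zero, in agreement with `push`. -/
theorem PigeonInput.idx_raw {u : List Bool} (hu : u.length = p.n + 2) :
    p.raw.idx u = p.push u := by
  rw [Raw.idx, p.foldl_raw u hu.le, hu, Nat.sub_self, List.replicate_zero, List.nil_append]
  cases hq : u.any id
  · have hq' : u = List.replicate (p.n + 2) false := List.eq_replicate_iff.2
      ⟨hu, fun b hb => by simpa using List.any_eq_false.1 hq b hb⟩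
    have h1 : List.replicate (p.n + 2) false =
        false :: (List.replicate p.n false ++ [false]) := by
      rw [List.replicate_succ, List.replicate_succ']
    have h2 : p.raw.ident = List.replicate (p.n + 2) false := rfl
    rw [hq', h2, h1, p.push_cons_append]
    simp only [cond_false, Bool.and_false]
    rw [p.op_raw (by simp) (by simp), Bool.xor_self, cond_false, ← List.replicate_succ',
      ← List.replicate_succ', ← List.replicate_succ]
  · rfl

end

/-- Translate instances of Pigeon to instances of Index. -/
def pigeonToIndex (x : List Bool) : List Bool :=
  let a := parseUnary x
  let b := parseGates a.2
  (pushRaw a.1 b.1 (parseNats b.2).1).enc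

/-- Translate solutions of Index to solutions of Pigeon. -/
def indexSolToPigeon (y : List Bool) : List Bool :=
  encList encStr ((parseStrs y).1.map interior)

theorem polyF_pigeonToIndex : PolyF pigeonToIndex := by
  have h1 := PolyF.parseUnary (PolyF.id' (α := List Bool))
  have h2 := PolyF.parseGates (PolyF.snd.comp h1)
  have h3 := PolyF.parseNats (PolyF.snd.comp h2)
  have hn := PolyF.fst.comp h1
  have h4 := PolyF.polyF_pushCircuit.comp
    (hn.prodMk ((PolyF.fst.comp h2).prodMk (PolyF.fst.comp h3)))
  have h5 : PolyF fun n : ℕ => List.replicate n false ++ [true] :=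
    (PolyF.replicate PolyF.id' (PolyF.const false)).append (PolyF.const [true])
  have h7 : PolyF fun n : ℕ => 2 * (n + 2) := by fun_prop
  have h8 : PolyF fun n : ℕ => List.replicate (n + 2) false :=
    PolyF.replicate (by fun_prop) (PolyF.const false)
  have h6 : PolyF fun n : ℕ => true :: List.replicate (n + 2) false :=
    (PolyF.const true).listCons h8
  refine PolyF.rawEnc (PolyF.of_rawTuple ?_)
  exact (h6.comp hn).prodMk ((h7.comp hn).prodMk ((PolyF.snd.comp (PolyF.fst.comp h4)).prodMk
    ((PolyF.snd.comp h4).prodMk ((h8.comp hn).prodMk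
      (((PolyF.const false).listCons (h5.comp hn)).prodMk
        ((PolyF.const true).listCons (h5.comp hn)))))))

theorem polyF_indexSolToPigeon : PolyF indexSolToPigeon := by
  have h1 : PolyF fun x : List Bool => (parseStrs x).1 := by fun_prop
  have h2 : PolyF interior := by unfold interior; fun_prop
  exact PolyF.encList (PolyF.encStr PolyF.id')
    (PolyF.map (g := fun _ u => interior u) h1 (h2.comp PolyF.snd))

/-- `push` preserves the first and last bits. A value equal to the target or a collision of
different strings therefore forces both outer bits to be `1`, and the statement passes to the
interiors, on which `push` acts by the Pigeon circuit. Removing the outer bits needs no knowledge of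
the instance. -/
theorem reducible_pigeon_index : Reducible Pigeon Index := by
  refine ⟨pigeonToIndex, indexSolToPigeon, polyF_pigeonToIndex.polyTime fun _ => rfl,
    polyF_indexSolToPigeon.polyTime fun _ => rfl, fun x y hy p hp => ?_⟩
  subst hp
  obtain ⟨i, hi⟩ := (Raw.valid_iff _).1 p.valid_raw
  have henc : pigeonToIndex p.enc = i.enc := by
    rw [← i.enc_toRaw, hi, pigeonToIndex, PigeonInput.enc, encCircuit]
    have h1 := parses_parseNats p.C.outputs []
    rw [List.append_nil] at h1
    simp only [List.append_assoc, parses_parseUnary _ _, parses_parseGates _ _, h1]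
  have htarget : ∀ u, u.length = p.n + 2 → p.push u = true :: (List.replicate p.n false ++ [true]) →
      p.C.eval (interior u) = List.replicate p.n false := fun u hu h => by
    obtain ⟨a, m, z, rfl, hm⟩ := exists_cons_append hu
    rw [p.push_cons_append] at h
    obtain ⟨rfl, h⟩ := List.cons.inj h
    obtain ⟨h1, h2⟩ := List.append_inj' h rfl
    obtain rfl : z = true := by simpa using h2
    rwa [interior_cons_append]
  have hint : ∀ u, u.length = p.n + 2 → (interior u).length = p.n := fun u hu => by
    obtain ⟨a, m, z, rfl, hm⟩ := exists_cons_append hu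
    rwa [interior_cons_append]
  have hg : ∀ l, indexSolToPigeon (encList encStr l) = encList encStr (l.map interior) :=
    fun l => by rw [indexSolToPigeon, parseStrs_encList]
  rcases (i.sol_iff y).1 (hy i henc.symm) with ⟨u, hu, rfl, h⟩ | ⟨q, ⟨-, -, hq⟩, -⟩ |
    ⟨u, v, hu, hv, rfl, hne, h⟩
  · rw [hi, p.below_raw] at hu
    rw [hi, p.idx_raw hu] at h
    exact Or.inl ⟨interior u, hint u hu, hg _, htarget u hu h⟩
  -- A product has length `n + 2`, hence lies in `[s]`.
  · rw [hi, ← Bool.not_eq_true, p.below_raw, Raw.length_op, p.raw_l] at hq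
    exact (hq rfl).elim
  · rw [hi, p.below_raw] at hu hv
    rw [hi, p.idx_raw hu, p.idx_raw hv] at h
    refine Or.inr ⟨interior u, interior v, hint u hu, hint v hv, hg _, ?_⟩
    obtain ⟨a, m, z, rfl, hm⟩ := exists_cons_append hu
    obtain ⟨b, k, t, rfl, hk⟩ := exists_cons_append hv
    rw [p.push_cons_append, p.push_cons_append] at h
    rw [interior_cons_append, interior_cons_append]
    obtain ⟨rfl, h⟩ := List.cons.inj h
    obtain ⟨h1, h2⟩ := List.append_inj' h rfl
    obtain rfl : z = t := by simpa using h2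
    cases haz : a && z
    · rw [haz] at h1
      exact (hne (by rw [show m = k from h1])).elim
    · rw [haz] at h1
      exact ⟨fun hmk => hne (by rw [hmk]), h1⟩

/-! ### Composition of reductions and PPP-completeness -/

theorem Reducible.trans {S T U : SearchProblem} (h : Reducible S T) (h' : Reducible T U) :
    Reducible S U := by
  obtain ⟨f, g, hf, hg, hfg⟩ := h
  obtain ⟨f', g', hf', hg', hfg'⟩ := h'
  exact ⟨fun x => f' (f x), fun y => g (g' y), hf'.comp hf, hg.comp hg',
    fun x y hy => hfg _ _ (hfg' _ _ hy)⟩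

end PPPIndex

theorem mainTheorem2 : PPPIndex.IsPPPComplete PPPIndex.Index :=
  ⟨⟨PPPIndex.isTFNP_index, PPPIndex.reducible_index_pigeon⟩,
    fun _ hT => hT.2.trans PPPIndex.reducible_pigeon_index⟩
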